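/- **Setting.** Fix $m>0$ and $\alpha>-1$, and write $\langle v,I\rangle=\sqrt{1+\tfrac12|v|^2+\tfrac1m I}$ for $(v,I)\in\mathbb R^3\times\mathbb R_+$. Let $L^p=L^p(\mathbb R^3\times\mathbb R_+,\,dv\,dI)$ and $\|\chi\|_{L^1_2}=\int|\chi|\,\langle v,I\rangle^2\,dv\,dI$. For $v,v_*\in\mathbb R^3$, $I,I_*>0$, $\sigma\in\mathbb S^2$, $r,R\in[0,1]$ put $u=v-v_*$, $\hat u=u/|u|$, $E=\tfrac m4|u|^2+I+I_*$, $$v'=\tfrac{v+v_*}2+\sqrt{\tfrac{RE}m}\,\sigma,\quad v'_*=\tfrac{v+v_*}2-\sqrt{\tfrac{RE}m}\,\sigma,\quad I'=r(1-R)E,\quad I'_*=(1-r)(1-R)E,$$ and $d_\alpha(r,R)=r^\alpha(1-r)^\alpha(1-R)^{2\alpha+1}\sqrt R$. The collision operator is $Q(f,g)=Q^+(f,g)-Q^-(f,g)$, $Q^-(f,g)=f\,\nu[g]$, where, with $\mathbb S^2_+=\{\sigma\in\mathbb S^2:\hat u\cdot\sigma\ge0\}$, $$Q^+(f,g)(v,I)=\int_{\mathbb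 R^3\times\mathbb R_+}\int_{[0,1]^2\times\mathbb S^2_+} f(v',I')\,g(v'_*,I'_*)\Big(\frac{II_*}{I'I'_*}\Big)^{\alpha}\tilde{\mathcal B}\;b(\hat u\cdot\sigma)\,d_\alpha(r,R)\,d\sigma\,dR\,dr\,dv_*\,dI_*,$$ $$\nu[g](v,I)=\int_{\mathbb R^3\times\mathbb R_+}\int_{[0,1]^2\times\mathbb S^2_+} g(v_*,I_*)\,\tilde{\mathcal B}\;b(\hat u\cdot\sigma)\,d_\alpha(r,R)\,d\sigma\,dR\,dr\,dv_*\,dI_*,\qquad \tilde{\mathcal B}=\tilde{\mathcal B}(v,v_*,I,I_*,r,R).$$ The kernel is assumed to satisfy: $b\ge0$ is integrable on $[0,1]$; $\tilde{\mathcal B}\ge0$ is measurable and invariant under $(v,v_*,I,I_*,r,R)\mapsto\big(v',v'_*,I',I'_*,\tfrac I{I+I_*},\tfrac{m|u|^2}{4E}\big)$ (for every $\sigma$) and under $(v,v_*,I,I_*,r,R)\mapsto(v_*,v,I_*,I,1-r,R)$; and, for some $\zeta\in(0,2]$, $$\tilde b^{lb}(r,R)\,(E/m)^{\zeta/2}\le\tilde{\mathcal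 B}\le\tilde b^{ub}(r,R)\,(E/m)^{\zeta/2},$$ where $\tilde b^{lb},\tilde b^{ub}\in L^1([0,1]^2;\,d_\alpha\,dr\,dR)$ and $\int_{[0,1]^2}\tilde b^{lb}\,d_\alpha\,dr\,dR>0$. A *solution of the Boltzmann equation* with initial datum $f_0$ is a function $0\le f\in C([0,\infty),L^1_2)\cap C^1((0,\infty),L^1_2)$ with $f(0)=f_0$ such that, for every $t>0$, $Q^\pm(f(t),f(t))\in L^1_2$ and $\partial_tf(t)=Q(f(t),f(t))$. **Lemma.** Let $m>0$, $\alpha>-1$ and $p\in(1,\infty]$. There is a function $C=C_{m,\alpha,p}:\mathbb R^2\to\mathbb R$ such that, for all $\zeta,b,\tilde{\mathcal B},\tilde b^{lb},\tilde b^{ub}$ as above and every solution $f$ of the Boltzmann equation whose initial datum satisfies $f_0\in L^1_2\cap L^p$, $$H[f(t)]:=\int_{\mathbb R^3\times\mathbb R_+}f(t,v,I)\,\big|\log\!\big(f(t,v,I)\,I^{-\alpha}\big)\big|\,dv\,dI\;\le\;C\big(\|f_0\|_{L^1_2},\|f_0\|_{L^p}\big)\qquad\text{for all }t\ge0$$ (with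 the convention $0\log0=0$). -/

import Mathlib

open MeasureTheory Set
open scoped ENNReal RealInnerProductSpace

namespace PolyBoltzmann

noncomputable section

/-- The velocity space `ℝ³` with its Euclidean norm. -/
abbrev Vel : Type := EuclideanSpace ℝ (Fin 3)

/-- The unit sphere `𝕊²` of `ℝ³`. -/
abbrev S2 : Type := Metric.sphere (0 : Vel) 1

/-- The surface measure `dσ` on `𝕊²` (of total mass `4π`). -/
def surf : Measure S2 := (volume : Measure Vel).toSphere

/-- The Lebesgue measure `dv dI` on `ℝ³ × ℝ₊`, as a measure on `ℝ³ × ℝ`. -/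
def stateMeasure : Measure (Vel × ℝ) :=
  (volume : Measure Vel).prod ((volume : Measure ℝ).restrict (Ioi 0))

/-- The Lebesgue bracket `⟨v, I⟩ = √(1 + |v|²/2 + I/m)`. -/
def bracket (m : ℝ) (z : Vel × ℝ) : ℝ := √(1 + ‖z.1‖ ^ 2 / 2 + z.2 / m)

/-- The measure `⟨v, I⟩² dv dI`. -/
def energyMeasure (m : ℝ) : Measure (Vel × ℝ) :=
  stateMeasure.withDensity fun z => ENNReal.ofReal (bracket m z ^ 2)

/-- The Banach space `L¹₂(ℝ³ × ℝ₊)`, with norm `∫ |χ(v, I)| ⟨v, I⟩² dv dI`. -/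
abbrev L12 (m : ℝ) : Type := Lp ℝ 1 (energyMeasure m)

/-- The collisional energy `E = (m/4) |v - v_*|² + I + I_*`. -/
def collE (m : ℝ) (v vs : Vel) (I Is : ℝ) : ℝ := m / 4 * ‖v - vs‖ ^ 2 + I + Is

/-- `v' = (v + v_*)/2 + √(R E / m) σ`. -/
def vPost (m : ℝ) (v vs : Vel) (I Is : ℝ) (σ : Vel) (R : ℝ) : Vel :=
  (1 / 2 : ℝ) • (v + vs) + √(R * collE m v vs I Is / m) • σ

/-- `v'_* = (v + v_*)/2 - √(R E / m) σ`. -/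
def vsPost (m : ℝ) (v vs : Vel) (I Is : ℝ) (σ : Vel) (R : ℝ) : Vel :=
  (1 / 2 : ℝ) • (v + vs) - √(R * collE m v vs I Is / m) • σ

/-- `I' = r (1 - R) E`. -/
def iPost (m : ℝ) (v vs : Vel) (I Is r R : ℝ) : ℝ := r * (1 - R) * collE m v vs I Is

/-- `I'_* = (1 - r) (1 - R) E`. -/
def isPost (m : ℝ) (v vs : Vel) (I Is r R : ℝ) : ℝ := (1 - r) * (1 - R) * collE m v vs I Is

/-- `d_α(r, R) = r^α (1 - r)^α (1 - R)^(2α+1) √R`. -/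
def dAlpha (α r R : ℝ) : ℝ := r ^ α * (1 - r) ^ α * (1 - R) ^ (2 * α + 1) * √R

/-- The direction `û = u / |u|`. -/
def dir (u : Vel) : Vel := ‖u‖⁻¹ • u

/-- The half sphere `𝕊²₊ = {σ : û · σ ≥ 0}`. -/
def halfSphere (u : Vel) : Set S2 := {σ | 0 ≤ ⟪dir u, (σ : Vel)⟫}

/-- The standing assumptions on the collision kernel
`b(û · σ) B(v, v_*, I, I_*, r, R)`: nonnegativity, an integrable angular part (cut-off),
micro-reversibility, and two-sided bounds of `ζ`-hard-potential type. -/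
structure IsHardKernel (m α ζ : ℝ) (b : ℝ → ℝ) (B : Vel → Vel → ℝ → ℝ → ℝ → ℝ → ℝ)
    (blb bub : ℝ → ℝ → ℝ) : Prop where
  zeta_pos : 0 < ζ
  zeta_le : ζ ≤ 2
  measurable_b : Measurable b
  b_nonneg : ∀ x ∈ Icc (0 : ℝ) 1, 0 ≤ b x
  b_integrable : IntegrableOn b (Icc 0 1)
  measurable_B : Measurable fun x : Vel × Vel × ℝ × ℝ × ℝ × ℝ =>
    B x.1 x.2.1 x.2.2.1 x.2.2.2.1 x.2.2.2.2.1 x.2.2.2.2.2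
  B_nonneg : ∀ v vs I Is r R, 0 < I → 0 < Is → r ∈ Ioo (0 : ℝ) 1 → R ∈ Ioo (0 : ℝ) 1 →
    0 ≤ B v vs I Is r R
  /-- Invariance under the exchange of pre- and post-collisional states. -/
  B_reverse : ∀ (v vs : Vel) (I Is r R : ℝ) (σ : S2), v ≠ vs → 0 < I → 0 < Is →
    r ∈ Ioo (0 : ℝ) 1 → R ∈ Ioo (0 : ℝ) 1 →
    B (vPost m v vs I Is σ R) (vsPost m v vs I Is σ R)
      (iPost m v vs I Is r R) (isPost m v vs I Is r R)
      (I / (I + Is)) (m * ‖v - vs‖ ^ 2 / (4 * collE m v vs I Is)) = B v vs I Is r R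
  /-- Invariance under the exchange of the two molecules. -/
  B_swap : ∀ (v vs : Vel) (I Is r R : ℝ), 0 < I → 0 < Is →
    r ∈ Ioo (0 : ℝ) 1 → R ∈ Ioo (0 : ℝ) 1 → B vs v Is I (1 - r) R = B v vs I Is r R
  lower_bound : ∀ v vs I Is r R, 0 < I → 0 < Is → r ∈ Ioo (0 : ℝ) 1 → R ∈ Ioo (0 : ℝ) 1 →
    blb r R * (collE m v vs I Is / m) ^ (ζ / 2) ≤ B v vs I Is r R
  upper_bound : ∀ v vs I Is r R, 0 < I → 0 < Is → r ∈ Ioo (0 : ℝ) 1 → R ∈ Ioo (0 : ℝ) 1 →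
    B v vs I Is r R ≤ bub r R * (collE m v vs I Is / m) ^ (ζ / 2)
  blb_integrable : IntegrableOn (fun x : ℝ × ℝ => blb x.1 x.2 * dAlpha α x.1 x.2)
    (Icc 0 1 ×ˢ Icc 0 1)
  bub_integrable : IntegrableOn (fun x : ℝ × ℝ => bub x.1 x.2 * dAlpha α x.1 x.2)
    (Icc 0 1 ×ˢ Icc 0 1)
  /-- The lower bound is not void. -/
  blb_pos : 0 < ∫ x in Icc (0 : ℝ) 1 ×ˢ Icc (0 : ℝ) 1, blb x.1 x.2 * dAlpha α x.1 x.2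

/-- The gain term `Q⁺(f, g)(v, I)` of nonnegative `f`, `g`, as an element of `[0, ∞]`. -/
def gain (m α : ℝ) (b : ℝ → ℝ) (B : Vel → Vel → ℝ → ℝ → ℝ → ℝ → ℝ) (f g : Vel × ℝ → ℝ)
    (z : Vel × ℝ) : ℝ≥0∞ :=
  ∫⁻ w : Vel × ℝ, (∫⁻ r in Icc (0 : ℝ) 1, (∫⁻ R in Icc (0 : ℝ) 1,
    (∫⁻ σ in halfSphere (z.1 - w.1), ENNReal.ofReal
      (f (vPost m z.1 w.1 z.2 w.2 σ R, iPost m z.1 w.1 z.2 w.2 r R) *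
        g (vsPost m z.1 w.1 z.2 w.2 σ R, isPost m z.1 w.1 z.2 w.2 r R) *
        (z.2 * w.2 / (iPost m z.1 w.1 z.2 w.2 r R * isPost m z.1 w.1 z.2 w.2 r R)) ^ α *
        B z.1 w.1 z.2 w.2 r R * b ⟪dir (z.1 - w.1), (σ : Vel)⟫ * dAlpha α r R)
      ∂surf))) ∂stateMeasure

/-- The collision frequency `ν[g](v, I)` of a nonnegative `g`, as an element of `[0, ∞]`. -/
def collFreq (α : ℝ) (b : ℝ → ℝ) (B : Vel → Vel → ℝ → ℝ → ℝ → ℝ → ℝ) (g : Vel × ℝ → ℝ)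
    (z : Vel × ℝ) : ℝ≥0∞ :=
  ∫⁻ w : Vel × ℝ, (∫⁻ r in Icc (0 : ℝ) 1, (∫⁻ R in Icc (0 : ℝ) 1,
    (∫⁻ σ in halfSphere (z.1 - w.1), ENNReal.ofReal
      (g w * B z.1 w.1 z.2 w.2 r R * b ⟪dir (z.1 - w.1), (σ : Vel)⟫ * dAlpha α r R)
      ∂surf))) ∂stateMeasure

/-- The loss term `Q⁻(f, g) = f ν[g]` of nonnegative `f`, `g`. -/
def loss (α : ℝ) (b : ℝ → ℝ) (B : Vel → Vel → ℝ → ℝ → ℝ → ℝ → ℝ) (f g : Vel × ℝ → ℝ)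
    (z : Vel × ℝ) : ℝ≥0∞ :=
  ENNReal.ofReal (f z) * collFreq α b B g z

/-- The collision operator `Q = Q⁺ - Q⁻`, meaningful wherever both terms are finite. -/
def collOp (m α : ℝ) (b : ℝ → ℝ) (B : Vel → Vel → ℝ → ℝ → ℝ → ℝ → ℝ) (f g : Vel × ℝ → ℝ)
    (z : Vel × ℝ) : ℝ :=
  (gain m α b B f g z).toReal - (loss α b B f g z).toReal

/-- `f` is a solution, with initial datum `f 0`, of the space homogeneous Boltzmann equation
`∂ₜ f = Q(f, f)`: it is nonnegative, lies in `C([0,∞), L¹₂) ∩ C¹((0,∞), L¹₂)`, and for every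
`t > 0` the gain and the loss term belong to `L¹₂` and their difference is `∂ₜ f`.
(The values of `f` at negative times play no role.) -/
structure IsSolution (m α : ℝ) (b : ℝ → ℝ) (B : Vel → Vel → ℝ → ℝ → ℝ → ℝ → ℝ)
    (f : ℝ → L12 m) : Prop where
  nonneg : ∀ t, 0 ≤ t → ∀ᵐ z ∂stateMeasure, 0 ≤ f t z
  continuousOn : ContinuousOn f (Ici 0)
  contDiffOn : ContDiffOn ℝ 1 f (Ioi 0)
  gain_finite : ∀ t, 0 < t → ∫⁻ z, gain m α b B (f t) (f t) z ∂energyMeasure m < ∞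
  loss_finite : ∀ t, 0 < t → ∫⁻ z, loss α b B (f t) (f t) z ∂energyMeasure m < ∞
  equation : ∀ t, 0 < t → (deriv f t : L12 m) =ᵐ[stateMeasure] collOp m α b B (f t) (f t)

/-- The entropy-like quantity `H[f] = ∫ f |log (f I^(-α))| dv dI ∈ [0, ∞]` of a nonnegative
`f` (with `0 log 0 = 0`). -/
def entropyH (α : ℝ) (f : Vel × ℝ → ℝ) : ℝ≥0∞ :=
  ∫⁻ z, ENNReal.ofReal (f z * |Real.log (f z * z.2 ^ (-α))|) ∂stateMeasure

end

end PolyBoltzmann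

/-!
The entropy of a solution stays bounded because it does not increase. The entropy production
is not defined a priori for a solution that only has two moments, so the proof follows a truncated
entropy, with an error that disappears together with the truncation.

With respect to the measure `I^α dv dI` the solution has density `F = f I^(-α)`. Micro-reversibility
says that the joint law of the states before and after a collision, `collMeasure`, is invariant
under exchange of the two (`IsHardKernel.lintegral_collMeasure_swap`); it is also invariant under
exchange of the molecules (`IsHardKernel.lintegral_collMeasure_exchange`). This gives the weak form
`weak_form_symm` of the collision operator, hence conservation of mass and energy.

The truncated entropy is `∫ (F log a - a)`, where `a` is `F` truncated to `[e^(-n/8) x^(-q), e^n]`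
at states of energy `x`. Its production is the integral of the test function `log a`, which grows no
faster than the energy. The concavity of the logarithm makes the part of the production with the
densities `a` in place of `F` nonpositive. The remaining contributions are estimated in
`entropy_production_pointwise`. Where `F` exceeds the upper cut-off `e^n`, the factor `-log a = -n`
of the incoming molecule is favourable, unless an outgoing molecule is found where `F > e^(n/8)`.
That region has measure at most `e^(-n/8)` times the energy, and the law of an outgoing molecule
has a density, so few collisions lead into it (`IsHardKernel.exists_spread`, `exists_escape`). What
is left is at most `κ (X + n e^(-n/8)) (1 + Y)`, where `X` is the energy carried by the part of `F`
above `e^n` and `Y` the moment of order `ζ + 1` (`exists_entropy_production_le`).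

The moment `Y` need not be bounded in time, but it is integrable in time: every molecule keeps a
fraction of the energy of the pair, so collisions produce the square root of the energy at a rate
which controls `Y` (`IsHardKernel.exists_povzner`, `exists_sqrt_production`), while the total amount
of it is at most the energy. Since a solution is continuous in `L¹₂`, its values at times in
`[0, T]` form a compact set, on which `X` tends to zero uniformly as `n → ∞`
(`exists_excessEnergy_le`). The truncated entropy need not be differentiable in time, but the
convexity of its integrand bounds the left difference quotients, which suffices
(`le_of_left_slope_nonpos`, `IsSolution.truncEntropy_le`). Thus
the truncated entropy at time `T` exceeds the initial one by
at most a quantity that vanishes as `n → ∞` (`IsSolution.exists_truncEntropy_le`), whatever the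
kernel is.

Finally, Fatou's lemma removes the truncation; the negative part of the entropy is controlled by the
energy (`mul_neg_log_le`), and the initial entropy by the energy and the `L^p` norm
(`integral_gasDensity_posLog_le`).
-/

namespace PolyBoltzmann

/-! ### Integration in polar and quadrant coordinates -/

theorem lintegral_Ioi_mul_left {a : ℝ} (ha : 0 < a) (g : ℝ → ℝ≥0∞) :
    ∫⁻ x in Ioi (0 : ℝ), g x = ∫⁻ x in Ioi (0 : ℝ), ENNReal.ofReal a * g (a * x) := by
  have himg : (fun x : ℝ => a * x) '' Ioi 0 = Ioi 0 := by
    ext y; constructor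
    · rintro ⟨x, hx, rfl⟩; exact mul_pos ha hx
    · intro hy; exact ⟨y / a, div_pos hy ha, by field_simp⟩
  have h := lintegral_image_eq_lintegral_abs_deriv_mul (s := Ioi (0 : ℝ)) (f := fun x => a * x)
    (f' := fun _ => a) measurableSet_Ioi
    (fun x _ => by simpa using ((hasDerivAt_id x).const_mul a).hasDerivWithinAt)
    (fun x _ y _ hxy => mul_left_cancel₀ ha.ne' hxy) g
  rw [himg] at h
  rw [h]; simp [abs_of_pos ha]

theorem lintegral_Ioi_comp_sqrt (g : ℝ → ℝ≥0∞) :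
    ∫⁻ x in Ioi (0 : ℝ), ENNReal.ofReal (x ^ 2) * g x =
      ∫⁻ k in Ioi (0 : ℝ), ENNReal.ofReal (√k / 2) * g (√k) := by
  have himg : (fun x : ℝ => √x) '' Ioi 0 = Ioi 0 := by
    ext y; constructor
    · rintro ⟨x, hx, rfl⟩; exact Real.sqrt_pos.2 hx
    · intro hy; exact ⟨y ^ 2, by have : 0 < y := hy; exact pow_pos this 2,
        Real.sqrt_sq (le_of_lt hy)⟩
  have h := lintegral_image_eq_lintegral_abs_deriv_mul (s := Ioi (0 : ℝ)) (f := fun x => √x)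
    (f' := fun x => 1 / (2 * √x)) measurableSet_Ioi
    (fun x hx => (Real.hasDerivAt_sqrt (ne_of_gt hx)).hasDerivWithinAt)
    (fun x hx y hy hxy => (Real.sqrt_inj (le_of_lt hx) (le_of_lt hy)).1 hxy)
    (fun x => ENNReal.ofReal (x ^ 2) * g x)
  rw [himg] at h
  rw [h]
  refine setLIntegral_congr_fun measurableSet_Ioi fun k hk => ?_
  have hs : 0 < √k := Real.sqrt_pos.2 hk
  rw [← mul_assoc, ← ENNReal.ofReal_mul (abs_nonneg _), abs_of_pos (by positivity)]
  congr 2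
  field_simp

instance : IsFiniteMeasure surf := by unfold surf; infer_instance

/-- Polar coordinates in `ℝ³`, with the squared radius as radial variable. -/
theorem lintegral_vel_polar (h : Vel → ℝ≥0∞) (hh : Measurable h) :
    ∫⁻ u, h u = ∫⁻ k in Ioi (0 : ℝ), ENNReal.ofReal (√k / 2) *
      ∫⁻ σ, h (√k • (σ : Vel)) ∂surf := by
  have hmp := (volume : Measure Vel).measurePreserving_homeomorphUnitSphereProd
  have h1 : ∫⁻ u, h u = ∫⁻ x : S2 × Ioi (0 : ℝ), h (x.2.1 • (x.1 : Vel))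
      ∂(surf.prod (Measure.volumeIoiPow 2)) := by
    have hd : Module.finrank ℝ Vel - 1 = 2 := by simp
    rw [← restrict_compl_singleton (μ := (volume : Measure Vel)) 0,
      ← lintegral_subtype_comap (measurableSet_singleton _).compl]
    have h2 := hmp.lintegral_comp (f := fun x : S2 × Ioi (0 : ℝ) => h (x.2.1 • (x.1 : Vel)))
      (by fun_prop)
    rw [hd] at h2
    unfold surf
    rw [← h2]
    refine lintegral_congr fun u => ?_
    congr 1
    have hu : ‖(u : Vel)‖ ≠ 0 := norm_ne_zero_iff.2 u.2
    simp [smul_smul, hu]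
  have hm : Measurable fun x : S2 × ℝ => h (x.2 • (x.1 : Vel)) := by fun_prop
  rw [h1, lintegral_prod_symm' _ (by fun_prop)]
  have h3 : ∫⁻ x in Ioi (0 : ℝ), ENNReal.ofReal (x ^ 2) * ∫⁻ σ, h (x • (σ : Vel)) ∂surf =
      ∫⁻ k in Ioi (0 : ℝ), ENNReal.ofReal (√k / 2) * ∫⁻ σ, h (√k • (σ : Vel)) ∂surf :=
    lintegral_Ioi_comp_sqrt (fun x => ∫⁻ σ, h (x • (σ : Vel)) ∂surf)
  rw [← h3, ← lintegral_subtype_comap measurableSet_Ioi, Measure.volumeIoiPow,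
    lintegral_withDensity_eq_lintegral_mul _ (by fun_prop)]
  · rfl
  · exact (Measurable.lintegral_prod_left' hm).comp measurable_subtype_coe

/-- The coordinates `(I, J) = (r S, (1 - r) S)` of the quadrant. -/
theorem lintegral_quadrant (h : ℝ × ℝ → ℝ≥0∞) (hh : Measurable h) :
    ∫⁻ x in Ioi (0 : ℝ), ∫⁻ y in Ioi (0 : ℝ), h (x, y) =
      ∫⁻ s in Ioi (0 : ℝ), ENNReal.ofReal s *
        ∫⁻ r in Ioo (0 : ℝ) 1, h (r * s, (1 - r) * s) := by
  have e1 : ∀ x : ℝ, ∫⁻ y in Ioi (0 : ℝ), h (x, y) =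
      ∫⁻ s, (Ioi x).indicator (fun s => h (x, s - x)) s := by
    intro x
    rw [← lintegral_indicator measurableSet_Ioi,
      ← lintegral_sub_right_eq_self (fun y => (Ioi (0:ℝ)).indicator (fun y => h (x, y)) y) x]
    refine lintegral_congr fun s => ?_
    by_cases hs : x < s <;> simp [indicator, hs]
  have e2 : ∫⁻ x in Ioi (0 : ℝ), ∫⁻ y in Ioi (0 : ℝ), h (x, y) =
      ∫⁻ s, ∫⁻ x, (Ioo (0:ℝ) s).indicator (fun x => h (x, s - x)) x := by
    rw [lintegral_congr e1, ← lintegral_indicator measurableSet_Ioi]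
    have : ∀ x : ℝ, (Ioi (0:ℝ)).indicator (fun x => ∫⁻ s, (Ioi x).indicator
        (fun s => h (x, s - x)) s) x = ∫⁻ s, (Ioo (0:ℝ) s).indicator (fun x => h (x, s - x)) x := by
      intro x
      by_cases hx : 0 < x
      · rw [indicator_of_mem (by exact hx)]
        refine lintegral_congr fun s => ?_
        by_cases hs : x < s <;> simp [indicator, hs, hx]
      · rw [indicator_of_notMem (by exact hx)]
        simp [indicator, hx]
    rw [lintegral_congr this, lintegral_lintegral_swap]
    have : (Function.uncurry fun x s : ℝ => (Ioo (0:ℝ) s).indicator (fun x => h (x, s - x)) x) =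
        {p : ℝ × ℝ | 0 < p.1 ∧ p.1 < p.2}.indicator (fun p => h (p.1, p.2 - p.1)) := by
      ext ⟨x, s⟩; simp [indicator, Function.uncurry]
    rw [this]
    refine (Measurable.indicator (by fun_prop) ?_).aemeasurable
    exact (measurableSet_lt measurable_const measurable_fst).inter
      (measurableSet_lt measurable_fst measurable_snd)
  rw [e2, ← lintegral_indicator measurableSet_Ioi]
  refine lintegral_congr fun s => ?_
  by_cases hs : 0 < s
  · rw [indicator_of_mem (by exact hs), lintegral_indicator measurableSet_Ioo]
    have himg : (fun r : ℝ => r * s) '' Ioo 0 1 = Ioo 0 s := by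
      ext y; constructor
      · rintro ⟨x, hx, rfl⟩; exact ⟨mul_pos hx.1 hs, by nlinarith [hx.2]⟩
      · intro hy; exact ⟨y / s, ⟨div_pos hy.1 hs, (div_lt_one hs).2 hy.2⟩, by field_simp⟩
    rw [← himg, lintegral_image_eq_lintegral_abs_deriv_mul (f' := fun _ => s) measurableSet_Ioo
      (fun x _ => by simpa using ((hasDerivAt_id x).mul_const s).hasDerivWithinAt)
      (fun x _ y _ hxy => mul_right_cancel₀ hs.ne' hxy), lintegral_const_mul _ (by fun_prop),
      abs_of_pos hs]
    congr 1
    refine lintegral_congr fun r => ?_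
    congr 2; ring
  · rw [indicator_of_notMem (by exact hs), Ioo_eq_empty (fun h => hs h)]
    simp

/-- Centre of mass and relative velocity. -/
theorem lintegral_vel_pair (h : Vel × Vel → ℝ≥0∞) (hh : Measurable h) :
    ∫⁻ v, ∫⁻ vs, h (v, vs) =
      ∫⁻ w, ∫⁻ u, h (w + (1 / 2 : ℝ) • u, w - (1 / 2 : ℝ) • u) := by
  rw [lintegral_lintegral_swap (by fun_prop)]
  calc ∫⁻ vs, ∫⁻ v, h (v, vs) = ∫⁻ vs, ∫⁻ u, h (u + vs, vs) :=
        lintegral_congr fun vs => (lintegral_add_right_eq_self (fun v => h (v, vs)) vs).symm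
    _ = ∫⁻ u, ∫⁻ vs, h (u + vs, vs) := lintegral_lintegral_swap (by fun_prop)
    _ = ∫⁻ u, ∫⁻ w, h (w + (1 / 2 : ℝ) • u, w - (1 / 2 : ℝ) • u) := by
        refine lintegral_congr fun u => ?_
        rw [← lintegral_sub_right_eq_self (fun vs => h (u + vs, vs)) ((1 / 2 : ℝ) • u)]
        refine lintegral_congr fun w => ?_
        congr 2
        module
    _ = _ := lintegral_lintegral_swap (by fun_prop)

/-! ### The reference measure and pairs of molecules -/

/-- The measure `I^α dv dI`, the natural reference measure of the collision process. -/
noncomputable def gasMeasure (α : ℝ) : Measure (Vel × ℝ) :=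
  stateMeasure.withDensity fun z => ENNReal.ofReal (z.2 ^ α)

/-- The measure `dr dR dσ` of the collision parameters `(r, R, σ)`. -/
noncomputable def angMeasure : Measure (ℝ × ℝ × S2) :=
  (volume.restrict (Ioo 0 1)).prod ((volume.restrict (Ioo 0 1)).prod surf)

/-- The pair of molecules with centre of mass velocity `w`, energy `E` in the centre of mass
frame, and collision parameters `ω = (r, R, σ)`. Every pair arises in this way, and a collision
with parameters `ω'` replaces `ω` by `ω'`. -/
noncomputable def pairConf (m : ℝ) (w : Vel) (E : ℝ) (ω : ℝ × ℝ × S2) :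
    (Vel × ℝ) × (Vel × ℝ) :=
  ((w + √(ω.2.1 * E / m) • (ω.2.2 : Vel), ω.1 * (1 - ω.2.1) * E),
    (w - √(ω.2.1 * E / m) • (ω.2.2 : Vel), (1 - ω.1) * (1 - ω.2.1) * E))

instance : SFinite stateMeasure := by unfold stateMeasure; infer_instance
instance : SigmaFinite stateMeasure := by unfold stateMeasure; infer_instance
instance (α : ℝ) : SFinite (gasMeasure α) := by unfold gasMeasure; infer_instance
instance : IsFiniteMeasure angMeasure := by unfold angMeasure; infer_instance

instance (α : ℝ) : SigmaFinite (gasMeasure α) := by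
  unfold gasMeasure
  exact SigmaFinite.withDensity_ofReal _

theorem lintegral_stateMeasure (H : Vel × ℝ → ℝ≥0∞) (hH : Measurable H) :
    ∫⁻ z, H z ∂stateMeasure = ∫⁻ v, ∫⁻ I in Ioi (0 : ℝ), H (v, I) := by
  unfold stateMeasure
  rw [lintegral_prod _ hH.aemeasurable]

theorem lintegral_gasMeasure (α : ℝ) (H : Vel × ℝ → ℝ≥0∞) (hH : Measurable H) :
    ∫⁻ z, H z ∂gasMeasure α =
      ∫⁻ v, ∫⁻ I in Ioi (0 : ℝ), ENNReal.ofReal (I ^ α) * H (v, I) := by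
  unfold gasMeasure
  rw [lintegral_withDensity_eq_lintegral_mul _ (by fun_prop) hH,
    lintegral_stateMeasure _ (by fun_prop)]
  rfl

@[fun_prop]
theorem measurable_pairConf (m : ℝ) : Measurable fun p : Vel × ℝ × ℝ × ℝ × S2 =>
    pairConf m p.1 p.2.1 p.2.2 := by
  unfold pairConf; fun_prop

@[fun_prop]
theorem measurable_dAlpha (α : ℝ) : Measurable fun p : ℝ × ℝ => dAlpha α p.1 p.2 := by
  unfold dAlpha; fun_prop

theorem dAlpha_pos {α r R : ℝ} (hr : r ∈ Ioo (0 : ℝ) 1) (hR : R ∈ Ioo (0 : ℝ) 1) :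
    0 < dAlpha α r R := by
  have h1 : 0 < 1 - r := sub_pos.2 hr.2
  have h2 : 0 < 1 - R := sub_pos.2 hR.2
  have := hr.1
  have := hR.1
  unfold dAlpha; positivity

theorem lintegral_angMeasure (h : ℝ × ℝ × S2 → ℝ≥0∞) (hh : Measurable h) :
    ∫⁻ ω, h ω ∂angMeasure =
      ∫⁻ r in Ioo (0 : ℝ) 1, ∫⁻ R in Ioo (0 : ℝ) 1, ∫⁻ σ, h (r, R, σ) ∂surf := by
  unfold angMeasure
  rw [lintegral_prod _ hh.aemeasurable]
  refine lintegral_congr fun r => ?_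
  rw [lintegral_prod _ (by fun_prop)]

/-- Polar coordinates for the relative velocity, with the kinetic energy `k = m |u|² / 4` as
radial variable. -/
theorem lintegral_vel_polar_energy {m : ℝ} (hm : 0 < m) (h : Vel → ℝ≥0∞) (hh : Measurable h) :
    ∫⁻ u, h u = ∫⁻ k in Ioi (0 : ℝ), ENNReal.ofReal (4 / (m * √m) * √k) *
      ∫⁻ σ, h ((2 * √(k / m)) • (σ : Vel)) ∂surf := by
  have hm4 : (0 : ℝ) < 4 / m := by positivity
  rw [lintegral_vel_polar h hh, lintegral_Ioi_mul_left hm4]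
  refine setLIntegral_congr_fun measurableSet_Ioi fun k hk => ?_
  have hk : 0 < k := hk
  have e : √(4 / m * k) = 2 * √(k / m) := by
    rw [show 4 / m * k = 2 ^ 2 * (k / m) by ring, Real.sqrt_mul (by positivity),
      Real.sqrt_sq (by norm_num)]
  rw [← mul_assoc, ← ENNReal.ofReal_mul hm4.le, e, Real.sqrt_div hk.le]
  congr 2
  field_simp

/-- In the coordinates `(w, E, r, R, σ)` the measure `(I I_*)^α dv dv_* dI dI_*` becomes a
multiple of `E^(2α + 5/2) d_α(r, R) dw dE dr dR dσ`. -/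
theorem lintegral_pair_eq {m : ℝ} (hm : 0 < m) (α : ℝ)
    (H : (Vel × ℝ) × (Vel × ℝ) → ℝ≥0∞) (hH : Measurable H) :
    ∫⁻ p, H p ∂((gasMeasure α).prod (gasMeasure α)) =
      ∫⁻ w : Vel, ∫⁻ E in Ioi (0 : ℝ),
        ENNReal.ofReal (4 / (m * √m) * E ^ (2 * α + 5 / 2)) *
        ∫⁻ ω, ENNReal.ofReal (dAlpha α ω.1 ω.2.1) * H (pairConf m w E ω) ∂angMeasure := by
  have s1 : ∫⁻ p, H p ∂((gasMeasure α).prod (gasMeasure α)) =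
      ∫⁻ v, ∫⁻ vs, ∫⁻ I in Ioi (0 : ℝ), ∫⁻ J in Ioi (0 : ℝ),
        ENNReal.ofReal (I ^ α) * (ENNReal.ofReal (J ^ α) * H ((v, I), (vs, J))) := by
    rw [lintegral_prod _ hH.aemeasurable, lintegral_gasMeasure _ _ (by fun_prop)]
    refine lintegral_congr fun v => ?_
    rw [lintegral_lintegral_swap (by fun_prop)]
    refine lintegral_congr fun I => ?_
    rw [lintegral_gasMeasure _ _ (by fun_prop), ← lintegral_const_mul _ (by fun_prop)]
    refine lintegral_congr fun vs => ?_
    rw [← lintegral_const_mul _ (by fun_prop)]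
  have s2 : ∀ v vs : Vel, ∫⁻ I in Ioi (0 : ℝ), ∫⁻ J in Ioi (0 : ℝ),
        ENNReal.ofReal (I ^ α) * (ENNReal.ofReal (J ^ α) * H ((v, I), (vs, J))) =
      ∫⁻ s in Ioi (0 : ℝ), ENNReal.ofReal s * ∫⁻ r in Ioo (0 : ℝ) 1,
        ENNReal.ofReal ((r * s) ^ α) * (ENNReal.ofReal (((1 - r) * s) ^ α) *
          H ((v, r * s), (vs, (1 - r) * s))) := fun v vs =>
    lintegral_quadrant (fun p => ENNReal.ofReal (p.1 ^ α) * (ENNReal.ofReal (p.2 ^ α) *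
      H ((v, p.1), (vs, p.2)))) (by fun_prop)
  rw [s1]
  simp_rw [s2]
  rw [lintegral_vel_pair (fun p => ∫⁻ s in Ioi (0 : ℝ), ENNReal.ofReal s * ∫⁻ r in Ioo (0 : ℝ) 1,
        ENNReal.ofReal ((r * s) ^ α) * (ENNReal.ofReal (((1 - r) * s) ^ α) *
          H ((p.1, r * s), (p.2, (1 - r) * s)))) (by fun_prop)]
  refine lintegral_congr fun w => ?_
  rw [lintegral_vel_polar_energy hm _ (by fun_prop)]
  have s3 : ∀ k : ℝ, ENNReal.ofReal (4 / (m * √m) * √k) * ∫⁻ σ : S2,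
      (∫⁻ s in Ioi (0 : ℝ), ENNReal.ofReal s * ∫⁻ r in Ioo (0 : ℝ) 1,
        ENNReal.ofReal ((r * s) ^ α) * (ENNReal.ofReal (((1 - r) * s) ^ α) *
          H ((w + (1 / 2 : ℝ) • ((2 * √(k / m)) • (σ : Vel)), r * s),
            (w - (1 / 2 : ℝ) • ((2 * √(k / m)) • (σ : Vel)), (1 - r) * s)))) ∂surf =
      ∫⁻ s in Ioi (0 : ℝ), ENNReal.ofReal (4 / (m * √m) * √k) * (ENNReal.ofReal s *
        ∫⁻ σ : S2, (∫⁻ r in Ioo (0 : ℝ) 1,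
        ENNReal.ofReal ((r * s) ^ α) * (ENNReal.ofReal (((1 - r) * s) ^ α) *
          H ((w + √(k / m) • (σ : Vel), r * s),
            (w - √(k / m) • (σ : Vel), (1 - r) * s)))) ∂surf) := by
    intro k
    have : (1 / 2 : ℝ) * (2 * √(k / m)) = √(k / m) := by ring
    simp_rw [smul_smul, this]
    rw [lintegral_lintegral_swap (by fun_prop), ← lintegral_const_mul _ (by fun_prop)]
    refine lintegral_congr fun s => ?_
    rw [lintegral_const_mul _ (by fun_prop)]
  simp_rw [s3]
  -- the energy `E` splits into the share `R` of the kinetic and `1 - R` of the internal energy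
  rw [lintegral_quadrant (fun p => ENNReal.ofReal (4 / (m * √m) * √p.1) * (ENNReal.ofReal p.2 *
        ∫⁻ σ : S2, (∫⁻ r in Ioo (0 : ℝ) 1,
        ENNReal.ofReal ((r * p.2) ^ α) * (ENNReal.ofReal (((1 - r) * p.2) ^ α) *
          H ((w + √(p.1 / m) • (σ : Vel), r * p.2),
            (w - √(p.1 / m) • (σ : Vel), (1 - r) * p.2)))) ∂surf)) (by fun_prop)]
  refine setLIntegral_congr_fun measurableSet_Ioi fun E hE => ?_
  have hE : 0 < E := hE
  rw [lintegral_angMeasure _ (by fun_prop), lintegral_lintegral_swap (by fun_prop)]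
  rw [← lintegral_const_mul _ (by fun_prop), ← lintegral_const_mul _ (by fun_prop)]
  refine setLIntegral_congr_fun measurableSet_Ioo fun R hR => ?_
  have hR0 := hR.1
  have hR1 : 0 < 1 - R := sub_pos.2 hR.2
  rw [lintegral_lintegral_swap (by fun_prop), ← mul_assoc, ← mul_assoc,
    ← lintegral_const_mul _ (by fun_prop), ← lintegral_const_mul _ (by fun_prop)]
  refine setLIntegral_congr_fun measurableSet_Ioo fun r hr => ?_
  have hr0 := hr.1
  have hr1 : 0 < 1 - r := sub_pos.2 hr.2
  rw [← lintegral_const_mul _ (by fun_prop), ← lintegral_const_mul _ (by fun_prop)]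
  refine lintegral_congr fun σ => ?_
  simp only [pairConf]
  rw [← mul_assoc, ← mul_assoc, ← mul_assoc, mul_assoc r, mul_assoc (1 - r),
    ← ENNReal.ofReal_mul (by positivity), ← ENNReal.ofReal_mul (by positivity),
    ← ENNReal.ofReal_mul (by positivity), ← ENNReal.ofReal_mul (by positivity),
    ← mul_assoc (ENNReal.ofReal (4 / (m * √m) * E ^ (2 * α + 5 / 2))),
    ← ENNReal.ofReal_mul (by positivity)]
  congr 2
  unfold dAlpha
  rw [Real.mul_rpow hr0.le (by positivity), Real.mul_rpow hr1.le (by positivity),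
    Real.mul_rpow hR1.le hE.le, Real.sqrt_mul hR0.le,
    show 2 * α + 5 / 2 = α + α + 1 + 1 + 1 / 2 by ring, show 2 * α + 1 = α + α + 1 by ring,
    Real.rpow_add hE, Real.rpow_add hE, Real.rpow_add hE, Real.rpow_add hE, Real.rpow_add hR1,
    Real.rpow_add hR1, Real.rpow_one, Real.rpow_one, Real.sqrt_eq_rpow E]
  ring

/-! ### The collision measure and micro-reversibility -/

/-- The outcome of a collision of the pair `p` with parameters `ω = (r, R, σ)`. -/
noncomputable def postConf (m : ℝ) (p : (Vel × ℝ) × (Vel × ℝ)) (ω : ℝ × ℝ × S2) :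
    (Vel × ℝ) × (Vel × ℝ) :=
  ((vPost m p.1.1 p.2.1 p.1.2 p.2.2 ω.2.2 ω.2.1, iPost m p.1.1 p.2.1 p.1.2 p.2.2 ω.1 ω.2.1),
    (vsPost m p.1.1 p.2.1 p.1.2 p.2.2 ω.2.2 ω.2.1, isPost m p.1.1 p.2.1 p.1.2 p.2.2 ω.1 ω.2.1))

/-- The rate `B b d_α` of collisions of a pair with parameters `(r, R, σ)`, cut off to the half
sphere. -/
noncomputable def collRate (α : ℝ) (b : ℝ → ℝ) (B : Vel → Vel → ℝ → ℝ → ℝ → ℝ → ℝ)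
    (y : ((Vel × ℝ) × (Vel × ℝ)) × (ℝ × ℝ × S2)) : ℝ≥0∞ :=
  {y : ((Vel × ℝ) × (Vel × ℝ)) × (ℝ × ℝ × S2) |
      0 ≤ ⟪dir (y.1.1.1 - y.1.2.1), (y.2.2.2 : Vel)⟫}.indicator
    (fun y => ENNReal.ofReal (B y.1.1.1 y.1.2.1 y.1.1.2 y.1.2.2 y.2.1 y.2.2.1 *
      b ⟪dir (y.1.1.1 - y.1.2.1), (y.2.2.2 : Vel)⟫ * dAlpha α y.2.1 y.2.2.1)) y

/-- The collision measure: the joint law, weighted by `collRate`, of the pairs before and after a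
collision, when both molecules before the collision are distributed according to `I^α dv dI`. -/
noncomputable def collMeasure (m α : ℝ) (b : ℝ → ℝ) (B : Vel → Vel → ℝ → ℝ → ℝ → ℝ → ℝ) :
    Measure (((Vel × ℝ) × (Vel × ℝ)) × ((Vel × ℝ) × (Vel × ℝ))) :=
  ((((gasMeasure α).prod (gasMeasure α)).prod angMeasure).withDensity (collRate α b B)).map
    fun y => (y.1, postConf m y.1 y.2)

@[fun_prop]
theorem measurable_dir : Measurable dir := by unfold dir; fun_prop

@[fun_prop]
theorem measurable_postConf (m : ℝ) :
    Measurable fun y : ((Vel × ℝ) × (Vel × ℝ)) × (ℝ × ℝ × S2) => postConf m y.1 y.2 := by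
  unfold postConf vPost vsPost iPost isPost collE
  fun_prop

section
variable {m α ζ : ℝ} {b : ℝ → ℝ} {B : Vel → Vel → ℝ → ℝ → ℝ → ℝ → ℝ} {blb bub : ℝ → ℝ → ℝ}

theorem IsHardKernel.measurable_collRate (hK : IsHardKernel m α ζ b B blb bub) :
    Measurable (collRate α b B) := by
  have h1 := hK.measurable_B.comp (f := fun y : ((Vel × ℝ) × (Vel × ℝ)) × (ℝ × ℝ × S2) =>
    (y.1.1.1, y.1.2.1, y.1.1.2, y.1.2.2, y.2.1, y.2.2.1)) (by fun_prop)
  have h2 : Measurable fun y : ((Vel × ℝ) × (Vel × ℝ)) × (ℝ × ℝ × S2) =>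
    ⟪dir (y.1.1.1 - y.1.2.1), (y.2.2.2 : Vel)⟫ := by fun_prop
  have h3 := hK.measurable_b.comp h2
  unfold collRate
  refine Measurable.indicator ?_ (measurableSet_le measurable_const h2)
  exact ((h1.mul h3).mul ((measurable_dAlpha α).comp (f := fun y :
    ((Vel × ℝ) × (Vel × ℝ)) × (ℝ × ℝ × S2) => (y.2.1, y.2.2.1)) (by fun_prop))).ennreal_ofReal

theorem IsHardKernel.lintegral_collMeasure (hK : IsHardKernel m α ζ b B blb bub)
    {G : ((Vel × ℝ) × (Vel × ℝ)) × ((Vel × ℝ) × (Vel × ℝ)) → ℝ≥0∞} (hG : Measurable G) :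
    ∫⁻ y, G y ∂collMeasure m α b B =
      ∫⁻ p, ∫⁻ ω, collRate α b B (p, ω) * G (p, postConf m p ω) ∂angMeasure
        ∂((gasMeasure α).prod (gasMeasure α)) := by
  have := hK.measurable_collRate
  unfold collMeasure
  rw [lintegral_map hG (by fun_prop),
    lintegral_withDensity_eq_lintegral_mul _ this (by fun_prop),
    lintegral_prod _ (by fun_prop)]
  rfl

theorem collE_pairConf (hm : 0 < m) (w : Vel) {E : ℝ} (hE : 0 ≤ E) {ω : ℝ × ℝ × S2}
    (hR : 0 ≤ ω.2.1) :
    collE m (pairConf m w E ω).1.1 (pairConf m w E ω).2.1 (pairConf m w E ω).1.2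
      (pairConf m w E ω).2.2 = E := by
  have h1 : (w + √(ω.2.1 * E / m) • (ω.2.2 : Vel)) - (w - √(ω.2.1 * E / m) • (ω.2.2 : Vel)) =
      (2 * √(ω.2.1 * E / m)) • (ω.2.2 : Vel) := by module
  have h2 : ‖(ω.2.2 : Vel)‖ = 1 := by simp
  simp only [collE, pairConf, h1, norm_smul, h2]
  rw [mul_one, Real.norm_eq_abs, sq_abs, mul_pow, Real.sq_sqrt (by positivity)]
  field_simp; ring

theorem postConf_pairConf (hm : 0 < m) (w : Vel) {E : ℝ} (hE : 0 ≤ E) {ω' : ℝ × ℝ × S2}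
    (hR : 0 ≤ ω'.2.1) (ω : ℝ × ℝ × S2) :
    postConf m (pairConf m w E ω') ω = pairConf m w E ω := by
  have h := collE_pairConf hm w hE hR
  have h1 : (1 / 2 : ℝ) • ((pairConf m w E ω').1.1 + (pairConf m w E ω').2.1) = w := by
    simp only [pairConf]; module
  unfold postConf vPost vsPost iPost isPost
  rw [h, h1]; rfl

theorem dir_pairConf (hm : 0 < m) (w : Vel) {E : ℝ} (hE : 0 < E) {ω : ℝ × ℝ × S2}
    (hR : 0 < ω.2.1) :
    dir ((pairConf m w E ω).1.1 - (pairConf m w E ω).2.1) = ω.2.2 := by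
  have h1 : (w + √(ω.2.1 * E / m) • (ω.2.2 : Vel)) - (w - √(ω.2.1 * E / m) • (ω.2.2 : Vel)) =
      (2 * √(ω.2.1 * E / m)) • (ω.2.2 : Vel) := by module
  have h2 : ‖(ω.2.2 : Vel)‖ = 1 := by simp
  have h3 : 0 < √(ω.2.1 * E / m) := Real.sqrt_pos.2 (by positivity)
  simp only [pairConf, h1, dir, norm_smul, h2, smul_smul, mul_one, Real.norm_eq_abs]
  rw [abs_of_pos (by positivity), inv_mul_cancel₀ (by positivity), one_smul]

/-- Micro-reversibility of the collision rate: a collision takes the parameters `ω` to `ω'` at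
the same rate as `ω'` to `ω`. -/
theorem IsHardKernel.collRate_pairConf_comm (hK : IsHardKernel m α ζ b B blb bub) (hm : 0 < m)
    (w : Vel) {E : ℝ} (hE : 0 < E) {ω ω' : ℝ × ℝ × S2}
    (hr : ω.1 ∈ Ioo (0 : ℝ) 1) (hR : ω.2.1 ∈ Ioo (0 : ℝ) 1)
    (hr' : ω'.1 ∈ Ioo (0 : ℝ) 1) (hR' : ω'.2.1 ∈ Ioo (0 : ℝ) 1) :
    ENNReal.ofReal (dAlpha α ω.1 ω.2.1) * collRate α b B (pairConf m w E ω, ω') =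
      ENNReal.ofReal (dAlpha α ω'.1 ω'.2.1) * collRate α b B (pairConf m w E ω', ω) := by
  have hE1 : collE m (pairConf m w E ω).1.1 (pairConf m w E ω).2.1 (pairConf m w E ω).1.2
      (pairConf m w E ω).2.2 = E := collE_pairConf hm w hE.le hR.1.le
  have hr1 : 0 < 1 - ω.1 := sub_pos.2 hr.2
  have hR1 : 0 < 1 - ω.2.1 := sub_pos.2 hR.2
  have hr0 := hr.1
  have hR0 := hR.1
  have hI : 0 < (pairConf m w E ω).1.2 := by simp only [pairConf]; positivity
  have hJ : 0 < (pairConf m w E ω).2.2 := by simp only [pairConf]; positivity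
  have hsub : (pairConf m w E ω).1.1 - (pairConf m w E ω).2.1 =
      (2 * √(ω.2.1 * E / m)) • (ω.2.2 : Vel) := by simp only [pairConf]; module
  have hne : (pairConf m w E ω).1.1 ≠ (pairConf m w E ω).2.1 := by
    intro h
    have h3 : 0 < √(ω.2.1 * E / m) := Real.sqrt_pos.2 (by positivity)
    rw [← sub_eq_zero, hsub] at h
    have := congrArg norm h
    simp [norm_smul] at this
    exact h3.ne' (by simpa using this)
  have hrev := hK.B_reverse _ _ _ _ ω'.1 ω'.2.1 ω'.2.2 hne hI hJ hr' hR'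
  have hpc := postConf_pairConf hm w hE.le hR.1.le ω'
  simp only [postConf, Prod.ext_iff] at hpc
  rw [hpc.1.1, hpc.1.2, hpc.2.1, hpc.2.2, hE1] at hrev
  have e1 : (pairConf m w E ω).1.2 / ((pairConf m w E ω).1.2 + (pairConf m w E ω).2.2) = ω.1 := by
    simp only [pairConf]; field_simp; ring
  have e2 : m * ‖(pairConf m w E ω).1.1 - (pairConf m w E ω).2.1‖ ^ 2 / (4 * E) = ω.2.1 := by
    rw [hsub, norm_smul]
    have h2 : ‖(ω.2.2 : Vel)‖ = 1 := by simp
    rw [h2, mul_one, Real.norm_eq_abs, sq_abs, mul_pow, Real.sq_sqrt (by positivity)]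
    field_simp
    norm_num
  rw [e1, e2] at hrev
  have d1 := dir_pairConf hm w hE hR.1
  have d2 := dir_pairConf hm w hE hR'.1
  unfold collRate
  simp only [indicator, mem_ofPred_eq, d1, d2, hrev, real_inner_comm (ω'.2.2 : Vel) (ω.2.2 : Vel)]
  split_ifs
  · rw [ENNReal.ofReal_mul' (dAlpha_pos hr hR).le, ENNReal.ofReal_mul' (dAlpha_pos hr' hR').le]
    ring
  · simp

theorem ae_angMeasure : ∀ᵐ ω ∂angMeasure, ω.1 ∈ Ioo (0 : ℝ) 1 ∧ ω.2.1 ∈ Ioo (0 : ℝ) 1 := by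
  unfold angMeasure
  have h1 : ∀ᵐ r ∂(volume.restrict (Ioo (0 : ℝ) 1)), r ∈ Ioo (0 : ℝ) 1 :=
    ae_restrict_mem measurableSet_Ioo
  have h2 := (Measure.quasiMeasurePreserving_fst (μ := volume.restrict (Ioo (0 : ℝ) 1))
    (ν := (volume.restrict (Ioo (0 : ℝ) 1)).prod surf)).ae h1
  have h3 := (Measure.quasiMeasurePreserving_snd (μ := volume.restrict (Ioo (0 : ℝ) 1))
    (ν := (volume.restrict (Ioo (0 : ℝ) 1)).prod surf)).ae
      ((Measure.quasiMeasurePreserving_fst (μ := volume.restrict (Ioo (0 : ℝ) 1))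
        (ν := surf)).ae h1)
  filter_upwards [h2, h3] with ω a c using ⟨a, c⟩

/-- The collision measure is invariant under exchange of the states before and after the
collision. In the coordinates of `pairConf` both sides are integrals over two independent sets of
collision parameters, and the exchange interchanges these. -/
theorem IsHardKernel.lintegral_collMeasure_swap (hK : IsHardKernel m α ζ b B blb bub) (hm : 0 < m)
    {G : ((Vel × ℝ) × (Vel × ℝ)) × ((Vel × ℝ) × (Vel × ℝ)) → ℝ≥0∞} (hG : Measurable G) :
    ∫⁻ y, G y.swap ∂collMeasure m α b B = ∫⁻ y, G y ∂collMeasure m α b B := by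
  have hr := hK.measurable_collRate
  have key : ∀ {G : ((Vel × ℝ) × (Vel × ℝ)) × ((Vel × ℝ) × (Vel × ℝ)) → ℝ≥0∞}, Measurable G →
      ∫⁻ y, G y ∂collMeasure m α b B = ∫⁻ w : Vel, ∫⁻ E in Ioi (0 : ℝ),
        ENNReal.ofReal (4 / (m * √m) * E ^ (2 * α + 5 / 2)) *
        ∫⁻ ω, ∫⁻ ω', ENNReal.ofReal (dAlpha α ω.1 ω.2.1) * collRate α b B (pairConf m w E ω, ω') *
          G (pairConf m w E ω, pairConf m w E ω') ∂angMeasure ∂angMeasure := by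
    intro G hG
    rw [hK.lintegral_collMeasure hG, lintegral_pair_eq hm _ _ (by fun_prop)]
    refine lintegral_congr fun w => ?_
    refine setLIntegral_congr_fun measurableSet_Ioi fun E hE => ?_
    congr 1
    refine lintegral_congr_ae (ae_angMeasure.mono fun ω hω => ?_)
    simp only
    rw [← lintegral_const_mul _ (by fun_prop)]
    refine lintegral_congr fun ω' => ?_
    rw [postConf_pairConf hm w (le_of_lt hE) hω.2.1.le, mul_assoc]
  rw [key hG, key (by fun_prop)]
  refine lintegral_congr fun w => ?_
  refine setLIntegral_congr_fun measurableSet_Ioi fun E hE => ?_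
  congr 1
  rw [lintegral_lintegral_swap (by fun_prop)]
  refine lintegral_congr_ae (ae_angMeasure.mono fun ω' hω' => ?_)
  refine lintegral_congr_ae (ae_angMeasure.mono fun ω hω => ?_)
  simp only
  rw [hK.collRate_pairConf_comm hm w hE hω.1 hω.2 hω'.1 hω'.2]
  rfl

end

/-! ### Exchange of the molecules -/

section
open scoped Pointwise

/-- A linear isometry, as a map of the unit sphere. -/
noncomputable def sphereMap (A : Vel ≃ₗᵢ[ℝ] Vel) (σ : S2) : S2 := ⟨A σ, by simp⟩

@[simp] theorem coe_sphereMap (A : Vel ≃ₗᵢ[ℝ] Vel) (σ : S2) : (sphereMap A σ : Vel) = A σ := rfl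

/-- The surface measure is invariant under linear isometries. -/
theorem measurePreserving_sphereMap (A : Vel ≃ₗᵢ[ℝ] Vel) :
    MeasurePreserving (sphereMap A) surf surf := by
  have hm : Measurable (sphereMap A) :=
    (A.continuous.measurable.comp measurable_subtype_coe).subtype_mk
  refine ⟨hm, Measure.ext fun s hs => ?_⟩
  rw [Measure.map_apply hm hs]
  unfold surf
  rw [Measure.toSphere_apply' _ hs, Measure.toSphere_apply' _ (hm hs)]
  congr 1
  have : Ioo (0 : ℝ) 1 • ((fun σ : S2 => (σ : Vel)) '' (sphereMap A ⁻¹' s)) =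
      A ⁻¹' (Ioo (0 : ℝ) 1 • ((fun σ : S2 => (σ : Vel)) '' s)) := by
    ext u
    simp only [mem_smul, mem_image, mem_preimage]
    constructor
    · rintro ⟨c, hc, _, ⟨σ, hσ, rfl⟩, rfl⟩
      exact ⟨c, hc, _, ⟨_, hσ, rfl⟩, by simp⟩
    · rintro ⟨c, hc, _, ⟨σ, hσ, rfl⟩, h⟩
      refine ⟨c, hc, _, ⟨sphereMap A.symm σ, ?_, rfl⟩, ?_⟩
      · convert hσ
        ext1; simp
      · apply A.injective; simp [← h]
  rw [this]
  exact A.measurePreserving.measure_preimage_equiv (f := A.toHomeomorph.toMeasurableEquiv) _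

end

theorem lintegral_sphereMap (A : Vel ≃ₗᵢ[ℝ] Vel) (h : S2 → ℝ≥0∞) (hh : Measurable h) :
    ∫⁻ σ, h (sphereMap A σ) ∂surf = ∫⁻ σ, h σ ∂surf :=
  (measurePreserving_sphereMap A).lintegral_comp hh

theorem lintegral_Ioo_one_sub (h : ℝ → ℝ≥0∞) :
    ∫⁻ r in Ioo (0 : ℝ) 1, h (1 - r) = ∫⁻ r in Ioo (0 : ℝ) 1, h r := by
  rw [← lintegral_indicator measurableSet_Ioo, ← lintegral_indicator measurableSet_Ioo,
    ← lintegral_sub_left_eq_self (fun r => (Ioo (0 : ℝ) 1).indicator h r) 1]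
  refine lintegral_congr fun r => ?_
  by_cases hr : r ∈ Ioo (0 : ℝ) 1
  · rw [indicator_of_mem hr, indicator_of_mem (by
      rcases hr with ⟨h1, h2⟩; constructor <;> linarith)]
  · rw [indicator_of_notMem hr, indicator_of_notMem]
    rintro ⟨h1, h2⟩; exact hr ⟨by linarith, by linarith⟩

/-- The collision parameters seen by the second molecule: `r` becomes `1 - r` and `σ` becomes
`-σ`. -/
noncomputable def angSwap (ω : ℝ × ℝ × S2) : ℝ × ℝ × S2 :=
  (1 - ω.1, ω.2.1, sphereMap (LinearIsometryEquiv.neg ℝ) ω.2.2)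

@[fun_prop]
theorem measurable_sphereMap (A : Vel ≃ₗᵢ[ℝ] Vel) : Measurable (sphereMap A) :=
  (measurePreserving_sphereMap A).measurable

@[fun_prop]
theorem measurable_angSwap : Measurable angSwap := by
  unfold angSwap; fun_prop

theorem lintegral_angSwap (h : ℝ × ℝ × S2 → ℝ≥0∞) (hh : Measurable h) :
    ∫⁻ ω, h (angSwap ω) ∂angMeasure = ∫⁻ ω, h ω ∂angMeasure := by
  rw [lintegral_angMeasure _ hh, lintegral_angMeasure _ (by fun_prop),
    ← lintegral_Ioo_one_sub]
  refine lintegral_congr fun r => lintegral_congr fun R => ?_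
  have e : ∀ σ, angSwap (1 - r, R, σ) = (r, R, sphereMap (LinearIsometryEquiv.neg ℝ) σ) := by
    intro σ; simp [angSwap]
  simp only [e]
  exact lintegral_sphereMap _ (fun σ => h (r, R, σ)) (by fun_prop)

section
variable {m α ζ : ℝ} {b : ℝ → ℝ} {B : Vel → Vel → ℝ → ℝ → ℝ → ℝ → ℝ} {blb bub : ℝ → ℝ → ℝ}

theorem collE_comm (m : ℝ) (v vs : Vel) (I J : ℝ) : collE m vs v J I = collE m v vs I J := by
  unfold collE; rw [norm_sub_rev]; ring

theorem postConf_swap (m : ℝ) (p : (Vel × ℝ) × (Vel × ℝ)) (ω : ℝ × ℝ × S2) :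
    postConf m p.swap (angSwap ω) = (postConf m p ω).swap := by
  simp only [postConf, angSwap, Prod.swap, vPost, vsPost, iPost, isPost,
    collE_comm m p.1.1 p.2.1 p.1.2 p.2.2]
  ext1 <;> ext1 <;> simp [add_comm p.2.1, sub_eq_add_neg]

theorem IsHardKernel.collRate_swap (hK : IsHardKernel m α ζ b B blb bub)
    {p : (Vel × ℝ) × (Vel × ℝ)} (h1 : 0 < p.1.2) (h2 : 0 < p.2.2) {ω : ℝ × ℝ × S2}
    (hr : ω.1 ∈ Ioo (0 : ℝ) 1) (hR : ω.2.1 ∈ Ioo (0 : ℝ) 1) :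
    collRate α b B (p.swap, angSwap ω) = collRate α b B (p, ω) := by
  have e : dir (p.2.1 - p.1.1) = - dir (p.1.1 - p.2.1) := by
    unfold dir; rw [norm_sub_rev]; simp [← smul_neg]
  have hB := hK.B_swap p.1.1 p.2.1 p.1.2 p.2.2 ω.1 ω.2.1 h1 h2 hr hR
  have e2 : dAlpha α (1 - ω.1) ω.2.1 = dAlpha α ω.1 ω.2.1 := by
    unfold dAlpha; rw [sub_sub_cancel]; ring
  unfold collRate
  simp [angSwap, Prod.swap, indicator, e, hB, e2]

theorem ae_gasMeasure_pos (α : ℝ) : ∀ᵐ z ∂gasMeasure α, 0 < z.2 := by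
  unfold gasMeasure
  refine (withDensity_absolutelyContinuous _ _).ae_le ?_
  unfold stateMeasure
  exact Measure.quasiMeasurePreserving_snd.ae (ae_restrict_mem measurableSet_Ioi)

theorem ae_pair_pos (α : ℝ) : ∀ᵐ p ∂((gasMeasure α).prod (gasMeasure α)),
    0 < p.1.2 ∧ 0 < p.2.2 := by
  filter_upwards [Measure.quasiMeasurePreserving_fst.ae (ae_gasMeasure_pos α),
    Measure.quasiMeasurePreserving_snd.ae (ae_gasMeasure_pos α)] with p h1 h2 using ⟨h1, h2⟩

/-- The collision measure is invariant under exchange of the two molecules. -/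
theorem IsHardKernel.lintegral_collMeasure_exchange (hK : IsHardKernel m α ζ b B blb bub)
    {G : ((Vel × ℝ) × (Vel × ℝ)) × ((Vel × ℝ) × (Vel × ℝ)) → ℝ≥0∞} (hG : Measurable G) :
    ∫⁻ y, G (y.1.swap, y.2.swap) ∂collMeasure m α b B = ∫⁻ y, G y ∂collMeasure m α b B := by
  have hr := hK.measurable_collRate
  rw [hK.lintegral_collMeasure hG, hK.lintegral_collMeasure (by fun_prop),
    ← (Measure.measurePreserving_swap (μ := gasMeasure α) (ν := gasMeasure α)).lintegral_comp
      (by fun_prop)]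
  refine lintegral_congr_ae ((ae_pair_pos α).mono fun p hp => ?_)
  simp only
  rw [← lintegral_angSwap (fun ω => collRate α b B (p.swap, ω) *
    G (p.swap.swap, (postConf m p.swap ω).swap))
    (by fun_prop)]
  refine lintegral_congr_ae (ae_angMeasure.mono fun ω hω => ?_)
  simp only
  rw [hK.collRate_swap hp.1 hp.2 hω.1 hω.2, postConf_swap, Prod.swap_swap, Prod.swap_swap]

/-- Pairs of molecules with distinct velocities. -/
theorem ae_pair_ne (α : ℝ) : ∀ᵐ p ∂((gasMeasure α).prod (gasMeasure α)), p.1.1 ≠ p.2.1 := by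
  have hs : MeasurableSet {p : (Vel × ℝ) × (Vel × ℝ) | p.1.1 ≠ p.2.1} :=
    (measurableSet_eq_fun (by fun_prop) (by fun_prop)).compl
  rw [Measure.ae_prod_iff_ae_ae hs]
  refine Filter.Eventually.of_forall fun z => ?_
  unfold gasMeasure
  refine (withDensity_absolutelyContinuous _ _).ae_le ?_
  unfold stateMeasure
  refine Measure.quasiMeasurePreserving_fst.ae (p := fun v => z.1 ≠ v) ?_
  rw [ae_iff]
  simp

/-- A property of all non-degenerate collisions holds almost everywhere. -/
theorem ae_collMeasure
    {q : ((Vel × ℝ) × (Vel × ℝ)) × ((Vel × ℝ) × (Vel × ℝ)) → Prop}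
    (hq : MeasurableSet {y | q y})
    (h : ∀ p : (Vel × ℝ) × (Vel × ℝ), 0 < p.1.2 → 0 < p.2.2 → p.1.1 ≠ p.2.1 →
      ∀ ω : ℝ × ℝ × S2, ω.1 ∈ Ioo (0 : ℝ) 1 → ω.2.1 ∈ Ioo (0 : ℝ) 1 → q (p, postConf m p ω)) :
    ∀ᵐ y ∂collMeasure m α b B, q y := by
  unfold collMeasure
  rw [ae_map_iff (by fun_prop) hq]
  refine (withDensity_absolutelyContinuous _ _).ae_le ?_
  have h1 := (Measure.quasiMeasurePreserving_fst (μ := (gasMeasure α).prod (gasMeasure α))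
    (ν := angMeasure)).ae ((ae_pair_pos α).and (ae_pair_ne α))
  have h2 := (Measure.quasiMeasurePreserving_snd (μ := (gasMeasure α).prod (gasMeasure α))
    (ν := angMeasure)).ae ae_angMeasure
  filter_upwards [h1, h2] with y h1 h2
  exact h _ h1.1.1 h1.1.2 h1.2 _ h2.1 h2.2

/-- Properties of almost all states hold for the first molecule before the collision. -/
theorem ae_collMeasure_of_ae (m α : ℝ) (b : ℝ → ℝ) (B : Vel → Vel → ℝ → ℝ → ℝ → ℝ → ℝ)
    {q : Vel × ℝ → Prop} (h : ∀ᵐ z ∂gasMeasure α, q z) :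
    ∀ᵐ y ∂collMeasure m α b B, q y.1.1 := by
  obtain ⟨s, hs, hsm, hs0⟩ := exists_measurable_superset_of_null (ae_iff.1 h)
  have hq : ∀ᵐ y ∂collMeasure m α b B, y.1.1 ∈ sᶜ := by
    unfold collMeasure
    rw [ae_map_iff (by fun_prop) (measurable_fst.fst hsm.compl)]
    refine (withDensity_absolutelyContinuous _ _).ae_le ?_
    have h1 : ∀ᵐ z ∂gasMeasure α, z ∈ sᶜ := by rw [ae_iff]; simpa using hs0
    exact (Measure.quasiMeasurePreserving_fst (ν := angMeasure)).ae
      ((Measure.quasiMeasurePreserving_fst (ν := gasMeasure α)).ae h1)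
  filter_upwards [hq] with y hy
  by_contra hc
  exact hy (hs hc)

theorem IsHardKernel.map_swap_collMeasure (hK : IsHardKernel m α ζ b B blb bub) (hm : 0 < m) :
    MeasurePreserving Prod.swap (collMeasure m α b B) (collMeasure m α b B) := by
  refine ⟨measurable_swap, Measure.ext fun s hs => ?_⟩
  rw [Measure.map_apply measurable_swap hs, ← lintegral_indicator_one (measurable_swap hs),
    ← lintegral_indicator_one hs, ← hK.lintegral_collMeasure_swap hm (G := s.indicator 1)
      (measurable_one.indicator hs)]
  rfl

theorem IsHardKernel.map_exchange_collMeasure (hK : IsHardKernel m α ζ b B blb bub) :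
    MeasurePreserving (Prod.map Prod.swap Prod.swap) (collMeasure m α b B)
      (collMeasure m α b B) := by
  have hms : Measurable (Prod.map Prod.swap Prod.swap :
    ((Vel × ℝ) × (Vel × ℝ)) × ((Vel × ℝ) × (Vel × ℝ)) → _) := by fun_prop
  refine ⟨hms, Measure.ext fun s hs => ?_⟩
  rw [Measure.map_apply hms hs, ← lintegral_indicator_one (hms hs),
    ← lintegral_indicator_one hs, ← hK.lintegral_collMeasure_exchange (G := s.indicator 1)
      (measurable_one.indicator hs)]
  rfl

/-- Properties of almost all states hold for all four states of almost all collisions. -/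
theorem IsHardKernel.ae_collMeasure_all (hK : IsHardKernel m α ζ b B blb bub) (hm : 0 < m)
    {q : Vel × ℝ → Prop} (h : ∀ᵐ z ∂gasMeasure α, q z) :
    ∀ᵐ y ∂collMeasure m α b B, (q y.1.1 ∧ q y.1.2) ∧ q y.2.1 ∧ q y.2.2 := by
  have h1 := ae_collMeasure_of_ae m α b B h
  have h2 := hK.map_exchange_collMeasure.quasiMeasurePreserving.ae h1
  have h3 := (hK.map_swap_collMeasure hm).quasiMeasurePreserving.ae (h1.and h2)
  filter_upwards [h1, h2, h3] with y a c d using ⟨⟨a, c⟩, d.1, d.2⟩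

end

/-! ### Energy before and after a collision -/

/-- The energy `1 + |v|²/2 + I/m`, the square of the Lebesgue bracket. -/
noncomputable def kin (m : ℝ) (z : Vel × ℝ) : ℝ := 1 + ‖z.1‖ ^ 2 / 2 + z.2 / m

/-- The collisional energy per unit mass of a pair of molecules. -/
noncomputable def relE (m : ℝ) (p : (Vel × ℝ) × (Vel × ℝ)) : ℝ :=
  collE m p.1.1 p.2.1 p.1.2 p.2.2 / m

/-- The total energy of a pair of molecules. -/
noncomputable def pairKin (m : ℝ) (p : (Vel × ℝ) × (Vel × ℝ)) : ℝ := kin m p.1 + kin m p.2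

@[fun_prop] theorem measurable_kin (m : ℝ) : Measurable (kin m) := by unfold kin; fun_prop
@[fun_prop] theorem measurable_relE (m : ℝ) : Measurable (relE m) := by
  unfold relE collE; fun_prop
@[fun_prop] theorem measurable_pairKin (m : ℝ) : Measurable (pairKin m) := by
  unfold pairKin; fun_prop

section
variable {m : ℝ}

theorem one_le_kin (hm : 0 < m) {z : Vel × ℝ} (hz : 0 < z.2) : 1 ≤ kin m z := by
  unfold kin; have : 0 ≤ z.2 / m := by positivity
  nlinarith [sq_nonneg ‖z.1‖]

theorem bracket_sq (hm : 0 < m) {z : Vel × ℝ} (hz : 0 < z.2) : bracket m z ^ 2 = kin m z := by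
  unfold bracket
  rw [Real.sq_sqrt]
  · rfl
  · exact zero_le_one.trans (one_le_kin hm hz)

theorem pairKin_eq (hm : 0 < m) (p : (Vel × ℝ) × (Vel × ℝ)) :
    pairKin m p = 2 + ‖(1 / 2 : ℝ) • (p.1.1 + p.2.1)‖ ^ 2 + relE m p := by
  unfold pairKin kin relE collE
  rw [norm_smul, mul_pow, norm_add_sq_real, norm_sub_sq_real]
  field_simp
  norm_num
  ring

theorem relE_pos (hm : 0 < m) {p : (Vel × ℝ) × (Vel × ℝ)} (h1 : 0 < p.1.2) (h2 : 0 < p.2.2) :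
    0 < relE m p := by
  unfold relE collE; positivity

theorem relE_le_pairKin (hm : 0 < m) (p : (Vel × ℝ) × (Vel × ℝ)) : relE m p ≤ pairKin m p := by
  rw [pairKin_eq hm]; nlinarith [sq_nonneg ‖(1 / 2 : ℝ) • (p.1.1 + p.2.1)‖]

theorem kin_le_relE (hm : 0 < m) {p : (Vel × ℝ) × (Vel × ℝ)} (h1 : 0 < p.1.2) (h2 : 0 < p.2.2) :
    kin m p.1 ≤ 4 * relE m p + 2 * kin m p.2 := by
  have h3 : 0 ≤ p.1.2 / m := by positivity
  have h4 : 0 ≤ p.2.2 / m := by positivity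
  have h5 : relE m p = ‖p.1.1 - p.2.1‖ ^ 2 / 4 + p.1.2 / m + p.2.2 / m := by
    unfold relE collE; field_simp
  have h6 : ‖p.1.1‖ ≤ ‖p.1.1 - p.2.1‖ + ‖p.2.1‖ := by
    simpa using norm_add_le (p.1.1 - p.2.1) p.2.1
  unfold kin
  nlinarith [norm_nonneg p.1.1, sq_nonneg (‖p.1.1 - p.2.1‖ - ‖p.2.1‖)]

/-- Conservation of energy in a collision. -/
theorem pairKin_postConf (hm : 0 < m) {p : (Vel × ℝ) × (Vel × ℝ)} (h1 : 0 < p.1.2)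
    (h2 : 0 < p.2.2) {ω : ℝ × ℝ × S2} (hR : 0 ≤ ω.2.1) :
    pairKin m (postConf m p ω) = pairKin m p := by
  rw [pairKin_eq hm p]
  set w := (1 / 2 : ℝ) • (p.1.1 + p.2.1)
  have hs : ‖(ω.2.2 : Vel)‖ = 1 := by simp
  have he := relE_pos hm h1 h2
  have hc : collE m p.1.1 p.2.1 p.1.2 p.2.2 = m * relE m p := by unfold relE; field_simp
  simp only [pairKin, kin, postConf, vPost, vsPost, iPost, isPost, hc]
  rw [norm_add_sq_real, norm_sub_sq_real, norm_smul √(ω.2.1 * (m * relE m p) / m), hs,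
    mul_one, Real.norm_eq_abs, sq_abs, Real.sq_sqrt (by positivity)]
  field_simp
  ring

/-- A lower bound for the fraction of the total energy of the pair that each molecule has after
a collision with parameters `r` and `R`. -/
noncomputable def energyShare (r R : ℝ) : ℝ := r * (1 - r) * (1 - R) * (1 - √R) ^ 2 / 4

@[fun_prop] theorem measurable_energyShare :
    Measurable fun x : ℝ × ℝ => energyShare x.1 x.2 := by unfold energyShare; fun_prop

theorem energyShare_pos {r R : ℝ} (hr : r ∈ Ioo (0 : ℝ) 1) (hR : R ∈ Ioo (0 : ℝ) 1) :
    0 < energyShare r R := by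
  have h1 : 0 < 1 - r := sub_pos.2 hr.2
  have h2 : 0 < 1 - R := sub_pos.2 hR.2
  have h3 : 0 < 1 - √R := sub_pos.2 (by rw [Real.sqrt_lt' one_pos]; simpa using hR.2)
  have := hr.1
  unfold energyShare; positivity

/-- If the centre of mass moves fast, the molecule has at least kinetic energy; otherwise the
internal energy it receives is comparable to the total energy. -/
theorem energyShare_mul_le (w s : Vel) (hs : ‖s‖ = 1) {e r R : ℝ} (he : 0 < e)
    (hr : r ∈ Ioo (0 : ℝ) 1) (hR : R ∈ Ioo (0 : ℝ) 1) :
    energyShare r R * (2 + ‖w‖ ^ 2 + e) ≤ 1 + ‖w + √(R * e) • s‖ ^ 2 / 2 + r * (1 - R) * e := by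
  obtain ⟨hr0, hr1⟩ := hr
  obtain ⟨hR0, hR1⟩ := hR
  have h3 : √R < 1 := by rw [Real.sqrt_lt' one_pos]; simpa using hR1
  have h4 : 0 < √R := Real.sqrt_pos.2 hR0
  have hq : (1 - √R) ^ 2 ≤ 1 := by nlinarith
  have hq0 : 0 ≤ (1 - √R) ^ 2 := sq_nonneg _
  have hrr : 0 ≤ r * (1 - R) := mul_nonneg hr0.le (by linarith)
  have hrr1 : r * (1 - R) ≤ 1 := by nlinarith
  have hrr2 : r * (1 - r) * (1 - R) ≤ 1 := by nlinarith [mul_nonneg hrr (by linarith : 0 ≤ 1 - r)]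
  have hrr3 : 0 ≤ r * (1 - r) * (1 - R) := by
    have := mul_nonneg hrr (by linarith : 0 ≤ 1 - r); nlinarith
  have k1 : energyShare r R ≤ (1 - √R) ^ 2 / 4 := by unfold energyShare; nlinarith
  have k2 : energyShare r R ≤ r * (1 - R) / 4 := by
    have h5 : r * (1 - r) * (1 - R) ≤ r * (1 - R) := by nlinarith
    unfold energyShare; nlinarith
  rcases le_total e (‖w‖ ^ 2) with h | h
  · have hse : √(R * e) ≤ √R * ‖w‖ := by
      rw [Real.sqrt_mul hR0.le]
      gcongr
      exact Real.sqrt_le_iff.2 ⟨norm_nonneg _, h⟩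
    have h5 : (1 - √R) * ‖w‖ ≤ ‖w + √(R * e) • s‖ := by
      have := norm_sub_le (w + √(R * e) • s) (√(R * e) • s)
      rw [add_sub_cancel_right, norm_smul, hs, mul_one, Real.norm_eq_abs,
        abs_of_nonneg (Real.sqrt_nonneg _)] at this
      nlinarith
    have h6 : (1 - √R) ^ 2 * ‖w‖ ^ 2 ≤ ‖w + √(R * e) • s‖ ^ 2 := by
      rw [← mul_pow]; exact pow_le_pow_left₀ (mul_nonneg (by linarith) (norm_nonneg _)) h5 2
    have h7 : energyShare r R * (2 + ‖w‖ ^ 2 + e) ≤ (1 - √R) ^ 2 / 4 * (2 + 2 * ‖w‖ ^ 2) :=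
      mul_le_mul k1 (by linarith) (by positivity) (by positivity)
    have h8 : 0 ≤ r * (1 - R) * e := by positivity
    nlinarith
  · have h7 : energyShare r R * (2 + ‖w‖ ^ 2 + e) ≤ r * (1 - R) / 4 * (2 + 2 * e) :=
      mul_le_mul k2 (by linarith) (by positivity) (by positivity)
    nlinarith [sq_nonneg ‖w + √(R * e) • s‖, mul_nonneg hrr he.le]

theorem sqrt_add_sqrt_ge {k x y : ℝ} (hk : 0 ≤ k) (hx : k * (x + y) ≤ x)
    (hy : k * (x + y) ≤ y) (hX : 0 ≤ x + y) : (1 + k / 2) * √(x + y) ≤ √x + √y := by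
  have hx0 : 0 ≤ x := (mul_nonneg hk hX).trans hx
  have hy0 : 0 ≤ y := (mul_nonneg hk hX).trans hy
  have h1 : k * (x + y) ≤ √x * √y := by
    rw [← Real.sqrt_mul hx0]
    refine Real.le_sqrt_of_sq_le ?_
    rw [sq]; exact mul_le_mul hx hy (mul_nonneg hk hX) hx0
  refine (sq_le_sq₀ (by positivity) (by positivity)).1 ?_
  rw [mul_pow, Real.sq_sqrt hX, add_sq (√x) (√y), Real.sq_sqrt hx0, Real.sq_sqrt hy0]
  nlinarith [mul_nonneg hk hX]

theorem energyShare_symm (r R : ℝ) : energyShare (1 - r) R = energyShare r R := by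
  unfold energyShare; ring

/-- Since both molecules have a fraction of the total energy after a collision, the
subadditivity of the square root is strict for the energies after the collision. -/
theorem sqrt_kin_postConf (hm : 0 < m) {p : (Vel × ℝ) × (Vel × ℝ)} (h1 : 0 < p.1.2)
    (h2 : 0 < p.2.2) {ω : ℝ × ℝ × S2} (hr : ω.1 ∈ Ioo (0 : ℝ) 1) (hR : ω.2.1 ∈ Ioo (0 : ℝ) 1) :
    (1 + energyShare ω.1 ω.2.1 / 2) * √(pairKin m p) ≤
      √(kin m (postConf m p ω).1) + √(kin m (postConf m p ω).2) := by
  have hE := pairKin_postConf hm h1 h2 hR.1.le (ω := ω)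
  have he := relE_pos hm h1 h2
  have hs : ‖(ω.2.2 : Vel)‖ = 1 := by simp
  have hs' : ‖-(ω.2.2 : Vel)‖ = 1 := by simp
  have hc : collE m p.1.1 p.2.1 p.1.2 p.2.2 = m * relE m p := by unfold relE; field_simp
  have hc' : ω.2.1 * (m * relE m p) / m = ω.2.1 * relE m p := by field_simp
  have a1 : energyShare ω.1 ω.2.1 * pairKin m p ≤ kin m (postConf m p ω).1 := by
    rw [pairKin_eq hm]
    refine (energyShare_mul_le _ _ hs he hr hR).trans (le_of_eq ?_)
    simp only [kin, postConf, vPost, iPost, hc, hc']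
    field_simp
  have a2 : energyShare ω.1 ω.2.1 * pairKin m p ≤ kin m (postConf m p ω).2 := by
    rw [pairKin_eq hm, ← energyShare_symm]
    refine (energyShare_mul_le _ _ hs' he (r := 1 - ω.1) (by
      rcases hr with ⟨h1, h2⟩; constructor <;> linarith) hR).trans (le_of_eq ?_)
    simp only [kin, postConf, vsPost, isPost, hc, hc', smul_neg, ← sub_eq_add_neg]
    field_simp
  have hX : 0 ≤ pairKin m p := by
    have := one_le_kin hm h1; have := one_le_kin hm h2; unfold pairKin; linarith
  unfold pairKin at hE
  have := sqrt_add_sqrt_ge (energyShare_pos hr hR).le (x := kin m (postConf m p ω).1)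
    (y := kin m (postConf m p ω).2) (by rw [hE]; exact a1) (by rw [hE]; exact a2)
    (by rw [hE]; exact hX)
  rw [hE] at this
  exact this

end

/-! ### Bounds for the collision rate -/

/-- The angular kernel, cut off to nonnegative cosines. -/
noncomputable def angProfile (b : ℝ → ℝ) (s : ℝ) : ℝ≥0∞ :=
  (Ici (0 : ℝ)).indicator (fun s => ENNReal.ofReal (b s)) s

/-- A fixed unit vector, the reference direction for `û`. -/
noncomputable def poleVel : Vel := EuclideanSpace.single 0 1

/-- The total angular cross section `∫ b(û · σ) dσ` over a half sphere, which does not depend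
on `û`. -/
noncomputable def angConst (b : ℝ → ℝ) : ℝ≥0∞ := ∫⁻ σ, angProfile b ⟪poleVel, (σ : Vel)⟫ ∂surf

theorem norm_poleVel : ‖poleVel‖ = 1 := by simp [poleVel]

theorem measurable_angProfile {b : ℝ → ℝ} (hb : Measurable b) : Measurable (angProfile b) :=
  hb.ennreal_ofReal.indicator measurableSet_Ici

theorem exists_isometry_pole {u : Vel} (hu : ‖u‖ = 1) : ∃ A : Vel ≃ₗᵢ[ℝ] Vel, A poleVel = u :=
  ⟨_, Submodule.reflection_sub (norm_poleVel.trans hu.symm)⟩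

theorem norm_dir {u : Vel} (hu : u ≠ 0) : ‖dir u‖ = 1 := by
  unfold dir; rw [norm_smul, norm_inv, norm_norm, inv_mul_cancel₀ (norm_ne_zero_iff.2 hu)]

theorem lintegral_angProfile {b : ℝ → ℝ} (hb : Measurable b) {u : Vel} (hu : ‖u‖ = 1) :
    ∫⁻ σ, angProfile b ⟪u, (σ : Vel)⟫ ∂surf = angConst b := by
  have := measurable_angProfile hb
  obtain ⟨A, rfl⟩ := exists_isometry_pole hu
  rw [← lintegral_sphereMap A _ (by fun_prop)]
  simp [angConst]

/-- Integration of a function of `(r, R)` against the angular kernel. -/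
theorem lintegral_ang_mul_angProfile {b : ℝ → ℝ} (hb : Measurable b) {u : Vel} (hu : ‖u‖ = 1)
    (h : ℝ × ℝ → ℝ≥0∞) (hh : Measurable h) :
    ∫⁻ ω, h (ω.1, ω.2.1) * angProfile b ⟪u, (ω.2.2 : Vel)⟫ ∂angMeasure =
      (∫⁻ r in Ioo (0 : ℝ) 1, ∫⁻ R in Ioo (0 : ℝ) 1, h (r, R)) * angConst b := by
  have := measurable_angProfile hb
  rw [lintegral_angMeasure _ (by fun_prop), ← lintegral_mul_const _ (by fun_prop)]
  refine lintegral_congr fun r => ?_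
  rw [← lintegral_mul_const _ (by fun_prop)]
  refine lintegral_congr fun R => ?_
  simp only
  rw [lintegral_const_mul _ (by fun_prop), lintegral_angProfile hb hu]

section
variable {m α ζ : ℝ} {b : ℝ → ℝ} {B : Vel → Vel → ℝ → ℝ → ℝ → ℝ → ℝ} {blb bub : ℝ → ℝ → ℝ}

/-- A measurable version of an integrable weight `h d_α` on the square, as a weight on the
collision parameters. -/
theorem exists_measurable_weight {h : ℝ → ℝ → ℝ}
    (hi : IntegrableOn (fun x : ℝ × ℝ => h x.1 x.2 * dAlpha α x.1 x.2) (Icc 0 1 ×ˢ Icc 0 1)) :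
    ∃ g : ℝ × ℝ → ℝ≥0∞, Measurable g ∧
      (∀ᵐ x ∂(volume.restrict (Ioo (0 : ℝ) 1)).prod (volume.restrict (Ioo (0 : ℝ) 1)),
        ENNReal.ofReal (h x.1 x.2 * dAlpha α x.1 x.2) = g x) ∧
      (∀ᵐ ω ∂angMeasure, ENNReal.ofReal (h ω.1 ω.2.1 * dAlpha α ω.1 ω.2.1) = g (ω.1, ω.2.1)) ∧
      ∫⁻ r in Ioo (0 : ℝ) 1, ∫⁻ R in Ioo (0 : ℝ) 1, g (r, R) =
        ∫⁻ x in Icc (0 : ℝ) 1 ×ˢ Icc (0 : ℝ) 1, ENNReal.ofReal (h x.1 x.2 * dAlpha α x.1 x.2) := by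
  have hr : (volume : Measure (ℝ × ℝ)).restrict (Icc (0 : ℝ) 1 ×ˢ Icc (0 : ℝ) 1) =
      (volume.restrict (Ioo (0 : ℝ) 1)).prod (volume.restrict (Ioo (0 : ℝ) 1)) := by
    rw [Measure.volume_eq_prod, ← Measure.prod_restrict, Measure.restrict_congr_set Ioo_ae_eq_Icc]
  have hm := hi.aestronglyMeasurable.aemeasurable.ennreal_ofReal
  rw [hr] at hm
  refine ⟨hm.mk _, hm.measurable_mk, hm.ae_eq_mk, ?_, ?_⟩
  · have h1 : MeasurePreserving (MeasurableEquiv.prodAssoc (α := ℝ) (β := ℝ) (γ := S2))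
      (((volume.restrict (Ioo (0 : ℝ) 1)).prod (volume.restrict (Ioo (0 : ℝ) 1))).prod surf)
      angMeasure := measurePreserving_prodAssoc _ _ _
    have h2 := (Measure.quasiMeasurePreserving_fst (μ := (volume.restrict (Ioo (0 : ℝ) 1)).prod
      (volume.restrict (Ioo (0 : ℝ) 1))) (ν := surf)).ae hm.ae_eq_mk
    have h3 := h1.symm.quasiMeasurePreserving.ae h2
    exact h3
  · rw [hr, lintegral_congr_ae hm.ae_eq_mk, lintegral_prod _ hm.measurable_mk.aemeasurable]

theorem collRate_le (hK : IsHardKernel m α ζ b B blb bub) (hm : 0 < m)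
    {p : (Vel × ℝ) × (Vel × ℝ)} (h1 : 0 < p.1.2) (h2 : 0 < p.2.2) (hne : p.1.1 ≠ p.2.1)
    {ω : ℝ × ℝ × S2} (hr : ω.1 ∈ Ioo (0 : ℝ) 1) (hR : ω.2.1 ∈ Ioo (0 : ℝ) 1) :
    ENNReal.ofReal (relE m p ^ (ζ / 2)) * (ENNReal.ofReal (blb ω.1 ω.2.1 * dAlpha α ω.1 ω.2.1) *
      angProfile b ⟪dir (p.1.1 - p.2.1), (ω.2.2 : Vel)⟫) ≤ collRate α b B (p, ω) ∧
    collRate α b B (p, ω) ≤ ENNReal.ofReal (relE m p ^ (ζ / 2)) *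
      (ENNReal.ofReal (bub ω.1 ω.2.1 * dAlpha α ω.1 ω.2.1) *
      angProfile b ⟪dir (p.1.1 - p.2.1), (ω.2.2 : Vel)⟫) := by
  have he : 0 ≤ relE m p ^ (ζ / 2) := Real.rpow_nonneg (relE_pos hm h1 h2).le _
  have hd := (dAlpha_pos (α := α) hr hR).le
  have hlo := hK.lower_bound p.1.1 p.2.1 p.1.2 p.2.2 ω.1 ω.2.1 h1 h2 hr hR
  have hup := hK.upper_bound p.1.1 p.2.1 p.1.2 p.2.2 ω.1 ω.2.1 h1 h2 hr hR
  unfold collRate angProfile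
  set s := ⟪dir (p.1.1 - p.2.1), (ω.2.2 : Vel)⟫ with hs
  by_cases h0 : 0 ≤ s
  · have hs1 : s ≤ 1 := by
      have := real_inner_le_norm (dir (p.1.1 - p.2.1)) (ω.2.2 : Vel)
      rw [norm_dir (sub_ne_zero.2 hne)] at this
      simpa using this
    have hb := hK.b_nonneg s ⟨h0, hs1⟩
    rw [indicator_of_mem (by exact h0), indicator_of_mem (by exact h0), ← ENNReal.ofReal_mul' hb,
      ← ENNReal.ofReal_mul he, ← ENNReal.ofReal_mul' hb, ← ENNReal.ofReal_mul he]
    have hbd : 0 ≤ b s * dAlpha α ω.1 ω.2.1 := mul_nonneg hb hd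
    have e1 := mul_le_mul_of_nonneg_right hlo hbd
    have e2 := mul_le_mul_of_nonneg_right hup hbd
    simp only [relE] at he ⊢
    constructor <;> refine ENNReal.ofReal_le_ofReal ?_
    · exact (le_of_eq (by ring)).trans (e1.trans (le_of_eq (by ring)))
    · exact (le_of_eq (by ring)).trans (e2.trans (le_of_eq (by ring)))
  · rw [indicator_of_notMem (by exact h0), indicator_of_notMem (by exact h0)]
    simp

/-- Measurable two-sided bounds for the collision rate. -/
theorem IsHardKernel.exists_rate_bounds (hK : IsHardKernel m α ζ b B blb bub) (hm : 0 < m) :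
    ∃ gl gu : ℝ × ℝ → ℝ≥0∞, Measurable gl ∧ Measurable gu ∧
      ∫⁻ r in Ioo (0 : ℝ) 1, ∫⁻ R in Ioo (0 : ℝ) 1, gl (r, R) ≠ 0 ∧
      ∫⁻ r in Ioo (0 : ℝ) 1, ∫⁻ R in Ioo (0 : ℝ) 1, gl (r, R) ≠ ∞ ∧
      ∫⁻ r in Ioo (0 : ℝ) 1, ∫⁻ R in Ioo (0 : ℝ) 1, gu (r, R) ≠ ∞ ∧
      ∀ᵐ ω ∂angMeasure, (ω.1 ∈ Ioo (0 : ℝ) 1 ∧ ω.2.1 ∈ Ioo (0 : ℝ) 1) ∧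
        ∀ p : (Vel × ℝ) × (Vel × ℝ), 0 < p.1.2 → 0 < p.2.2 → p.1.1 ≠ p.2.1 →
        ENNReal.ofReal (relE m p ^ (ζ / 2)) * (gl (ω.1, ω.2.1) *
          angProfile b ⟪dir (p.1.1 - p.2.1), (ω.2.2 : Vel)⟫) ≤ collRate α b B (p, ω) ∧
        collRate α b B (p, ω) ≤ ENNReal.ofReal (relE m p ^ (ζ / 2)) * (gu (ω.1, ω.2.1) *
          angProfile b ⟪dir (p.1.1 - p.2.1), (ω.2.2 : Vel)⟫) := by
  obtain ⟨gl, hgl, -, hla, hli⟩ := exists_measurable_weight hK.blb_integrable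
  obtain ⟨gu, hgu, -, hua, hui⟩ := exists_measurable_weight hK.bub_integrable
  refine ⟨gl, gu, hgl, hgu, ?_, ?_, ?_, ?_⟩
  · rw [hli]
    intro h0
    have h1 := integral_eq_lintegral_pos_part_sub_lintegral_neg_part hK.blb_integrable
    rw [h0] at h1
    have h2 := hK.blb_pos
    rw [h1] at h2
    simp only [ENNReal.toReal_zero, zero_sub] at h2
    exact absurd h2 (not_lt.2 (neg_nonpos.2 ENNReal.toReal_nonneg))
  · rw [hli]; exact hK.blb_integrable.lintegral_lt_top.ne
  · rw [hui]; exact hK.bub_integrable.lintegral_lt_top.ne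
  · filter_upwards [hla, hua, ae_angMeasure] with ω e1 e2 hω
    refine ⟨hω, fun p h1 h2 hne => ?_⟩
    rw [← e1, ← e2]
    exact collRate_le hK hm h1 h2 hne hω.1 hω.2

/-- A collision measure integral is bounded by the relative energy to the power `ζ / 2`. -/
theorem IsHardKernel.exists_lintegral_le_angConst_mul (hK : IsHardKernel m α ζ b B blb bub)
    (hm : 0 < m) :
    ∃ C : ℝ≥0∞, C ≠ ∞ ∧ ∀ G : (Vel × ℝ) × (Vel × ℝ) → ℝ≥0∞, Measurable G →
      ∫⁻ y, G y.1 ∂collMeasure m α b B ≤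
        C * angConst b * ∫⁻ p, G p * ENNReal.ofReal (relE m p ^ (ζ / 2))
          ∂((gasMeasure α).prod (gasMeasure α)) := by
  obtain ⟨gl, gu, hgl, hgu, -, -, hfin, hω⟩ := hK.exists_rate_bounds hm
  have hbm := measurable_angProfile hK.measurable_b
  refine ⟨_, hfin, fun G hG => ?_⟩
  rw [hK.lintegral_collMeasure (by fun_prop), ← lintegral_const_mul _ (by fun_prop)]
  refine lintegral_mono_ae (((ae_pair_pos α).and (ae_pair_ne α)).mono fun p hp => ?_)
  calc ∫⁻ ω, collRate α b B (p, ω) * G p ∂angMeasure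
      ≤ ∫⁻ ω, (G p * ENNReal.ofReal (relE m p ^ (ζ / 2))) * (gu (ω.1, ω.2.1) *
          angProfile b ⟪dir (p.1.1 - p.2.1), (ω.2.2 : Vel)⟫) ∂angMeasure := by
        refine lintegral_mono_ae (hω.mono fun ω h => ?_)
        rw [mul_assoc, mul_comm]
        exact mul_le_mul_right (h.2 p hp.1.1 hp.1.2 hp.2).2 _
    _ = _ := by
        rw [lintegral_const_mul _ (by fun_prop), lintegral_ang_mul_angProfile hK.measurable_b
          (norm_dir (sub_ne_zero.2 hp.2)) _ hgu, mul_comm]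

theorem IsHardKernel.exists_lintegral_le (hK : IsHardKernel m α ζ b B blb bub) (hm : 0 < m)
    (hb : angConst b ≠ ∞) :
    ∃ C : ℝ≥0∞, C ≠ ∞ ∧ ∀ G : (Vel × ℝ) × (Vel × ℝ) → ℝ≥0∞, Measurable G →
      ∫⁻ y, G y.1 ∂collMeasure m α b B ≤
        C * ∫⁻ p, G p * ENNReal.ofReal (relE m p ^ (ζ / 2))
          ∂((gasMeasure α).prod (gasMeasure α)) := by
  obtain ⟨C, hC, h⟩ := hK.exists_lintegral_le_angConst_mul hm
  exact ⟨C * angConst b, ENNReal.mul_ne_top hC hb, h⟩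

/-- A weighted lower bound for collision measure integrals, with a weight that may depend on the
collision parameters. -/
theorem IsHardKernel.exists_le_lintegral (hK : IsHardKernel m α ζ b B blb bub) (hm : 0 < m)
    (k : ℝ × ℝ → ℝ≥0∞) (hk : Measurable k)
    (hk0 : ∀ r ∈ Ioo (0 : ℝ) 1, ∀ R ∈ Ioo (0 : ℝ) 1, k (r, R) ≠ 0) :
    ∃ c : ℝ≥0∞, c ≠ 0 ∧ ∀ G : (Vel × ℝ) × (Vel × ℝ) → ℝ≥0∞, Measurable G →
      c * angConst b * ∫⁻ p, G p * ENNReal.ofReal (relE m p ^ (ζ / 2))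
          ∂((gasMeasure α).prod (gasMeasure α)) ≤
      ∫⁻ p, ∫⁻ ω, collRate α b B (p, ω) * (G p * k (ω.1, ω.2.1)) ∂angMeasure
        ∂((gasMeasure α).prod (gasMeasure α)) := by
  obtain ⟨gl, gu, hgl, hgu, h0, -, -, hω⟩ := hK.exists_rate_bounds hm
  have hbm := measurable_angProfile hK.measurable_b
  refine ⟨∫⁻ r in Ioo (0 : ℝ) 1, ∫⁻ R in Ioo (0 : ℝ) 1, gl (r, R) * k (r, R), ?_, fun G hG => ?_⟩
  · intro hz
    apply h0
    rw [lintegral_eq_zero_iff (by fun_prop)] at hz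
    rw [lintegral_eq_zero_iff (by fun_prop)]
    filter_upwards [hz, ae_restrict_mem measurableSet_Ioo] with r h1 hr
    simp only [Pi.zero_apply] at h1 ⊢
    rw [lintegral_eq_zero_iff (by fun_prop)] at h1 ⊢
    filter_upwards [h1, ae_restrict_mem measurableSet_Ioo] with R h2 hR
    simpa [hk0 r hr R hR] using h2
  rw [← lintegral_const_mul _ (by fun_prop)]
  refine lintegral_mono_ae (((ae_pair_pos α).and (ae_pair_ne α)).mono fun p hp => ?_)
  calc _ = ∫⁻ ω, (G p * ENNReal.ofReal (relE m p ^ (ζ / 2))) * (gl (ω.1, ω.2.1) *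
          k (ω.1, ω.2.1) * angProfile b ⟪dir (p.1.1 - p.2.1), (ω.2.2 : Vel)⟫) ∂angMeasure := by
        rw [lintegral_const_mul _ (by fun_prop), lintegral_ang_mul_angProfile hK.measurable_b
          (norm_dir (sub_ne_zero.2 hp.2)) (fun x => gl x * k x) (by fun_prop), mul_comm]
    _ ≤ _ := by
        refine lintegral_mono_ae (hω.mono fun ω h => ?_)
        calc _ = ENNReal.ofReal (relE m p ^ (ζ / 2)) * (gl (ω.1, ω.2.1) *
              angProfile b ⟪dir (p.1.1 - p.2.1), (ω.2.2 : Vel)⟫) * (G p * k (ω.1, ω.2.1)) := by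
                ring
          _ ≤ _ := mul_le_mul_left (h.2 p hp.1.1 hp.1.2 hp.2).1 _

/-- A collision measure integral is bounded below by the relative energy to the power `ζ / 2`. -/
theorem IsHardKernel.exists_const_mul_le (hK : IsHardKernel m α ζ b B blb bub) (hm : 0 < m) :
    ∃ c : ℝ≥0∞, c ≠ 0 ∧ ∀ G : (Vel × ℝ) × (Vel × ℝ) → ℝ≥0∞, Measurable G →
      c * angConst b * ∫⁻ p, G p * ENNReal.ofReal (relE m p ^ (ζ / 2))
          ∂((gasMeasure α).prod (gasMeasure α)) ≤ ∫⁻ y, G y.1 ∂collMeasure m α b B := by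
  obtain ⟨c, hc, h⟩ := hK.exists_le_lintegral hm (fun _ => 1) measurable_const
    (fun _ _ _ _ => one_ne_zero)
  refine ⟨c, hc, fun G hG => (h G hG).trans (le_of_eq ?_)⟩
  rw [hK.lintegral_collMeasure (by fun_prop)]
  simp

/-- Reversed Povzner inequality: the square roots of the two energies after the collision
exceed the square root of the total energy by a definite fraction of it, on average. -/
theorem IsHardKernel.exists_povzner (hK : IsHardKernel m α ζ b B blb bub) (hm : 0 < m) :
    ∃ c : ℝ≥0∞, c ≠ 0 ∧ ∀ G : (Vel × ℝ) × (Vel × ℝ) → ℝ≥0∞, Measurable G →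
      ∫⁻ y, G y.1 * ENNReal.ofReal √(pairKin m y.1) ∂collMeasure m α b B +
      c * angConst b * ∫⁻ p, G p * ENNReal.ofReal √(pairKin m p) *
        ENNReal.ofReal (relE m p ^ (ζ / 2)) ∂((gasMeasure α).prod (gasMeasure α)) ≤
      ∫⁻ y, G y.1 * (ENNReal.ofReal √(kin m y.2.1) + ENNReal.ofReal √(kin m y.2.2))
        ∂collMeasure m α b B := by
  have hcr := hK.measurable_collRate
  obtain ⟨c, hc, h⟩ := hK.exists_le_lintegral hm
    (fun x => ENNReal.ofReal (energyShare x.1 x.2 / 2)) (by fun_prop)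
    (fun r hr R hR => by
      have := energyShare_pos hr hR
      simpa using this)
  refine ⟨c, hc, fun G hG => ?_⟩
  grw [h (fun p => G p * ENNReal.ofReal √(pairKin m p)) (by fun_prop)]
  rw [hK.lintegral_collMeasure (by fun_prop), hK.lintegral_collMeasure (by fun_prop),
    ← lintegral_add_left (by fun_prop)]
  refine lintegral_mono_ae ((ae_pair_pos α).mono fun p hp => ?_)
  rw [← lintegral_add_left (by fun_prop)]
  refine lintegral_mono_ae (ae_angMeasure.mono fun ω hω => ?_)
  simp only
  have hs := sqrt_kin_postConf hm hp.1 hp.2 hω.1 hω.2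
  have he := (energyShare_pos hω.1 hω.2).le
  calc _ = collRate α b B (p, ω) * (G p *
        ENNReal.ofReal ((1 + energyShare ω.1 ω.2.1 / 2) * √(pairKin m p))) := by
        rw [add_mul, ENNReal.ofReal_add (by positivity) (by positivity), one_mul,
          ENNReal.ofReal_mul (by positivity)]
        ring
    _ ≤ _ := by
        gcongr
        rw [← ENNReal.ofReal_add (by positivity) (by positivity)]
        exact ENNReal.ofReal_le_ofReal hs

end

/-! ### Spreading of mass by collisions -/

theorem lintegral_vel_affine {s : ℝ} (hs : 0 < s) (w : Vel) (A : Vel ≃ₗᵢ[ℝ] Vel)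
    (h : Vel → ℝ≥0∞) (hh : Measurable h) :
    ∫⁻ v, h (w + s • A v) = ENNReal.ofReal (s ^ 3)⁻¹ * ∫⁻ v, h v := by
  have hA := A.continuous.measurable
  rw [A.measurePreserving.lintegral_comp (f := fun v => h (w + s • v)) (by fun_prop),
    ← lintegral_map (f := fun v => h (w + v)) (g := fun v : Vel => s • v) (by fun_prop)
      (by fun_prop), Measure.map_addHaar_smul _ hs.ne', lintegral_smul_measure,
    lintegral_add_left_eq_self h w]
  simp [abs_of_pos hs]

/-- Scaling of `I^α dv dI`. -/
theorem lintegral_gasMeasure_affine (α : ℝ) {e : ℝ} (he : 0 < e) (w : Vel) (A : Vel ≃ₗᵢ[ℝ] Vel)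
    (h : Vel × ℝ → ℝ≥0∞) (hh : Measurable h) :
    ∫⁻ z, h (w + √e • A z.1, e * z.2) ∂gasMeasure α =
      ENNReal.ofReal (e ^ (5 / 2 + α))⁻¹ * ∫⁻ z, h z ∂gasMeasure α := by
  have hA := A.continuous.measurable
  have hse : 0 < √e := Real.sqrt_pos.2 he
  rw [lintegral_gasMeasure _ _ (by fun_prop), lintegral_gasMeasure _ _ hh,
    ← lintegral_const_mul _ (by fun_prop)]
  have h1 : ∀ v : Vel, ∫⁻ I in Ioi (0 : ℝ), ENNReal.ofReal (I ^ α) * h (w + √e • A v, e * I) =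
      ENNReal.ofReal (e ^ (1 + α))⁻¹ *
        ∫⁻ I in Ioi (0 : ℝ), ENNReal.ofReal (I ^ α) * h (w + √e • A v, I) := by
    intro v
    rw [lintegral_Ioi_mul_left he (fun I => ENNReal.ofReal (I ^ α) * h (w + √e • A v, I)),
      ← lintegral_const_mul _ (by fun_prop)]
    refine setLIntegral_congr_fun measurableSet_Ioi fun I hI => ?_
    have hI : 0 < I := hI
    rw [← mul_assoc, ← mul_assoc, ← ENNReal.ofReal_mul (by positivity),
      ← ENNReal.ofReal_mul (by positivity)]
    congr 2
    rw [Real.mul_rpow he.le hI.le, Real.rpow_add he, Real.rpow_one]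
    field_simp
  simp_rw [h1]
  rw [lintegral_const_mul _ (by fun_prop), lintegral_vel_affine hse w A (fun v =>
    ∫⁻ I in Ioi (0 : ℝ), ENNReal.ofReal (I ^ α) * h (v, I)) (by fun_prop), ← mul_assoc,
    ← ENNReal.ofReal_mul (by positivity), lintegral_const_mul _ (by fun_prop)]
  congr 2
  have : √e ^ 3 = e ^ (3 / 2 : ℝ) := by
    rw [Real.sqrt_eq_rpow, ← Real.rpow_natCast, ← Real.rpow_mul he.le]; norm_num
  rw [this, ← mul_inv, ← Real.rpow_add he]
  congr 2; ring

theorem gasMeasure_preimage_affine (α : ℝ) {e : ℝ} (he : 0 < e) (w : Vel) (A : Vel ≃ₗᵢ[ℝ] Vel)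
    {s : Set (Vel × ℝ)} (hs : MeasurableSet s) :
    gasMeasure α ((fun z : Vel × ℝ => (w + √e • A z.1, e * z.2)) ⁻¹' s) =
      ENNReal.ofReal (e ^ (5 / 2 + α))⁻¹ * gasMeasure α s := by
  have hA := A.continuous.measurable
  have h := lintegral_gasMeasure_affine α he w A (s.indicator 1) (measurable_one.indicator hs)
  rw [lintegral_indicator_one hs] at h
  rw [← h, ← lintegral_indicator_one (by measurability)]
  rfl

/-- The state `(√R σ, m r (1 - R))` of the first molecule after a collision of unit energy with
centre of mass at rest. -/
noncomputable def unitPost (m : ℝ) (ω : ℝ × ℝ × S2) : Vel × ℝ :=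
  (√ω.2.1 • (ω.2.2 : Vel), m * (ω.1 * (1 - ω.2.1)))

@[fun_prop] theorem measurable_unitPost (m : ℝ) : Measurable (unitPost m) := by
  unfold unitPost; fun_prop

theorem lintegral_eq_zero_of_gasMeasure_eq_zero (α : ℝ) {s : Set (Vel × ℝ)} (hs : MeasurableSet s)
    (h : gasMeasure α s = 0) :
    ∫⁻ v, ∫⁻ I in Ioi (0 : ℝ), s.indicator 1 (v, I) = 0 := by
  have hm : Measurable (s.indicator (1 : Vel × ℝ → ℝ≥0∞)) := measurable_one.indicator hs
  rw [← lintegral_indicator_one hs, lintegral_gasMeasure _ _ hm,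
    lintegral_eq_zero_iff (by fun_prop)] at h
  rw [lintegral_eq_zero_iff (by fun_prop)]
  filter_upwards [h] with v hv
  simp only [Pi.zero_apply] at hv ⊢
  rw [lintegral_eq_zero_iff (by fun_prop)] at hv ⊢
  filter_upwards [hv, ae_restrict_mem measurableSet_Ioi] with I h1 hI
  have hI : 0 < I := hI
  have h2 : ENNReal.ofReal (I ^ α) ≠ 0 := by
    have : 0 < I ^ α := by positivity
    simpa using this
  simpa [h2] using h1

/-- The law of the state of a molecule after a collision has a density: `(√R σ, m r (1 - R))` are
polar coordinates of the velocity, together with a multiple of `r`. -/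
theorem map_unitPost_absolutelyContinuous {m : ℝ} (hm : 0 < m) (α : ℝ) :
    angMeasure.map (unitPost m) ≪ gasMeasure α := by
  refine Measure.AbsolutelyContinuous.mk fun s hs h0 => ?_
  have hms : Measurable (s.indicator (1 : Vel × ℝ → ℝ≥0∞)) := measurable_one.indicator hs
  have h1 := lintegral_eq_zero_of_gasMeasure_eq_zero α hs h0
  rw [lintegral_vel_polar _ (by fun_prop), lintegral_eq_zero_iff (by fun_prop)] at h1
  rw [Measure.map_apply (by fun_prop) hs, ← lintegral_indicator_one (measurable_unitPost m hs)]
  change ∫⁻ ω, s.indicator 1 (unitPost m ω) ∂angMeasure = 0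
  rw [lintegral_angMeasure _ (by fun_prop), lintegral_lintegral_swap (by fun_prop),
    lintegral_eq_zero_iff (by fun_prop)]
  have h2 := ae_mono (Measure.restrict_mono (Ioo_subset_Ioi_self : Ioo (0 : ℝ) 1 ⊆ Ioi 0) le_rfl) h1
  filter_upwards [h2, ae_restrict_mem measurableSet_Ioo] with R hR hR1
  have hR0 : 0 < √R := Real.sqrt_pos.2 hR1.1
  have hc : 0 < m * (1 - R) := mul_pos hm (sub_pos.2 hR1.2)
  simp only [Pi.zero_apply, mul_eq_zero, ENNReal.ofReal_eq_zero] at hR ⊢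
  rcases hR with hR | hR
  · linarith
  rw [lintegral_lintegral_swap (by fun_prop)]
  rw [lintegral_eq_zero_iff (by fun_prop)] at hR ⊢
  filter_upwards [hR] with σ hσ
  simp only [Pi.zero_apply] at hσ ⊢
  rw [lintegral_Ioi_mul_left hc, lintegral_const_mul _ (by fun_prop), mul_eq_zero] at hσ
  rcases hσ with hσ | hσ
  · rw [ENNReal.ofReal_eq_zero] at hσ; linarith
  refine le_antisymm (le_trans ?_ hσ.le) zero_le
  refine (lintegral_mono fun r => le_of_eq ?_).trans (lintegral_mono_set Ioo_subset_Ioi_self)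
  simp only [unitPost]
  congr 2; ring

/-- Quantitative absolute continuity of finite measures. -/
theorem exists_measure_lt_of_absolutelyContinuous {X : Type*} [MeasurableSpace X]
    {κ μ : Measure X} [IsFiniteMeasure κ] [SigmaFinite μ] (h : κ ≪ μ) {η : ℝ≥0∞} (hη : η ≠ 0) :
    ∃ δ > 0, ∀ s, MeasurableSet s → μ s < δ → κ s < η := by
  have hf : ∫⁻ x, κ.rnDeriv μ x ∂μ ≠ ∞ := by
    have := Measure.lintegral_rnDeriv_le (μ := κ) (ν := μ)
    exact (this.trans_lt (measure_lt_top κ univ)).ne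
  obtain ⟨δ, hδ, H⟩ := exists_pos_setLIntegral_lt_of_measure_lt hf hη
  refine ⟨δ, hδ, fun s hs hlt => ?_⟩
  have := H s hlt
  rwa [← withDensity_apply _ hs, Measure.withDensity_rnDeriv_eq _ _ h] at this

section
variable {m α ζ : ℝ} {b : ℝ → ℝ} {B : Vel → Vel → ℝ → ℝ → ℝ → ℝ → ℝ} {blb bub : ℝ → ℝ → ℝ}

theorem measurable_comp_postConf_fst (m : ℝ) (p : (Vel × ℝ) × (Vel × ℝ))
    {h : Vel × ℝ → ℝ≥0∞} (hh : Measurable h) : Measurable fun ω => h (postConf m p ω).1 := by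
  have h1 : Measurable fun ω => postConf m p ω := by
    unfold postConf vPost vsPost iPost isPost collE
    fun_prop
  exact hh.comp (measurable_fst.comp h1)

theorem postConf_sphereMap (hm : 0 < m) {p : (Vel × ℝ) × (Vel × ℝ)} (h1 : 0 < p.1.2)
    (h2 : 0 < p.2.2) (A : Vel ≃ₗᵢ[ℝ] Vel) (r R : ℝ) (σ : S2) :
    (postConf m p (r, R, sphereMap A σ)).1 =
      ((1 / 2 : ℝ) • (p.1.1 + p.2.1) + √(relE m p) • A (unitPost m (r, R, σ)).1,
        relE m p * (unitPost m (r, R, σ)).2) := by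
  have he := relE_pos hm h1 h2
  have hc : collE m p.1.1 p.2.1 p.1.2 p.2.2 = m * relE m p := by unfold relE; field_simp
  have h3 : R * (m * relE m p) / m = relE m p * R := by field_simp
  simp only [postConf, vPost, iPost, hc, unitPost, coe_sphereMap, map_smul, smul_smul, h3,
    Real.sqrt_mul he.le, Prod.mk.injEq]
  exact ⟨trivial, by ring⟩

/-- The law of the first molecule after the collision of a given pair is an affine image of a
fixed law. -/
theorem lintegral_postConf_eq (hb : Measurable b) (hm : 0 < m) {p : (Vel × ℝ) × (Vel × ℝ)}
    (h1 : 0 < p.1.2) (h2 : 0 < p.2.2) {A : Vel ≃ₗᵢ[ℝ] Vel}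
    (hA : A poleVel = dir (p.1.1 - p.2.1)) {g : ℝ × ℝ → ℝ≥0∞} (hg : Measurable g)
    {h : Vel × ℝ → ℝ≥0∞} (hh : Measurable h) :
    ∫⁻ ω, (g (ω.1, ω.2.1) * angProfile b ⟪dir (p.1.1 - p.2.1), (ω.2.2 : Vel)⟫) *
        h (postConf m p ω).1 ∂angMeasure =
      ∫⁻ z, h ((1 / 2 : ℝ) • (p.1.1 + p.2.1) + √(relE m p) • A z.1, relE m p * z.2)
        ∂((angMeasure.withDensity fun ω => g (ω.1, ω.2.1) *
          angProfile b ⟪poleVel, (ω.2.2 : Vel)⟫).map (unitPost m)) := by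
  have hbm := measurable_angProfile hb
  have hAm := A.continuous.measurable
  have hJ : Measurable fun ω => h (postConf m p ω).1 :=
    measurable_comp_postConf_fst m p hh
  have hL : Measurable fun ω : ℝ × ℝ × S2 => (g (ω.1, ω.2.1) *
      angProfile b ⟪dir (p.1.1 - p.2.1), (ω.2.2 : Vel)⟫) * h (postConf m p ω).1 :=
    Measurable.mul (by fun_prop) hJ
  have hL' : ∀ r R, Measurable fun σ : S2 => (g (r, R) *
      angProfile b ⟪dir (p.1.1 - p.2.1), (σ : Vel)⟫) * h (postConf m p (r, R, σ)).1 := fun r R =>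
    hL.comp (measurable_prodMk_left.comp measurable_prodMk_left)
  rw [lintegral_map (by fun_prop) (by fun_prop), lintegral_withDensity_eq_lintegral_mul _
    (by fun_prop) (by fun_prop), lintegral_angMeasure _ hL,
    lintegral_angMeasure _ (by fun_prop)]
  refine lintegral_congr fun r => lintegral_congr fun R => ?_
  simp only
  rw [← lintegral_sphereMap A _ (hL' r R)]
  refine lintegral_congr fun σ => ?_
  simp only [postConf_sphereMap hm h1 h2, ← hA, coe_sphereMap, LinearIsometryEquiv.inner_map_map]
  rfl

/-- Collisions spread mass: a pair whose relative energy is at least `ε` is unlikely to send a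
molecule to a given set of small measure. The law of the outgoing molecule is the image of a fixed
absolutely continuous measure under a map that scales `I^α dv dI` by a power of the relative
energy. -/
theorem IsHardKernel.exists_spread (hK : IsHardKernel m α ζ b B blb bub) (hm : 0 < m)
    (hb : angConst b ≠ ∞) (hα : -1 < α) {η : ℝ≥0∞} (hη : η ≠ 0) :
    ∃ δ > 0, ∀ s, MeasurableSet s → ∀ ε : ℝ, 0 < ε →
      ENNReal.ofReal (ε ^ (5 / 2 + α))⁻¹ * gasMeasure α s < δ →
      ∀ G : (Vel × ℝ) × (Vel × ℝ) → ℝ≥0∞, Measurable G → (∀ p, relE m p < ε → G p = 0) →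
      ∫⁻ y, G y.1 * s.indicator 1 y.2.1 ∂collMeasure m α b B ≤
        η * ∫⁻ p, G p * ENNReal.ofReal (relE m p ^ (ζ / 2))
          ∂((gasMeasure α).prod (gasMeasure α)) := by
  obtain ⟨gl, gu, hgl, hgu, -, -, hfin, hω⟩ := hK.exists_rate_bounds hm
  have hbm := measurable_angProfile hK.measurable_b
  have hDfin : ∫⁻ ω, gu (ω.1, ω.2.1) * angProfile b ⟪poleVel, (ω.2.2 : Vel)⟫ ∂angMeasure ≠ ∞ := by
    rw [lintegral_ang_mul_angProfile hK.measurable_b norm_poleVel _ hgu]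
    exact ENNReal.mul_ne_top hfin hb
  obtain ⟨κ, hκ⟩ : ∃ κ, κ = (angMeasure.withDensity fun ω => gu (ω.1, ω.2.1) *
          angProfile b ⟪poleVel, (ω.2.2 : Vel)⟫).map (unitPost m) := ⟨_, rfl⟩
  have hκf : IsFiniteMeasure κ := by
    have := isFiniteMeasure_withDensity hDfin
    rw [hκ]
    infer_instance
  have hac : κ ≪ gasMeasure α := by
    rw [hκ]
    exact ((withDensity_absolutelyContinuous _ _).map (measurable_unitPost m)).trans
      (map_unitPost_absolutelyContinuous hm α)
  obtain ⟨δ, hδ, H⟩ := exists_measure_lt_of_absolutelyContinuous hac hη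
  refine ⟨δ, hδ, fun s hs ε hε hsm G hG hG0 => ?_⟩
  have hsi : Measurable (s.indicator (1 : Vel × ℝ → ℝ≥0∞)) := measurable_one.indicator hs
  have hcr := hK.measurable_collRate
  rw [hK.lintegral_collMeasure (G := fun y => G y.1 * s.indicator 1 y.2.1) (by fun_prop),
    ← lintegral_const_mul _ (by fun_prop)]
  refine lintegral_mono_ae (((ae_pair_pos α).and (ae_pair_ne α)).mono fun p hp => ?_)
  by_cases hpe : relE m p < ε
  · simp [hG0 p hpe]
  rw [not_lt] at hpe
  have he := relE_pos hm hp.1.1 hp.1.2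
  obtain ⟨A, hA⟩ := exists_isometry_pole (norm_dir (sub_ne_zero.2 hp.2))
  have hAm := A.continuous.measurable
  obtain ⟨τ, hτ⟩ : ∃ τ : Vel × ℝ → Vel × ℝ, τ = fun z =>
    ((1 / 2 : ℝ) • (p.1.1 + p.2.1) + √(relE m p) • A z.1, relE m p * z.2) := ⟨_, rfl⟩
  have hτm : Measurable τ := by rw [hτ]; fun_prop
  have hκs : κ (τ ⁻¹' s) ≤ η := by
    refine (H _ (hτm hs) ?_).le
    rw [hτ, gasMeasure_preimage_affine α he _ A hs]
    refine lt_of_le_of_lt ?_ hsm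
    gcongr
    linarith
  obtain ⟨J, hJ⟩ : ∃ J : ℝ × ℝ × S2 → ℝ≥0∞, J = fun ω => s.indicator 1 (postConf m p ω).1 :=
    ⟨_, rfl⟩
  have hJm : Measurable J := by rw [hJ]; exact measurable_comp_postConf_fst m p hsi
  have hJint : ∫⁻ ω, (gu (ω.1, ω.2.1) *
      angProfile b ⟪dir (p.1.1 - p.2.1), (ω.2.2 : Vel)⟫) * J ω ∂angMeasure = κ (τ ⁻¹' s) := by
    rw [hJ, hκ, ← lintegral_indicator_one (hτm hs), hτ]
    exact lintegral_postConf_eq hK.measurable_b hm hp.1.1 hp.1.2 hA hgu hsi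
  calc ∫⁻ ω, collRate α b B (p, ω) * (G p * s.indicator 1 (postConf m p ω).1) ∂angMeasure
      = ∫⁻ ω, collRate α b B (p, ω) * (G p * J ω) ∂angMeasure := by rw [hJ]
    _ ≤ ∫⁻ ω, (G p * ENNReal.ofReal (relE m p ^ (ζ / 2))) * ((gu (ω.1, ω.2.1) *
          angProfile b ⟪dir (p.1.1 - p.2.1), (ω.2.2 : Vel)⟫) * J ω) ∂angMeasure := by
        refine lintegral_mono_ae (hω.mono fun ω h => ?_)
        calc _ ≤ ENNReal.ofReal (relE m p ^ (ζ / 2)) * (gu (ω.1, ω.2.1) *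
              angProfile b ⟪dir (p.1.1 - p.2.1), (ω.2.2 : Vel)⟫) * (G p * J ω) :=
              mul_le_mul_left (h.2 p hp.1.1 hp.1.2 hp.2).2 _
          _ = _ := by ring
    _ = (G p * ENNReal.ofReal (relE m p ^ (ζ / 2))) * κ (τ ⁻¹' s) := by
        rw [lintegral_const_mul _ (by fun_prop), hJint]
    _ ≤ η * (G p * ENNReal.ofReal (relE m p ^ (ζ / 2))) := by
        rw [mul_comm]; gcongr

end

/-! ### Weak form of the gain and the loss term -/

theorem ae_stateMeasure_pos : ∀ᵐ z ∂stateMeasure, 0 < z.2 := by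
  unfold stateMeasure
  exact Measure.quasiMeasurePreserving_snd.ae (ae_restrict_mem measurableSet_Ioi)

/-- The density of `f` with respect to `I^α dv dI`; the positive part only changes it on a null
set when `f` is nonnegative almost everywhere. -/
noncomputable def gasDensity (α : ℝ) (f : Vel × ℝ → ℝ) (z : Vel × ℝ) : ℝ :=
  max (f z) 0 * z.2 ^ (-α)

theorem measurable_gasDensity (α : ℝ) {f : Vel × ℝ → ℝ} (hf : Measurable f) :
    Measurable (gasDensity α f) := by unfold gasDensity; fun_prop

theorem gasDensity_nonneg (α : ℝ) (f : Vel × ℝ → ℝ) {z : Vel × ℝ} (hz : 0 < z.2) :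
    0 ≤ gasDensity α f z := by unfold gasDensity; positivity

theorem ofReal_rpow_mul_gasDensity (α : ℝ) (f : Vel × ℝ → ℝ) {z : Vel × ℝ} (hz : 0 < z.2) :
    ENNReal.ofReal (z.2 ^ α) * ENNReal.ofReal (gasDensity α f z) = ENNReal.ofReal (f z) := by
  rw [← ENNReal.ofReal_mul (by positivity)]
  have : z.2 ^ α * gasDensity α f z = max (f z) 0 := by
    unfold gasDensity
    rw [Real.rpow_neg hz.le]
    field_simp
  rw [this]
  simp [ENNReal.ofReal, Real.toNNReal]

theorem lintegral_gasMeasure_eq (α : ℝ) (h : Vel × ℝ → ℝ≥0∞) (hh : Measurable h) :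
    ∫⁻ z, h z ∂gasMeasure α = ∫⁻ z, ENNReal.ofReal (z.2 ^ α) * h z ∂stateMeasure := by
  unfold gasMeasure
  rw [lintegral_withDensity_eq_lintegral_mul _ (by fun_prop) hh]
  rfl

theorem lintegral_gasDensity (α : ℝ) {f : Vel × ℝ → ℝ} (hf : Measurable f)
    (φ : Vel × ℝ → ℝ≥0∞) (hφ : Measurable φ) :
    ∫⁻ z, ENNReal.ofReal (gasDensity α f z) * φ z ∂gasMeasure α =
      ∫⁻ z, ENNReal.ofReal (f z) * φ z ∂stateMeasure := by
  have := measurable_gasDensity α hf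
  rw [lintegral_gasMeasure_eq _ _ (by fun_prop)]
  refine lintegral_congr_ae (ae_stateMeasure_pos.mono fun z hz => ?_)
  simp only
  rw [← mul_assoc, ofReal_rpow_mul_gasDensity α f hz]

theorem ae_gasMeasure_of_ae (α : ℝ) {q : Vel × ℝ → Prop} (h : ∀ᵐ z ∂stateMeasure, q z) :
    ∀ᵐ z ∂gasMeasure α, q z :=
  (withDensity_absolutelyContinuous _ _).ae_le h

section
variable {m α ζ : ℝ} {b : ℝ → ℝ} {B : Vel → Vel → ℝ → ℝ → ℝ → ℝ → ℝ} {blb bub : ℝ → ℝ → ℝ}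

theorem IsHardKernel.rate_nonneg (hK : IsHardKernel m α ζ b B blb bub)
    {p : (Vel × ℝ) × (Vel × ℝ)} (h1 : 0 < p.1.2) (h2 : 0 < p.2.2)
    {r R : ℝ} (hr : r ∈ Ioo (0 : ℝ) 1) (hR : R ∈ Ioo (0 : ℝ) 1) {σ : S2}
    (hσ : 0 ≤ ⟪dir (p.1.1 - p.2.1), (σ : Vel)⟫) :
    0 ≤ B p.1.1 p.2.1 p.1.2 p.2.2 r R * b ⟪dir (p.1.1 - p.2.1), (σ : Vel)⟫ * dAlpha α r R := by
  refine mul_nonneg (mul_nonneg (hK.B_nonneg _ _ _ _ _ _ h1 h2 hr hR) (hK.b_nonneg _ ⟨hσ, ?_⟩))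
    (dAlpha_pos hr hR).le
  have h3 := real_inner_le_norm (dir (p.1.1 - p.2.1)) (σ : Vel)
  have h4 : ‖dir (p.1.1 - p.2.1)‖ ≤ 1 := by
    by_cases h : p.1.1 - p.2.1 = 0
    · simp [dir, h]
    · exact (norm_dir h).le
  have h5 : ‖(σ : Vel)‖ = 1 := by simp
  rw [h5, mul_one] at h3
  exact h3.trans h4

/-- Integrals over the collision parameters, in the form in which they enter the gain and the
loss term. -/
theorem lintegral_collRate (hK : IsHardKernel m α ζ b B blb bub) {z w : Vel × ℝ}
    (h1 : 0 < z.2) (h2 : 0 < w.2) {h : ℝ × ℝ × S2 → ℝ} (hh : Measurable h) :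
    ∫⁻ ω, collRate α b B ((z, w), ω) * ENNReal.ofReal (h ω) ∂angMeasure =
      ∫⁻ r in Icc (0 : ℝ) 1, (∫⁻ R in Icc (0 : ℝ) 1, (∫⁻ σ in halfSphere (z.1 - w.1),
        ENNReal.ofReal (h (r, R, σ) * (B z.1 w.1 z.2 w.2 r R * b ⟪dir (z.1 - w.1), (σ : Vel)⟫ *
          dAlpha α r R)) ∂surf)) := by
  have hcr := hK.measurable_collRate
  rw [Measure.restrict_congr_set (Ioo_ae_eq_Icc (a := (0 : ℝ)) (b := 1)).symm,
    lintegral_angMeasure _ (by fun_prop)]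
  refine setLIntegral_congr_fun measurableSet_Ioo fun r hr => ?_
  refine setLIntegral_congr_fun measurableSet_Ioo fun R hR => ?_
  have hs : MeasurableSet (halfSphere (z.1 - w.1)) :=
    measurableSet_le measurable_const (by fun_prop)
  rw [← lintegral_indicator hs]
  refine lintegral_congr fun σ => ?_
  by_cases hσ : 0 ≤ ⟪dir (z.1 - w.1), (σ : Vel)⟫
  · have e1 : σ ∈ halfSphere (z.1 - w.1) := hσ
    rw [indicator_of_mem e1, collRate, indicator_of_mem (by exact hσ), mul_comm,
      ENNReal.ofReal_mul' (hK.rate_nonneg (p := (z, w)) h1 h2 hr hR hσ)]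
  · have e1 : σ ∉ halfSphere (z.1 - w.1) := hσ
    rw [indicator_of_notMem e1, collRate, indicator_of_notMem (by exact hσ), zero_mul]

theorem measurable_rate_mul (hK : IsHardKernel m α ζ b B blb bub)
    {G : ((Vel × ℝ) × (Vel × ℝ)) × ((Vel × ℝ) × (Vel × ℝ)) → ℝ≥0∞} (hG : Measurable G) :
    Measurable fun p => ∫⁻ ω, collRate α b B (p, ω) * G (p, postConf m p ω) ∂angMeasure := by
  have hcr := hK.measurable_collRate
  have h1 : Measurable fun y : ((Vel × ℝ) × (Vel × ℝ)) × (ℝ × ℝ × S2) =>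
      collRate α b B y * G (y.1, postConf m y.1 y.2) := by fun_prop
  exact h1.lintegral_prod_right'

theorem measurable_rate_mul_right (hK : IsHardKernel m α ζ b B blb bub)
    {G : ((Vel × ℝ) × (Vel × ℝ)) × ((Vel × ℝ) × (Vel × ℝ)) → ℝ≥0∞} (hG : Measurable G)
    (z : Vel × ℝ) : Measurable fun w =>
      ∫⁻ ω, collRate α b B ((z, w), ω) * G ((z, w), postConf m (z, w) ω) ∂angMeasure :=
  (measurable_rate_mul hK hG).comp measurable_prodMk_left

/-- The integral over `dv_* dI_*` and over the collision parameters of a function `G` of the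
collision, in terms of the reference measure. The gain and the loss term are of this form. -/
noncomputable def gainAux (m α : ℝ) (b : ℝ → ℝ) (B : Vel → Vel → ℝ → ℝ → ℝ → ℝ → ℝ)
    (G : ((Vel × ℝ) × (Vel × ℝ)) × ((Vel × ℝ) × (Vel × ℝ)) → ℝ≥0∞) (z : Vel × ℝ) : ℝ≥0∞ :=
  ENNReal.ofReal (z.2 ^ α) * ∫⁻ w, ∫⁻ ω, collRate α b B ((z, w), ω) *
    G ((z, w), postConf m (z, w) ω) ∂angMeasure ∂gasMeasure α

theorem measurable_gainAux (hK : IsHardKernel m α ζ b B blb bub)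
    {G : ((Vel × ℝ) × (Vel × ℝ)) × ((Vel × ℝ) × (Vel × ℝ)) → ℝ≥0∞} (hG : Measurable G) :
    Measurable (gainAux m α b B G) := by
  have := measurable_rate_mul hK hG
  unfold gainAux
  exact Measurable.mul (by fun_prop) this.lintegral_prod_right'

theorem lintegral_gainAux (hK : IsHardKernel m α ζ b B blb bub)
    {G : ((Vel × ℝ) × (Vel × ℝ)) × ((Vel × ℝ) × (Vel × ℝ)) → ℝ≥0∞} (hG : Measurable G)
    {φ : Vel × ℝ → ℝ≥0∞} (hφ : Measurable φ) :
    ∫⁻ z, φ z * gainAux m α b B G z ∂stateMeasure =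
      ∫⁻ y, φ y.1.1 * G y ∂collMeasure m α b B := by
  have hr := measurable_rate_mul hK hG
  have hr' := measurable_rate_mul hK (G := fun y => φ y.1.1 * G y) (by fun_prop)
  rw [hK.lintegral_collMeasure (by fun_prop), lintegral_prod _ hr'.aemeasurable,
    lintegral_gasMeasure_eq _ _ hr'.lintegral_prod_right']
  refine lintegral_congr fun z => ?_
  unfold gainAux
  rw [mul_left_comm, ← lintegral_const_mul _ (measurable_rate_mul_right hK hG z)]
  congr 1
  refine lintegral_congr fun w => ?_
  have hcr := hK.measurable_collRate
  have h1 : Measurable fun y : ((Vel × ℝ) × (Vel × ℝ)) × (ℝ × ℝ × S2) =>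
      collRate α b B y * G (y.1, postConf m y.1 y.2) := by fun_prop
  have h2 : Measurable fun ω => collRate α b B ((z, w), ω) * G ((z, w), postConf m (z, w) ω) :=
    h1.comp measurable_prodMk_left
  rw [← lintegral_const_mul _ h2]
  refine lintegral_congr fun ω => ?_
  ring

theorem iPost_pos (hm : 0 < m) {z w : Vel × ℝ} (h1 : 0 < z.2) (h2 : 0 < w.2) {r R : ℝ}
    (hr : r ∈ Ioo (0 : ℝ) 1) (hR : R ∈ Ioo (0 : ℝ) 1) :
    0 < iPost m z.1 w.1 z.2 w.2 r R ∧ 0 < isPost m z.1 w.1 z.2 w.2 r R := by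
  have h3 : 0 < 1 - r := sub_pos.2 hr.2
  have h4 : 0 < 1 - R := sub_pos.2 hR.2
  have := hr.1
  have hE : 0 < collE m z.1 w.1 z.2 w.2 := by unfold collE; positivity
  unfold iPost isPost
  constructor <;> positivity

theorem gain_eq_gainAux (hK : IsHardKernel m α ζ b B blb bub) (hm : 0 < m) {f : Vel × ℝ → ℝ}
    (hf : Measurable f) {z : Vel × ℝ} (hz : 0 < z.2) :
    gain m α b B f f z = gainAux m α b B (fun y => ENNReal.ofReal
      ((f y.2.1 * y.2.1.2 ^ (-α)) * (f y.2.2 * y.2.2.2 ^ (-α)))) z := by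
  have hG : Measurable fun y : ((Vel × ℝ) × (Vel × ℝ)) × ((Vel × ℝ) × (Vel × ℝ)) =>
    ENNReal.ofReal ((f y.2.1 * y.2.1.2 ^ (-α)) * (f y.2.2 * y.2.2.2 ^ (-α))) := by fun_prop
  have hr := measurable_rate_mul_right hK hG z
  unfold gain gainAux
  rw [lintegral_gasMeasure_eq _ _ hr,
    ← lintegral_const_mul' _ _ ENNReal.ofReal_ne_top]
  refine lintegral_congr_ae (ae_stateMeasure_pos.mono fun w hw => ?_)
  have hpm : Measurable fun ω : ℝ × ℝ × S2 => postConf m (z, w) ω := by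
    unfold postConf vPost vsPost iPost isPost collE
    fun_prop
  have hh0 : Measurable fun p : (Vel × ℝ) × (Vel × ℝ) =>
    (f p.1 * p.1.2 ^ (-α)) * (f p.2 * p.2.2 ^ (-α)) := by fun_prop
  have hh : Measurable fun ω : ℝ × ℝ × S2 =>
    (f (postConf m (z, w) ω).1 * (postConf m (z, w) ω).1.2 ^ (-α)) *
      (f (postConf m (z, w) ω).2 * (postConf m (z, w) ω).2.2 ^ (-α)) := hh0.comp hpm
  have hC : Measurable fun ω : ℝ × ℝ × S2 => z.2 ^ α * w.2 ^ α *
    ((f (postConf m (z, w) ω).1 * (postConf m (z, w) ω).1.2 ^ (-α)) *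
      (f (postConf m (z, w) ω).2 * (postConf m (z, w) ω).2.2 ^ (-α))) := hh.const_mul _
  have e1 : ENNReal.ofReal (z.2 ^ α) * (ENNReal.ofReal (w.2 ^ α) *
      ∫⁻ ω, collRate α b B ((z, w), ω) * ENNReal.ofReal
        ((f (postConf m (z, w) ω).1 * (postConf m (z, w) ω).1.2 ^ (-α)) *
        (f (postConf m (z, w) ω).2 * (postConf m (z, w) ω).2.2 ^ (-α))) ∂angMeasure) =
      ∫⁻ ω, collRate α b B ((z, w), ω) * ENNReal.ofReal (z.2 ^ α * w.2 ^ α *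
        ((f (postConf m (z, w) ω).1 * (postConf m (z, w) ω).1.2 ^ (-α)) *
        (f (postConf m (z, w) ω).2 * (postConf m (z, w) ω).2.2 ^ (-α)))) ∂angMeasure := by
    rw [← mul_assoc, ← ENNReal.ofReal_mul (by positivity),
      ← lintegral_const_mul' _ _ ENNReal.ofReal_ne_top]
    refine lintegral_congr fun ω => ?_
    rw [ENNReal.ofReal_mul (p := z.2 ^ α * w.2 ^ α) (by positivity)]
    ring
  simp only
  rw [e1, lintegral_collRate hK hz hw hC,
    Measure.restrict_congr_set (Ioo_ae_eq_Icc (a := (0 : ℝ)) (b := 1)).symm]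
  refine setLIntegral_congr_fun measurableSet_Ioo fun r hr => ?_
  refine setLIntegral_congr_fun measurableSet_Ioo fun R hR => ?_
  refine lintegral_congr fun σ => ?_
  obtain ⟨hi, hi'⟩ := iPost_pos hm hz hw hr hR
  simp only [postConf]
  rw [Real.div_rpow (by positivity) (by positivity), Real.mul_rpow hz.le hw.le,
    Real.mul_rpow hi.le hi'.le, Real.rpow_neg hi.le, Real.rpow_neg hi'.le]
  congr 1
  field_simp

theorem loss_eq_gainAux (hK : IsHardKernel m α ζ b B blb bub) {f : Vel × ℝ → ℝ}
    (hf : Measurable f) {z : Vel × ℝ} (hz : 0 < z.2) :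
    loss α b B f f z = gainAux m α b B (fun y => ENNReal.ofReal (gasDensity α f y.1.1) *
      ENNReal.ofReal (gasDensity α f y.1.2)) z := by
  have hF := measurable_gasDensity α hf
  have hcr : ∀ w, Measurable fun ω => collRate α b B ((z, w), ω) := fun w =>
    hK.measurable_collRate.comp measurable_prodMk_left
  have hr := measurable_rate_mul_right (m := m) hK (G := fun y =>
    ENNReal.ofReal (gasDensity α f y.1.1) * ENNReal.ofReal (gasDensity α f y.1.2)) (by fun_prop) z
  unfold loss collFreq gainAux
  rw [lintegral_gasMeasure_eq _ _ hr,
    ← ofReal_rpow_mul_gasDensity α f hz, mul_assoc]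
  congr 1
  have hr1 : Measurable fun w : Vel × ℝ =>
      ∫⁻ ω, collRate α b B ((z, w), ω) * ENNReal.ofReal (f w) ∂angMeasure :=
    measurable_rate_mul_right (m := m) hK (G := fun y => ENNReal.ofReal (f y.1.2)) (by fun_prop) z
  have e0 : ∀ᵐ w ∂stateMeasure, (∫⁻ r in Icc (0 : ℝ) 1, (∫⁻ R in Icc (0 : ℝ) 1,
      (∫⁻ σ in halfSphere (z.1 - w.1), ENNReal.ofReal (f w * B z.1 w.1 z.2 w.2 r R *
        b ⟪dir (z.1 - w.1), (σ : Vel)⟫ * dAlpha α r R) ∂surf))) =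
      ∫⁻ ω, collRate α b B ((z, w), ω) * ENNReal.ofReal (f w) ∂angMeasure := by
    filter_upwards [ae_stateMeasure_pos] with w hw
    rw [lintegral_collRate hK hz hw measurable_const]
    simp only [mul_assoc]
  rw [lintegral_congr_ae e0, ← lintegral_const_mul' _ _ ENNReal.ofReal_ne_top]
  refine lintegral_congr_ae (ae_stateMeasure_pos.mono fun w hw => ?_)
  simp only
  rw [lintegral_mul_const _ (hcr w), lintegral_mul_const _ (hcr w),
    ← ofReal_rpow_mul_gasDensity α f hw]
  ring

/-- Weak form of the gain term. -/
theorem lintegral_gain (hK : IsHardKernel m α ζ b B blb bub) (hm : 0 < m) {f : Vel × ℝ → ℝ}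
    (hf : Measurable f) (hf0 : ∀ᵐ z ∂stateMeasure, 0 ≤ f z)
    {φ : Vel × ℝ → ℝ≥0∞} (hφ : Measurable φ) :
    ∫⁻ z, φ z * gain m α b B f f z ∂stateMeasure =
      ∫⁻ y, φ y.2.1 * (ENNReal.ofReal (gasDensity α f y.1.1) *
        ENNReal.ofReal (gasDensity α f y.1.2)) ∂collMeasure m α b B := by
  have hF := measurable_gasDensity α hf
  have e1 : ∫⁻ z, φ z * gain m α b B f f z ∂stateMeasure =
      ∫⁻ z, φ z * gainAux m α b B (fun y => ENNReal.ofReal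
      ((f y.2.1 * y.2.1.2 ^ (-α)) * (f y.2.2 * y.2.2.2 ^ (-α)))) z ∂stateMeasure :=
    lintegral_congr_ae (ae_stateMeasure_pos.mono fun z hz => by
      simp only; rw [gain_eq_gainAux hK hm hf hz])
  rw [e1, lintegral_gainAux hK (by fun_prop) hφ, ← hK.lintegral_collMeasure_swap hm (by fun_prop)]
  have hpos := ae_gasMeasure_of_ae α (hf0.and ae_stateMeasure_pos)
  refine lintegral_congr_ae ((hK.ae_collMeasure_all hm hpos).mono fun y hy => ?_)
  obtain ⟨⟨⟨h1, h2⟩, h3, h4⟩, -⟩ := hy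
  simp only [Prod.fst_swap, Prod.snd_swap, gasDensity, max_eq_left h1, max_eq_left h3]
  rw [ENNReal.ofReal_mul (by positivity)]

/-- Weak form of the loss term. -/
theorem lintegral_loss (hK : IsHardKernel m α ζ b B blb bub) {f : Vel × ℝ → ℝ}
    (hf : Measurable f) {φ : Vel × ℝ → ℝ≥0∞} (hφ : Measurable φ) :
    ∫⁻ z, φ z * loss α b B f f z ∂stateMeasure =
      ∫⁻ y, φ y.1.1 * (ENNReal.ofReal (gasDensity α f y.1.1) *
        ENNReal.ofReal (gasDensity α f y.1.2)) ∂collMeasure m α b B := by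
  have hF := measurable_gasDensity α hf
  have e1 : ∫⁻ z, φ z * loss α b B f f z ∂stateMeasure =
      ∫⁻ z, φ z * gainAux m α b B (fun y => ENNReal.ofReal (gasDensity α f y.1.1) *
        ENNReal.ofReal (gasDensity α f y.1.2)) z ∂stateMeasure :=
    lintegral_congr_ae (ae_stateMeasure_pos.mono fun z hz => by
      simp only; rw [loss_eq_gainAux hK hf hz])
  rw [e1, lintegral_gainAux hK (by fun_prop) hφ]

end

/-! ### Functionals on the energy space -/

section
variable {m : ℝ}

theorem measurable_bracket_sq (m : ℝ) :
    Measurable fun z : Vel × ℝ => ENNReal.ofReal (bracket m z ^ 2) := by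
  unfold bracket; fun_prop

theorem ae_stateMeasure_of_energyMeasure (hm : 0 < m) {q : Vel × ℝ → Prop}
    (h : ∀ᵐ z ∂energyMeasure m, q z) : ∀ᵐ z ∂stateMeasure, q z := by
  refine (withDensity_absolutelyContinuous' (measurable_bracket_sq m).aemeasurable ?_).ae_le h
  filter_upwards [ae_stateMeasure_pos] with z hz
  rw [bracket_sq hm hz]
  have := one_le_kin hm hz
  simp only [ne_eq, ENNReal.ofReal_eq_zero, not_le]
  linarith

theorem measurable_coe_L12 (f : L12 m) : Measurable f := (Lp.stronglyMeasurable f).measurable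

theorem integrable_energyMeasure_iff (hm : 0 < m) {f : Vel × ℝ → ℝ} :
    Integrable f (energyMeasure m) ↔ Integrable (fun z => kin m z * f z) stateMeasure := by
  unfold energyMeasure
  rw [integrable_withDensity_iff_integrable_smul' (measurable_bracket_sq m) (by simp)]
  refine integrable_congr ?_
  filter_upwards [ae_stateMeasure_pos] with z hz
  rw [bracket_sq hm hz, ENNReal.toReal_ofReal (zero_le_one.trans (one_le_kin hm hz)), smul_eq_mul]

theorem integral_energyMeasure (hm : 0 < m) (f : Vel × ℝ → ℝ) :
    ∫ z, f z ∂energyMeasure m = ∫ z, kin m z * f z ∂stateMeasure := by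
  unfold energyMeasure
  rw [integral_withDensity_eq_integral_toReal_smul (measurable_bracket_sq m) (by simp)]
  refine integral_congr_ae ?_
  filter_upwards [ae_stateMeasure_pos] with z hz
  rw [bracket_sq hm hz, ENNReal.toReal_ofReal (zero_le_one.trans (one_le_kin hm hz)), smul_eq_mul]

theorem lintegral_energyMeasure (hm : 0 < m) (f : Vel × ℝ → ℝ≥0∞) :
    ∫⁻ z, f z ∂energyMeasure m = ∫⁻ z, ENNReal.ofReal (kin m z) * f z ∂stateMeasure := by
  unfold energyMeasure
  rw [lintegral_withDensity_eq_lintegral_mul_non_measurable _ (measurable_bracket_sq m) (by simp)]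
  refine lintegral_congr_ae ?_
  filter_upwards [ae_stateMeasure_pos] with z hz
  simp [bracket_sq hm hz]

theorem integrable_kin_mul (hm : 0 < m) (f : L12 m) :
    Integrable (fun z => kin m z * f z) stateMeasure :=
  (integrable_energyMeasure_iff hm).1 (L1.integrable_coeFn f)

theorem integrable_kin_mul_abs (hm : 0 < m) (f : L12 m) :
    Integrable (fun z => kin m z * |f z|) stateMeasure := by
  refine (integrable_kin_mul hm f).norm.congr ?_
  filter_upwards [ae_stateMeasure_pos] with z hz
  rw [norm_mul, Real.norm_eq_abs, Real.norm_eq_abs,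
    abs_of_nonneg (zero_le_one.trans (one_le_kin hm hz))]

theorem norm_L12 (hm : 0 < m) (f : L12 m) : ‖f‖ = ∫ z, kin m z * |f z| ∂stateMeasure := by
  rw [L1.norm_eq_integral_norm, integral_energyMeasure hm]
  rfl

theorem integrable_weight_mul (hm : 0 < m) {ψ : Vel × ℝ → ℝ} (hψ : Measurable ψ) {C : ℝ}
    (hC : ∀ z : Vel × ℝ, 0 < z.2 → |ψ z| ≤ C * kin m z) (f : L12 m) :
    Integrable (fun z => ψ z * f z) stateMeasure := by
  refine ((integrable_kin_mul hm f).const_mul C).mono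
    (hψ.mul (measurable_coe_L12 f)).aestronglyMeasurable ?_
  filter_upwards [ae_stateMeasure_pos] with z hz
  rw [← mul_assoc, norm_mul, norm_mul]
  exact mul_le_mul_of_nonneg_right ((hC z hz).trans (le_abs_self _)) (norm_nonneg _)

/-- Integration against a weight that grows at most like the energy is a continuous functional
on `L¹₂`. -/
theorem exists_weight_functional (hm : 0 < m) {ψ : Vel × ℝ → ℝ} (hψ : Measurable ψ) {C : ℝ}
    (hC : ∀ z : Vel × ℝ, 0 < z.2 → |ψ z| ≤ C * kin m z) :
    ∃ l : L12 m →L[ℝ] ℝ, ∀ f, l f = ∫ z, ψ z * f z ∂stateMeasure := by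
  refine ⟨LinearMap.mkContinuous
    { toFun := fun f => ∫ z, ψ z * f z ∂stateMeasure, map_add' := ?_, map_smul' := ?_ } C ?_,
    fun f => rfl⟩
  · intro f g
    rw [← integral_add (integrable_weight_mul hm hψ hC f) (integrable_weight_mul hm hψ hC g)]
    refine integral_congr_ae ?_
    filter_upwards [ae_stateMeasure_of_energyMeasure hm (Lp.coeFn_add f g)] with z hz
    rw [hz, Pi.add_apply, mul_add]
  · intro c f
    simp only [RingHom.id_apply, smul_eq_mul]
    rw [← integral_const_mul]
    refine integral_congr_ae ?_
    filter_upwards [ae_stateMeasure_of_energyMeasure hm (Lp.coeFn_smul c f)] with z hz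
    rw [hz, Pi.smul_apply, smul_eq_mul]
    ring
  · intro f
    simp only [LinearMap.coe_mk, AddHom.coe_mk]
    rw [norm_L12 hm, ← integral_const_mul]
    refine norm_integral_le_of_norm_le ?_ ?_
    · exact (integrable_kin_mul_abs hm f).const_mul C
    · filter_upwards [ae_stateMeasure_pos] with z hz
      rw [norm_mul, Real.norm_eq_abs, Real.norm_eq_abs, ← mul_assoc]
      exact mul_le_mul_of_nonneg_right (hC z hz) (abs_nonneg _)

end

/-- If `∫ φ Γ dμ = ∫ (φ ∘ T) ρ dP` for nonnegative `φ`, then also for real valued functions. -/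
theorem integral_of_weak_form {X Y : Type*} [MeasurableSpace X] [MeasurableSpace Y]
    {μ : Measure X} {P : Measure Y} {Γ : X → ℝ≥0∞} {ρ : Y → ℝ≥0∞} {T : Y → X}
    (hT : Measurable T) (hΓ : AEMeasurable Γ μ) (hρ : Measurable ρ) (hΓf : ∀ᵐ x ∂μ, Γ x < ∞)
    (hρf : ∀ᵐ y ∂P, ρ y < ∞)
    (h : ∀ φ : X → ℝ≥0∞, Measurable φ → ∫⁻ x, φ x * Γ x ∂μ = ∫⁻ y, φ (T y) * ρ y ∂P)
    {ψ : X → ℝ} (hψ : Measurable ψ) :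
    (Integrable (fun x => (Γ x).toReal * ψ x) μ ↔
      Integrable (fun y => (ρ y).toReal * ψ (T y)) P) ∧
    ∫ x, (Γ x).toReal * ψ x ∂μ = ∫ y, (ρ y).toReal * ψ (T y) ∂P := by
  have e : μ.withDensity Γ = (P.withDensity ρ).map T := by
    refine Measure.ext fun s hs => ?_
    have h1 := h (s.indicator 1) (measurable_one.indicator hs)
    rw [withDensity_apply _ hs, Measure.map_apply hT hs, withDensity_apply _ (hT hs),
      ← lintegral_indicator hs, ← lintegral_indicator (hT hs)]
    convert h1 using 2
    · ext x; by_cases hx : x ∈ s <;> simp [hx]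
    · ext y; by_cases hy : T y ∈ s <;> simp [indicator, hy]
  constructor
  · have e1 := integrable_withDensity_iff_integrable_smul₀' hΓ hΓf (g := ψ)
    have e2 := integrable_withDensity_iff_integrable_smul₀' hρ.aemeasurable hρf (g := ψ ∘ T)
    have e3 : Integrable ψ ((P.withDensity ρ).map T) ↔ Integrable (ψ ∘ T) (P.withDensity ρ) :=
      integrable_map_measure hψ.aestronglyMeasurable hT.aemeasurable
    rw [e, e3, e2] at e1
    exact e1.symm
  · have e1 := integral_withDensity_eq_integral_toReal_smul₀ hΓ hΓf ψ
    have e2 := integral_withDensity_eq_integral_toReal_smul₀ hρ.aemeasurable hρf (ψ ∘ T)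
    rw [e, integral_map hT.aemeasurable hψ.aestronglyMeasurable] at e1
    exact e1.symm.trans e2

section
variable {m α ζ : ℝ} {b : ℝ → ℝ} {B : Vel → Vel → ℝ → ℝ → ℝ → ℝ → ℝ} {blb bub : ℝ → ℝ → ℝ}

theorem lintegral_lt_top_of_weak {m : ℝ} (hm : 0 < m) {Γ : Vel × ℝ → ℝ≥0∞}
    (hΓ : AEMeasurable Γ stateMeasure)
    (hfin : ∫⁻ z, Γ z ∂energyMeasure m < ∞) :
    (∀ᵐ z ∂stateMeasure, Γ z < ∞) ∧ ∀ {ψ : Vel × ℝ → ℝ}, Measurable ψ → ∀ {C : ℝ},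
      (∀ z : Vel × ℝ, 0 < z.2 → |ψ z| ≤ C * kin m z) →
      Integrable (fun z => (Γ z).toReal * ψ z) stateMeasure := by
  rw [lintegral_energyMeasure hm] at hfin
  have hkm := measurable_kin m
  have h1 : ∀ᵐ z ∂stateMeasure, Γ z < ∞ := by
    filter_upwards [ae_lt_top' (by fun_prop) hfin.ne, ae_stateMeasure_pos] with z hz hz0
    by_contra hc
    rw [not_lt, top_le_iff] at hc
    have := one_le_kin hm hz0
    rw [hc, ENNReal.mul_top (by simp only [ne_eq, ENNReal.ofReal_eq_zero, not_le]; linarith)] at hz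
    exact lt_irrefl _ hz
  refine ⟨h1, fun {ψ} hψ {C} hC => ?_⟩
  have h2 : Integrable (fun z => kin m z * (Γ z).toReal) stateMeasure := by
    have := integrable_toReal_of_lintegral_ne_top (by fun_prop) hfin.ne
    refine this.congr ?_
    filter_upwards [ae_stateMeasure_pos] with z hz
    rw [ENNReal.toReal_mul, ENNReal.toReal_ofReal (zero_le_one.trans (one_le_kin hm hz))]
  refine (h2.const_mul C).mono (hΓ.ennreal_toReal.mul hψ.aemeasurable).aestronglyMeasurable ?_
  filter_upwards [ae_stateMeasure_pos] with z hz
  rw [← mul_assoc, mul_comm, norm_mul, norm_mul]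
  exact mul_le_mul_of_nonneg_right ((hC z hz).trans (le_abs_self _)) (norm_nonneg _)

theorem aemeasurable_gain (hK : IsHardKernel m α ζ b B blb bub) (hm : 0 < m) {f : Vel × ℝ → ℝ}
    (hf : Measurable f) : AEMeasurable (gain m α b B f f) stateMeasure :=
  ⟨_, measurable_gainAux hK (by fun_prop),
    ae_stateMeasure_pos.mono fun _ hz => gain_eq_gainAux hK hm hf hz⟩

theorem aemeasurable_loss (hK : IsHardKernel m α ζ b B blb bub) {f : Vel × ℝ → ℝ}
    (hf : Measurable f) : AEMeasurable (loss α b B f f) stateMeasure :=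
  have := measurable_gasDensity α hf
  ⟨_, measurable_gainAux (m := m) hK (by fun_prop),
    ae_stateMeasure_pos.mono fun _ hz => loss_eq_gainAux hK hf hz⟩

end

/-! ### Weak form of the collision operator -/

section
variable {m α ζ : ℝ} {b : ℝ → ℝ} {B : Vel → Vel → ℝ → ℝ → ℝ → ℝ → ℝ} {blb bub : ℝ → ℝ → ℝ}

/-- A collision: the states of the two molecules before and after it. -/
abbrev Coll : Type := ((Vel × ℝ) × (Vel × ℝ)) × ((Vel × ℝ) × (Vel × ℝ))

/-- The product `F F_*` of the densities of the incoming molecules. -/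
noncomputable def preDensity (α : ℝ) (f : Vel × ℝ → ℝ) (y : Coll) : ℝ :=
  gasDensity α f y.1.1 * gasDensity α f y.1.2

theorem measurable_preDensity (α : ℝ) {f : Vel × ℝ → ℝ} (hf : Measurable f) :
    Measurable (preDensity α f) := by
  have := measurable_gasDensity α hf
  unfold preDensity; fun_prop

theorem preDensity_nonneg_ae (hK : IsHardKernel m α ζ b B blb bub) (hm : 0 < m)
    (f : Vel × ℝ → ℝ) : ∀ᵐ y ∂collMeasure m α b B, 0 ≤ preDensity α f y := by
  have := hK.ae_collMeasure_all hm (ae_gasMeasure_pos α)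
  exact this.mono fun y hy =>
    mul_nonneg (gasDensity_nonneg α f hy.1.1) (gasDensity_nonneg α f hy.1.2)

theorem ofReal_preDensity (hK : IsHardKernel m α ζ b B blb bub) (hm : 0 < m)
    (f : Vel × ℝ → ℝ) : ∀ᵐ y ∂collMeasure m α b B, ENNReal.ofReal (gasDensity α f y.1.1) *
        ENNReal.ofReal (gasDensity α f y.1.2) = ENNReal.ofReal (preDensity α f y) := by
  have := hK.ae_collMeasure_all hm (ae_gasMeasure_pos α)
  exact this.mono fun y hy => (ENNReal.ofReal_mul (gasDensity_nonneg α f hy.1.1)).symm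

/-- Weak form of the collision operator. -/
theorem weak_form (hK : IsHardKernel m α ζ b B blb bub) (hm : 0 < m) {f : Vel × ℝ → ℝ}
    (hf : Measurable f) (hf0 : ∀ᵐ z ∂stateMeasure, 0 ≤ f z)
    (hg : ∫⁻ z, gain m α b B f f z ∂energyMeasure m < ∞)
    (hl : ∫⁻ z, loss α b B f f z ∂energyMeasure m < ∞)
    {ψ : Vel × ℝ → ℝ} (hψ : Measurable ψ) {C : ℝ}
    (hC : ∀ z : Vel × ℝ, 0 < z.2 → |ψ z| ≤ C * kin m z) :
    Integrable (fun y : Coll => preDensity α f y * ψ y.1.1) (collMeasure m α b B) ∧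
    Integrable (fun y : Coll => preDensity α f y * ψ y.2.1) (collMeasure m α b B) ∧
    ∫ z, ψ z * collOp m α b B f f z ∂stateMeasure =
      ∫ y : Coll, preDensity α f y * ψ y.2.1 ∂collMeasure m α b B -
      ∫ y : Coll, preDensity α f y * ψ y.1.1 ∂collMeasure m α b B := by
  have hF := measurable_preDensity α hf
  have hgm := aemeasurable_gain hK hm hf
  have hlm := aemeasurable_loss (m := m) hK hf
  obtain ⟨hgf, hgi⟩ := lintegral_lt_top_of_weak hm hgm hg
  obtain ⟨hlf, hli⟩ := lintegral_lt_top_of_weak hm hlm hl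
  have hae := ofReal_preDensity hK hm f
  have hT1 : Measurable fun y : Coll => y.1.1 := measurable_fst.fst
  have hT2 : Measurable fun y : Coll => y.2.1 := measurable_snd.fst
  have hρ : Measurable fun y : Coll => ENNReal.ofReal (preDensity α f y) := hF.ennreal_ofReal
  have hρf : ∀ᵐ y ∂collMeasure m α b B, ENNReal.ofReal (preDensity α f y) < ∞ :=
    Filter.Eventually.of_forall fun y => ENNReal.ofReal_lt_top
  have wg : ∀ φ : Vel × ℝ → ℝ≥0∞, Measurable φ → ∫⁻ x, φ x * gain m α b B f f x ∂stateMeasure =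
      ∫⁻ y : Coll, φ y.2.1 * ENNReal.ofReal (preDensity α f y) ∂collMeasure m α b B := by
    intro φ hφ
    rw [lintegral_gain hK hm hf hf0 hφ]
    exact lintegral_congr_ae (hae.mono fun y hy => congrArg (φ y.2.1 * ·) hy)
  have wl : ∀ φ : Vel × ℝ → ℝ≥0∞, Measurable φ → ∫⁻ x, φ x * loss α b B f f x ∂stateMeasure =
      ∫⁻ y : Coll, φ y.1.1 * ENNReal.ofReal (preDensity α f y) ∂collMeasure m α b B := by
    intro φ hφ
    rw [lintegral_loss (m := m) hK hf hφ]
    exact lintegral_congr_ae (hae.mono fun y hy => congrArg (φ y.1.1 * ·) hy)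
  obtain ⟨g1, g2⟩ := integral_of_weak_form hT2 hgm hρ hgf hρf wg hψ
  obtain ⟨l1, l2⟩ := integral_of_weak_form hT1 hlm hρ hlf hρf wl hψ
  have hnn := preDensity_nonneg_ae hK hm f
  have ag : (fun y : Coll => (ENNReal.ofReal (preDensity α f y)).toReal * ψ y.2.1)
      =ᵐ[collMeasure m α b B] fun y => preDensity α f y * ψ y.2.1 :=
    hnn.mono fun y hy => congrArg (· * ψ y.2.1) (ENNReal.toReal_ofReal hy)
  have al : (fun y : Coll => (ENNReal.ofReal (preDensity α f y)).toReal * ψ y.1.1)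
      =ᵐ[collMeasure m α b B] fun y => preDensity α f y * ψ y.1.1 :=
    hnn.mono fun y hy => congrArg (· * ψ y.1.1) (ENNReal.toReal_ofReal hy)
  refine ⟨(l1.1 (hli hψ hC)).congr al, (g1.1 (hgi hψ hC)).congr ag, ?_⟩
  rw [← integral_congr_ae ag, ← integral_congr_ae al, ← g2, ← l2,
    ← integral_sub (hgi hψ hC) (hli hψ hC)]
  refine integral_congr_ae (Filter.Eventually.of_forall fun z => ?_)
  simp only [collOp]; ring

theorem preDensity_exchange (α : ℝ) (f : Vel × ℝ → ℝ) (y : Coll) :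
    preDensity α f (Prod.map Prod.swap Prod.swap y) = preDensity α f y := mul_comm _ _

/-- The integrals of the weak form do not see the numbering of the molecules. -/
theorem integral_exchange (hK : IsHardKernel m α ζ b B blb bub) {h : Coll → ℝ}
    (hh : Integrable h (collMeasure m α b B)) :
    Integrable (fun y : Coll => h (Prod.map Prod.swap Prod.swap y)) (collMeasure m α b B) ∧
    ∫ y : Coll, h (Prod.map Prod.swap Prod.swap y) ∂collMeasure m α b B =
      ∫ y : Coll, h y ∂collMeasure m α b B := by
  have hmp := hK.map_exchange_collMeasure (m := m)
  have j1 := hmp.integrable_comp_of_integrable hh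
  have k1 := integral_map hmp.measurable.aemeasurable (hmp.map_eq.symm ▸ hh.aestronglyMeasurable)
  rw [hmp.map_eq] at k1
  exact ⟨j1, k1.symm⟩

/-- Symmetrised weak form of the collision operator. -/
theorem weak_form_symm (hK : IsHardKernel m α ζ b B blb bub) (hm : 0 < m) {f : Vel × ℝ → ℝ}
    (hf : Measurable f) (hf0 : ∀ᵐ z ∂stateMeasure, 0 ≤ f z)
    (hg : ∫⁻ z, gain m α b B f f z ∂energyMeasure m < ∞)
    (hl : ∫⁻ z, loss α b B f f z ∂energyMeasure m < ∞)
    {ψ : Vel × ℝ → ℝ} (hψ : Measurable ψ) {C : ℝ}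
    (hC : ∀ z : Vel × ℝ, 0 < z.2 → |ψ z| ≤ C * kin m z) :
    Integrable (fun y : Coll => preDensity α f y *
      (ψ y.2.1 + ψ y.2.2 - (ψ y.1.1 + ψ y.1.2))) (collMeasure m α b B) ∧
    2 * ∫ z, ψ z * collOp m α b B f f z ∂stateMeasure =
      ∫ y : Coll, preDensity α f y *
        (ψ y.2.1 + ψ y.2.2 - (ψ y.1.1 + ψ y.1.2)) ∂collMeasure m α b B := by
  obtain ⟨i1, i2, e⟩ := weak_form hK hm hf hf0 hg hl hψ hC
  obtain ⟨j1, k1⟩ := integral_exchange hK i1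
  obtain ⟨j2, k2⟩ := integral_exchange hK i2
  simp only [preDensity_exchange, Prod.map_fst, Prod.map_snd, Prod.fst_swap] at j1 k1 j2 k2
  have he : ∀ y : Coll, preDensity α f y * (ψ y.2.1 + ψ y.2.2 - (ψ y.1.1 + ψ y.1.2)) =
      (preDensity α f y * ψ y.2.1 + preDensity α f y * ψ y.2.2) -
      (preDensity α f y * ψ y.1.1 + preDensity α f y * ψ y.1.2) := fun y => by ring
  simp only [he]
  have s1 : Integrable (fun y : Coll => preDensity α f y * ψ y.1.1 + preDensity α f y * ψ y.1.2)
    (collMeasure m α b B) := i1.add j1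
  have s2 : Integrable (fun y : Coll => preDensity α f y * ψ y.2.1 + preDensity α f y * ψ y.2.2)
    (collMeasure m α b B) := i2.add j2
  refine ⟨s2.sub s1, ?_⟩
  rw [integral_sub s2 s1, integral_add i2 j2, integral_add i1 j1, e, k1, k2]
  ring

end

/-! ### Conservation laws -/

section
variable {m α ζ : ℝ} {b : ℝ → ℝ} {B : Vel → Vel → ℝ → ℝ → ℝ → ℝ → ℝ} {blb bub : ℝ → ℝ → ℝ}

/-- The properties of a solution at a fixed positive time on which the production estimates
rest. -/
structure IsState (m α : ℝ) (b : ℝ → ℝ) (B : Vel → Vel → ℝ → ℝ → ℝ → ℝ → ℝ)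
    (f : Vel × ℝ → ℝ) : Prop where
  measurable : Measurable f
  nonneg : ∀ᵐ z ∂stateMeasure, 0 ≤ f z
  gain_finite : ∫⁻ z, gain m α b B f f z ∂energyMeasure m < ∞
  loss_finite : ∫⁻ z, loss α b B f f z ∂energyMeasure m < ∞

theorem IsSolution.isState {f : ℝ → L12 m} (hf : IsSolution m α b B f) {t : ℝ} (ht : 0 < t) :
    IsState m α b B (f t) :=
  ⟨measurable_coe_L12 _, hf.nonneg t ht.le, hf.gain_finite t ht, hf.loss_finite t ht⟩

theorem IsSolution.hasDerivAt {f : ℝ → L12 m} (hf : IsSolution m α b B f) {t : ℝ} (ht : 0 < t) :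
    HasDerivAt f (deriv f t) t :=
  ((hf.contDiffOn.differentiableOn one_ne_zero).differentiableAt (Ioi_mem_nhds ht)).hasDerivAt

/-- The weak form of the equation: the derivative of a moment of a solution is its production
by the collision operator. -/
theorem IsSolution.hasDerivAt_moment {f : ℝ → L12 m} (hf : IsSolution m α b B f)
    {ψ : Vel × ℝ → ℝ} {l : L12 m →L[ℝ] ℝ} (hl : ∀ g, l g = ∫ z, ψ z * g z ∂stateMeasure)
    {t : ℝ} (ht : 0 < t) :
    HasDerivAt (fun t => l (f t)) (∫ z, ψ z * collOp m α b B (f t) (f t) z ∂stateMeasure) t := by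
  have h1 := l.hasFDerivAt.comp_hasDerivAt t (hf.hasDerivAt ht)
  have h2 : l (deriv f t) = ∫ z, ψ z * collOp m α b B (f t) (f t) z ∂stateMeasure := by
    rw [hl]
    exact integral_congr_ae ((hf.equation t ht).mono fun z hz => congrArg (ψ z * ·) hz)
  rw [← h2]
  exact h1

theorem IsSolution.continuousOn_moment {f : ℝ → L12 m} (hf : IsSolution m α b B f)
    (l : L12 m →L[ℝ] ℝ) : ContinuousOn (fun t => l (f t)) (Ici 0) :=
  l.continuous.comp_continuousOn hf.continuousOn

/-- A moment whose production vanishes is conserved. -/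
theorem IsSolution.moment_eq {f : ℝ → L12 m} (hf : IsSolution m α b B f)
    {ψ : Vel × ℝ → ℝ} {l : L12 m →L[ℝ] ℝ} (hl : ∀ g, l g = ∫ z, ψ z * g z ∂stateMeasure)
    (h : ∀ t, 0 < t → ∫ z, ψ z * collOp m α b B (f t) (f t) z ∂stateMeasure = 0)
    {t : ℝ} (ht : 0 ≤ t) : l (f t) = l (f 0) := by
  rcases ht.eq_or_lt with rfl | ht
  · rfl
  obtain ⟨c, hc, h1⟩ := exists_hasDerivAt_eq_slope (fun t => l (f t)) _ ht
    ((hf.continuousOn_moment l).mono Icc_subset_Ici_self)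
    fun s hs => hf.hasDerivAt_moment hl hs.1
  rw [h c hc.1, eq_comm, div_eq_zero_iff] at h1
  rcases h1 with h1 | h1 <;> linarith

/-- Conservation of energy in almost every collision. -/
theorem ae_pairKin (hm : 0 < m) :
    ∀ᵐ y : Coll ∂collMeasure m α b B, pairKin m y.2 = pairKin m y.1 :=
  ae_collMeasure (measurableSet_eq_fun (by fun_prop) (by fun_prop))
    fun _ h1 h2 _ _ _ hR => pairKin_postConf hm h1 h2 hR.1.le

theorem integral_kin_collOp (hK : IsHardKernel m α ζ b B blb bub) (hm : 0 < m)
    {f : Vel × ℝ → ℝ} (hf : IsState m α b B f) :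
    ∫ z, kin m z * collOp m α b B f f z ∂stateMeasure = 0 := by
  have h := (weak_form_symm hK hm hf.measurable hf.nonneg hf.gain_finite hf.loss_finite
    (measurable_kin m) (C := 1) fun z hz => by
      rw [one_mul, abs_of_nonneg (zero_le_one.trans (one_le_kin hm hz))]).2
  have h2 : ∫ y : Coll, preDensity α f y * (kin m y.2.1 + kin m y.2.2 -
      (kin m y.1.1 + kin m y.1.2)) ∂collMeasure m α b B = 0 := by
    rw [← integral_zero Coll ℝ (μ := collMeasure m α b B)]
    refine integral_congr_ae ((ae_pairKin hm).mono fun y hy => ?_)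
    unfold pairKin at hy
    simp only
    rw [hy, sub_self, mul_zero]
  linarith

theorem integral_one_collOp (hK : IsHardKernel m α ζ b B blb bub) (hm : 0 < m)
    {f : Vel × ℝ → ℝ} (hf : IsState m α b B f) :
    ∫ z, 1 * collOp m α b B f f z ∂stateMeasure = 0 := by
  have h := (weak_form_symm hK hm hf.measurable hf.nonneg hf.gain_finite hf.loss_finite
    (ψ := fun _ => 1) measurable_const (C := 1) fun z hz => by
      simpa using one_le_kin hm hz).2
  simpa using h

/-- Conservation of mass and energy. -/
theorem IsSolution.exists_conserved (hK : IsHardKernel m α ζ b B blb bub) (hm : 0 < m)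
    {f : ℝ → L12 m} (hf : IsSolution m α b B f) {t : ℝ} (ht : 0 ≤ t) :
    ∫ z, f t z ∂stateMeasure = ∫ z, f 0 z ∂stateMeasure ∧ ‖f t‖ = ‖f 0‖ := by
  constructor
  · obtain ⟨l, hl⟩ := exists_weight_functional hm (ψ := fun _ => 1) measurable_const (C := 1)
      fun z hz => by simpa using one_le_kin hm hz
    have := hf.moment_eq hl (fun t ht => integral_one_collOp hK hm (hf.isState ht)) ht
    simpa [hl] using this
  · obtain ⟨l, hl⟩ := exists_weight_functional hm (measurable_kin m) (C := 1)
      fun z hz => by rw [one_mul, abs_of_nonneg (zero_le_one.trans (one_le_kin hm hz))]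
    have h1 := hf.moment_eq hl (fun t ht => integral_kin_collOp hK hm (hf.isState ht)) ht
    have h2 : ∀ s, 0 ≤ s → ‖f s‖ = l (f s) := fun s hs => by
      rw [norm_L12 hm, hl]
      exact integral_congr_ae ((hf.nonneg s hs).mono fun z hz => by
        simp only; rw [abs_of_nonneg hz])
    rw [h2 t ht, h2 0 le_rfl, h1]

end

/-! ### Production of the square root of the energy -/

section
variable {m α ζ : ℝ} {b : ℝ → ℝ} {B : Vel → Vel → ℝ → ℝ → ℝ → ℝ → ℝ} {blb bub : ℝ → ℝ → ℝ}

theorem relE_rpow_le (hm : 0 < m) (hζ : 0 < ζ) (hζ2 : ζ ≤ 2) {p : (Vel × ℝ) × (Vel × ℝ)}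
    (h1 : 0 < p.1.2) (h2 : 0 < p.2.2) : relE m p ^ (ζ / 2) ≤ pairKin m p ^ (ζ / 2) ∧
      pairKin m p ^ (ζ / 2) ≤ pairKin m p := by
  have hX : 1 ≤ pairKin m p := by
    have := one_le_kin hm h1; have := one_le_kin hm h2; unfold pairKin; linarith
  refine ⟨Real.rpow_le_rpow (relE_pos hm h1 h2).le (relE_le_pairKin hm p) (by positivity), ?_⟩
  calc _ ≤ pairKin m p ^ (1 : ℝ) := Real.rpow_le_rpow_of_exponent_le hX (by linarith)
    _ = _ := Real.rpow_one _

theorem sqrt_add_sqrt_le {x y : ℝ} (hx : 0 ≤ x) (hy : 0 ≤ y) :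
    √x + √y ≤ √(x + y) + min √x √y := by
  have h1 : √x ≤ √(x + y) := Real.sqrt_le_sqrt (by linarith)
  have h2 : √y ≤ √(x + y) := Real.sqrt_le_sqrt (by linarith)
  rcases le_total √x √y with h | h
  · rw [min_eq_left h]; linarith
  · rw [min_eq_right h]; linarith

/-- The defect in the subadditivity of the square root is harmless: multiplied by the total
energy it is bounded by the product of the energies. -/
theorem min_sqrt_mul_le {x y : ℝ} (hx : 1 ≤ x) (hy : 1 ≤ y) :
    min √x √y * (x + y) ≤ 2 * (x * y) := by
  wlog h : x ≤ y generalizing x y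
  · have := this hy hx (le_of_not_ge h)
    rw [min_comm, add_comm x y, mul_comm x y]; exact this
  have h1 : √x ≤ x := by
    rw [Real.sqrt_le_left (by linarith)]; nlinarith
  calc min √x √y * (x + y) ≤ x * (2 * y) :=
        mul_le_mul ((min_le_left _ _).trans h1) (by linarith) (by linarith) (by linarith)
    _ = _ := by ring

/-- The moment of order `ζ + 1` of one molecule is controlled by the relative energy, up to
the product of the energies of the pair. -/
theorem kin_rpow_le (hm : 0 < m) (hζ : 0 < ζ) (hζ2 : ζ ≤ 2) {p : (Vel × ℝ) × (Vel × ℝ)}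
    (h1 : 0 < p.1.2) (h2 : 0 < p.2.2) :
    kin m p.1 ^ (ζ / 2 + 1 / 2) ≤
      4 * (√(pairKin m p) * relE m p ^ (ζ / 2)) + 2 * (kin m p.1 * kin m p.2) := by
  have hx := one_le_kin hm h1
  have hy := one_le_kin hm h2
  have he := relE_pos hm h1 h2
  have hq : 0 < ζ / 2 := by positivity
  have hq1 : ζ / 2 ≤ 1 := by linarith
  have a1 : kin m p.1 ^ (ζ / 2) ≤ 4 * relE m p ^ (ζ / 2) + 2 * kin m p.2 := by
    calc kin m p.1 ^ (ζ / 2) ≤ (4 * relE m p + 2 * kin m p.2) ^ (ζ / 2) :=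
          Real.rpow_le_rpow (by linarith) (kin_le_relE hm h1 h2) hq.le
      _ ≤ (4 * relE m p) ^ (ζ / 2) + (2 * kin m p.2) ^ (ζ / 2) :=
          Real.rpow_add_le_add_rpow (by positivity) (by positivity) hq.le hq1
      _ ≤ 4 ^ (1 : ℝ) * relE m p ^ (ζ / 2) + (2 * kin m p.2) ^ (1 : ℝ) := by
          rw [Real.mul_rpow (by norm_num) he.le]
          gcongr
          · norm_num
          · linarith
      _ = _ := by rw [Real.rpow_one, Real.rpow_one]
  have a2 : √(kin m p.1) ≤ √(pairKin m p) := Real.sqrt_le_sqrt (by unfold pairKin; linarith)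
  have a3 : √(kin m p.1) ≤ kin m p.1 := by
    rw [Real.sqrt_le_left (by linarith)]; nlinarith
  have a4 : 0 ≤ relE m p ^ (ζ / 2) := by positivity
  rw [Real.rpow_add (by linarith), ← Real.sqrt_eq_rpow]
  calc kin m p.1 ^ (ζ / 2) * √(kin m p.1)
      ≤ (4 * relE m p ^ (ζ / 2) + 2 * kin m p.2) * √(kin m p.1) := by gcongr
    _ = 4 * (√(kin m p.1) * relE m p ^ (ζ / 2)) + 2 * (√(kin m p.1) * kin m p.2) := by ring
    _ ≤ _ := by gcongr

/-- Production of a nonnegative moment, as a difference of two finite quantities. -/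
theorem two_mul_production (hK : IsHardKernel m α ζ b B blb bub) (hm : 0 < m)
    {f : Vel × ℝ → ℝ} (hf : IsState m α b B f) {ψ : Vel × ℝ → ℝ} (hψ : Measurable ψ) {C : ℝ}
    (hψ0 : ∀ z, 0 ≤ ψ z) (hC : ∀ z : Vel × ℝ, 0 < z.2 → |ψ z| ≤ C * kin m z) :
    ∫⁻ y : Coll, ENNReal.ofReal (preDensity α f y * (ψ y.1.1 + ψ y.1.2))
      ∂collMeasure m α b B ≠ ∞ ∧
    ∫⁻ y : Coll, ENNReal.ofReal (preDensity α f y * (ψ y.2.1 + ψ y.2.2))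
      ∂collMeasure m α b B ≠ ∞ ∧
    2 * ∫ z, ψ z * collOp m α b B f f z ∂stateMeasure =
      (∫⁻ y : Coll, ENNReal.ofReal (preDensity α f y * (ψ y.2.1 + ψ y.2.2))
        ∂collMeasure m α b B).toReal -
      (∫⁻ y : Coll, ENNReal.ofReal (preDensity α f y * (ψ y.1.1 + ψ y.1.2))
        ∂collMeasure m α b B).toReal := by
  obtain ⟨i1, i2, -⟩ := weak_form hK hm hf.measurable hf.nonneg hf.gain_finite hf.loss_finite hψ hC
  obtain ⟨-, e⟩ := weak_form_symm hK hm hf.measurable hf.nonneg hf.gain_finite hf.loss_finite hψ hC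
  obtain ⟨j1, -⟩ := integral_exchange hK i1
  obtain ⟨j2, -⟩ := integral_exchange hK i2
  simp only [preDensity_exchange, Prod.map_fst, Prod.map_snd, Prod.fst_swap] at j1 j2
  have s1 : Integrable (fun y : Coll => preDensity α f y * (ψ y.1.1 + ψ y.1.2))
    (collMeasure m α b B) := (i1.add j1).congr
      (Filter.Eventually.of_forall fun y => (mul_add _ _ _).symm)
  have s2 : Integrable (fun y : Coll => preDensity α f y * (ψ y.2.1 + ψ y.2.2))
    (collMeasure m α b B) := (i2.add j2).congr
      (Filter.Eventually.of_forall fun y => (mul_add _ _ _).symm)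
  have hnn := preDensity_nonneg_ae hK hm f
  refine ⟨s1.lintegral_lt_top.ne, s2.lintegral_lt_top.ne, ?_⟩
  rw [e, ← integral_eq_lintegral_of_nonneg_ae
      (hnn.mono fun y hy => mul_nonneg hy (add_nonneg (hψ0 _) (hψ0 _))) s1.aestronglyMeasurable,
    ← integral_eq_lintegral_of_nonneg_ae
      (hnn.mono fun y hy => mul_nonneg hy (add_nonneg (hψ0 _) (hψ0 _))) s2.aestronglyMeasurable,
    ← integral_sub s2 s1]
  refine integral_congr_ae (Filter.Eventually.of_forall fun y => ?_)
  simp only; ring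

/-- The moment of order `ζ + 1` of a state, in terms of the Lebesgue bracket. -/
noncomputable def highMoment (m α ζ : ℝ) (f : Vel × ℝ → ℝ) : ℝ≥0∞ :=
  ∫⁻ z, ENNReal.ofReal (gasDensity α f z) * ENNReal.ofReal (kin m z ^ (ζ / 2 + 1 / 2))
    ∂gasMeasure α

/-- The energy of a state. -/
noncomputable def energy (m α : ℝ) (f : Vel × ℝ → ℝ) : ℝ≥0∞ :=
  ∫⁻ z, ENNReal.ofReal (gasDensity α f z) * ENNReal.ofReal (kin m z) ∂gasMeasure α

/-- The mass of a state. -/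
noncomputable def mass (α : ℝ) (f : Vel × ℝ → ℝ) : ℝ≥0∞ :=
  ∫⁻ z, ENNReal.ofReal (gasDensity α f z) ∂gasMeasure α

theorem lintegral_pair_mul {α : ℝ} {g h : Vel × ℝ → ℝ≥0∞} (hg : Measurable g)
    (hh : Measurable h) : ∫⁻ p : (Vel × ℝ) × (Vel × ℝ), g p.1 * h p.2
      ∂((gasMeasure α).prod (gasMeasure α)) = (∫⁻ z, g z ∂gasMeasure α) * ∫⁻ z, h z ∂gasMeasure α :=
  lintegral_prod_mul hg.aemeasurable hh.aemeasurable

theorem lintegral_pair_energy (m α : ℝ) {f : Vel × ℝ → ℝ} (hf : Measurable f) :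
    ∫⁻ p : (Vel × ℝ) × (Vel × ℝ),
      (ENNReal.ofReal (gasDensity α f p.1) * ENNReal.ofReal (kin m p.1)) *
      (ENNReal.ofReal (gasDensity α f p.2) * ENNReal.ofReal (kin m p.2))
        ∂((gasMeasure α).prod (gasMeasure α)) = energy m α f ^ 2 := by
  have hF := measurable_gasDensity α hf
  rw [sq]
  exact lintegral_pair_mul (g := fun z => ENNReal.ofReal (gasDensity α f z) *
    ENNReal.ofReal (kin m z)) (h := fun z => ENNReal.ofReal (gasDensity α f z) *
    ENNReal.ofReal (kin m z)) (by fun_prop) (by fun_prop)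

/-- The square roots of the energies before the collision add up to the square root of the
total energy, up to an error controlled by the energy of the state. -/
theorem lintegral_preDensity_le (hK : IsHardKernel m α ζ b B blb bub) (hm : 0 < m)
    {f : Vel × ℝ → ℝ} (hf : Measurable f) {C : ℝ≥0∞}
    (hC : ∀ G : (Vel × ℝ) × (Vel × ℝ) → ℝ≥0∞, Measurable G →
      ∫⁻ y, G y.1 ∂collMeasure m α b B ≤
        C * ∫⁻ p, G p * ENNReal.ofReal (relE m p ^ (ζ / 2))
          ∂((gasMeasure α).prod (gasMeasure α))) :
    ∫⁻ y : Coll, ENNReal.ofReal (preDensity α f y * (√(kin m y.1.1) + √(kin m y.1.2)))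
      ∂collMeasure m α b B ≤
    ∫⁻ y : Coll, ENNReal.ofReal (gasDensity α f y.1.1) * ENNReal.ofReal (gasDensity α f y.1.2) *
      ENNReal.ofReal √(pairKin m y.1) ∂collMeasure m α b B + C * (2 * energy m α f ^ 2) := by
  have hF := measurable_gasDensity α hf
  have hpos := hK.ae_collMeasure_all hm (ae_gasMeasure_pos α)
  have h1 : ∫⁻ y : Coll, ENNReal.ofReal (preDensity α f y * (√(kin m y.1.1) + √(kin m y.1.2)))
      ∂collMeasure m α b B ≤ ∫⁻ y : Coll,
      (ENNReal.ofReal (gasDensity α f y.1.1) * ENNReal.ofReal (gasDensity α f y.1.2) *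
      ENNReal.ofReal √(pairKin m y.1) + (fun p : (Vel × ℝ) × (Vel × ℝ) =>
        ENNReal.ofReal (gasDensity α f p.1) * ENNReal.ofReal (gasDensity α f p.2) *
        ENNReal.ofReal (min √(kin m p.1) √(kin m p.2))) y.1) ∂collMeasure m α b B := by
    refine lintegral_mono_ae (hpos.mono fun y hy => ?_)
    have a1 := gasDensity_nonneg α f hy.1.1
    have a2 := gasDensity_nonneg α f hy.1.2
    simp only
    rw [← mul_add, ← ENNReal.ofReal_mul a1, ← ENNReal.ofReal_add (by positivity) (by positivity),
      ← ENNReal.ofReal_mul (by positivity)]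
    refine ENNReal.ofReal_le_ofReal (mul_le_mul_of_nonneg_left ?_ (mul_nonneg a1 a2))
    exact sqrt_add_sqrt_le (zero_le_one.trans (one_le_kin hm hy.1.1))
      (zero_le_one.trans (one_le_kin hm hy.1.2))
  refine h1.trans ?_
  rw [lintegral_add_left (by fun_prop)]
  gcongr
  refine (hC (fun p : (Vel × ℝ) × (Vel × ℝ) =>
        ENNReal.ofReal (gasDensity α f p.1) * ENNReal.ofReal (gasDensity α f p.2) *
        ENNReal.ofReal (min √(kin m p.1) √(kin m p.2))) (by fun_prop)).trans ?_
  gcongr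
  calc _ ≤ ∫⁻ p : (Vel × ℝ) × (Vel × ℝ), 2 *
        ((ENNReal.ofReal (gasDensity α f p.1) * ENNReal.ofReal (kin m p.1)) *
        (ENNReal.ofReal (gasDensity α f p.2) * ENNReal.ofReal (kin m p.2)))
        ∂((gasMeasure α).prod (gasMeasure α)) := by
        refine lintegral_mono_ae ((ae_pair_pos α).mono fun p hp => ?_)
        have hx := one_le_kin hm hp.1
        have hy := one_le_kin hm hp.2
        have e1 : ENNReal.ofReal (min √(kin m p.1) √(kin m p.2)) *
            ENNReal.ofReal (relE m p ^ (ζ / 2)) ≤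
            2 * (ENNReal.ofReal (kin m p.1) * ENNReal.ofReal (kin m p.2)) := by
          rw [← ENNReal.ofReal_mul (by positivity), ← ENNReal.ofReal_mul (by linarith),
            ← ENNReal.ofReal_ofNat, ← ENNReal.ofReal_mul (by norm_num)]
          refine ENNReal.ofReal_le_ofReal (le_trans ?_ (min_sqrt_mul_le hx hy))
          obtain ⟨r1, r2⟩ := relE_rpow_le hm hK.zeta_pos hK.zeta_le hp.1 hp.2
          exact mul_le_mul_of_nonneg_left (r1.trans r2) (by positivity)
        calc _ = ENNReal.ofReal (gasDensity α f p.1) * ENNReal.ofReal (gasDensity α f p.2) *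
              (ENNReal.ofReal (min √(kin m p.1) √(kin m p.2)) *
                ENNReal.ofReal (relE m p ^ (ζ / 2))) := by ring
          _ ≤ _ := mul_le_mul_right e1 _
          _ = _ := by ring
    _ = _ := by
        rw [lintegral_const_mul _ (by fun_prop), lintegral_pair_energy m α hf]

theorem mass_mul_highMoment_le (hm : 0 < m) (hζ : 0 < ζ) (hζ2 : ζ ≤ 2)
    {f : Vel × ℝ → ℝ} (hf : Measurable f) :
    mass α f * highMoment m α ζ f ≤
      4 * ∫⁻ p, ENNReal.ofReal (gasDensity α f p.1) * ENNReal.ofReal (gasDensity α f p.2) *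
        ENNReal.ofReal √(pairKin m p) * ENNReal.ofReal (relE m p ^ (ζ / 2))
        ∂((gasMeasure α).prod (gasMeasure α)) + 2 * energy m α f ^ 2 := by
  have hF := measurable_gasDensity α hf
  have e1 : mass α f * highMoment m α ζ f = ∫⁻ p,
      (ENNReal.ofReal (gasDensity α f p.1) * ENNReal.ofReal (kin m p.1 ^ (ζ / 2 + 1 / 2))) *
      ENNReal.ofReal (gasDensity α f p.2) ∂((gasMeasure α).prod (gasMeasure α)) := by
    rw [lintegral_pair_mul (g := fun z => ENNReal.ofReal (gasDensity α f z) *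
      ENNReal.ofReal (kin m z ^ (ζ / 2 + 1 / 2))) (h := fun z => ENNReal.ofReal (gasDensity α f z))
      (by fun_prop) (by fun_prop), mul_comm]; rfl
  have e2 : energy m α f ^ 2 = ∫⁻ p,
      (ENNReal.ofReal (gasDensity α f p.1) * ENNReal.ofReal (kin m p.1)) *
      (ENNReal.ofReal (gasDensity α f p.2) * ENNReal.ofReal (kin m p.2))
        ∂((gasMeasure α).prod (gasMeasure α)) := by
    exact (lintegral_pair_energy m α hf).symm
  rw [e1, e2, ← lintegral_const_mul _ (by fun_prop), ← lintegral_const_mul _ (by fun_prop),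
    ← lintegral_add_left (by fun_prop)]
  refine lintegral_mono_ae ((ae_pair_pos α).mono fun p hp => ?_)
  have hx := one_le_kin hm hp.1
  have hy := one_le_kin hm hp.2
  have he := relE_pos hm hp.1 hp.2
  have key : ENNReal.ofReal (kin m p.1 ^ (ζ / 2 + 1 / 2)) ≤
      4 * (ENNReal.ofReal √(pairKin m p) * ENNReal.ofReal (relE m p ^ (ζ / 2))) +
      2 * (ENNReal.ofReal (kin m p.1) * ENNReal.ofReal (kin m p.2)) := by
    rw [← ENNReal.ofReal_mul (by positivity), ← ENNReal.ofReal_mul (by linarith),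
      ← ENNReal.ofReal_ofNat 4, ← ENNReal.ofReal_ofNat 2, ← ENNReal.ofReal_mul (by norm_num),
      ← ENNReal.ofReal_mul (by norm_num), ← ENNReal.ofReal_add (by positivity)
        (by have : 0 ≤ kin m p.1 * kin m p.2 := by nlinarith
            linarith)]
    exact ENNReal.ofReal_le_ofReal (kin_rpow_le hm hζ hζ2 hp.1 hp.2)
  calc _ = ENNReal.ofReal (gasDensity α f p.1) * ENNReal.ofReal (gasDensity α f p.2) *
        ENNReal.ofReal (kin m p.1 ^ (ζ / 2 + 1 / 2)) := by ring
    _ ≤ _ := mul_le_mul_right key _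
    _ = _ := by ring

/-- The square root of the energy is produced at a rate that controls the moment of order
`ζ + 1`. -/
theorem exists_sqrt_production (hK : IsHardKernel m α ζ b B blb bub) (hm : 0 < m)
    (hb0 : angConst b ≠ 0) (hb : angConst b ≠ ∞) {M E : ℝ≥0∞} (hM : M ≠ 0) (hM' : M ≠ ∞)
    (hE : E ≠ ∞) :
    ∃ c > 0, ∃ C : ℝ, ∀ f, IsState m α b B f → mass α f = M → energy m α f ≤ E →
      highMoment m α ζ f ≠ ∞ ∧ c * (highMoment m α ζ f).toReal ≤
        ∫ z, √(kin m z) * collOp m α b B f f z ∂stateMeasure + C := by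
  obtain ⟨C1, hC1, h1⟩ := hK.exists_lintegral_le hm hb
  obtain ⟨c0, hc0, h2'⟩ := hK.exists_povzner hm
  -- `exists_povzner` may hold with an infinite constant, which has to be replaced by a finite one
  set c1 : ℝ≥0∞ := min c0 1 * angConst b with hc1
  have hc1f : c1 ≠ ∞ := ENNReal.mul_ne_top (ne_top_of_le_ne_top ENNReal.one_ne_top
    (min_le_right _ _)) hb
  have hc10 : c1 ≠ 0 := mul_ne_zero (by simp [hc0]) hb0
  set K : ℝ≥0∞ := C1 * (2 * E ^ 2) with hKdef
  have hKf : K ≠ ∞ := ENNReal.mul_ne_top hC1 (ENNReal.mul_ne_top (by simp) (by simp [hE]))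
  set K2 : ℝ≥0∞ := c1 * (2 * E ^ 2) with hK2def
  have hK2f : K2 ≠ ∞ := ENNReal.mul_ne_top hc1f (ENNReal.mul_ne_top (by simp) (by simp [hE]))
  have hMc : c1 * M ≠ ∞ := ENNReal.mul_ne_top hc1f hM'
  refine ⟨(c1 * M).toReal / 8, div_pos (ENNReal.toReal_pos (mul_ne_zero hc10 hM) hMc) (by norm_num),
    (4 * K.toReal + K2.toReal) / 8, fun f hf hfM hfE => ?_⟩
  have hF := measurable_gasDensity α hf.measurable
  obtain ⟨pre_fin, post_fin, e⟩ := two_mul_production hK hm hf (ψ := fun z => √(kin m z))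
    (by fun_prop) (fun z => Real.sqrt_nonneg _) (C := 1) (fun z hz => by
      have := one_le_kin hm hz
      rw [abs_of_nonneg (Real.sqrt_nonneg _), one_mul, Real.sqrt_le_left (by linarith)]
      nlinarith)
  have hpre := lintegral_preDensity_le hK hm hf.measurable h1
  have hpov := h2' (fun p => ENNReal.ofReal (gasDensity α f p.1) *
    ENNReal.ofReal (gasDensity α f p.2)) (by fun_prop)
  have hpost : ∫⁻ y : Coll, ENNReal.ofReal (gasDensity α f y.1.1) *
      ENNReal.ofReal (gasDensity α f y.1.2) *
      (ENNReal.ofReal √(kin m y.2.1) + ENNReal.ofReal √(kin m y.2.2)) ∂collMeasure m α b B =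
      ∫⁻ y : Coll, ENNReal.ofReal (preDensity α f y * (√(kin m y.2.1) + √(kin m y.2.2)))
        ∂collMeasure m α b B := by
    refine lintegral_congr_ae ?_
    filter_upwards [ofReal_preDensity hK hm f, preDensity_nonneg_ae hK hm f] with y hy hy0
    rw [hy, ← ENNReal.ofReal_add (by positivity) (by positivity), ← ENNReal.ofReal_mul hy0]
  rw [hpost] at hpov
  have hJ := mass_mul_highMoment_le (α := α) hm hK.zeta_pos hK.zeta_le hf.measurable
  rw [hfM] at hJ
  set J := ∫⁻ p, ENNReal.ofReal (gasDensity α f p.1) * ENNReal.ofReal (gasDensity α f p.2) *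
        ENNReal.ofReal √(pairKin m p) * ENNReal.ofReal (relE m p ^ (ζ / 2))
        ∂((gasMeasure α).prod (gasMeasure α))
  set A := ∫⁻ y : Coll, ENNReal.ofReal (gasDensity α f y.1.1) *
      ENNReal.ofReal (gasDensity α f y.1.2) *
      ENNReal.ofReal √(pairKin m y.1) ∂collMeasure m α b B
  set post := ∫⁻ y : Coll, ENNReal.ofReal (preDensity α f y * (√(kin m y.2.1) + √(kin m y.2.2)))
        ∂collMeasure m α b B
  set pre := ∫⁻ y : Coll, ENNReal.ofReal (preDensity α f y * (√(kin m y.1.1) + √(kin m y.1.2)))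
        ∂collMeasure m α b B
  set Y := highMoment m α ζ f
  have hpov' : A + c1 * J ≤ post := by
    refine le_trans ?_ hpov
    rw [hc1]
    gcongr
    exact min_le_left _ _
  have hpreK : pre ≤ A + K := hpre.trans (by rw [hKdef]; gcongr)
  have hcomb : pre + c1 * J ≤ post + K := by
    calc pre + c1 * J ≤ A + K + c1 * J := by gcongr
      _ = A + c1 * J + K := by ring
      _ ≤ _ := by gcongr
  have hcJ : c1 * J ≠ ∞ := ne_top_of_le_ne_top post_fin (le_trans le_add_self hpov')
  have hMY : c1 * M * Y ≤ 4 * (c1 * J) + K2 := by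
    calc c1 * M * Y = c1 * (M * Y) := by ring
      _ ≤ c1 * (4 * J + 2 * E ^ 2) := by gcongr; exact hJ.trans (by gcongr)
      _ = _ := by rw [hK2def]; ring
  have hYf : Y ≠ ∞ := by
    intro hY
    rw [hY, ENNReal.mul_top (mul_ne_zero hc10 hM), top_le_iff] at hMY
    exact ENNReal.add_ne_top.2 ⟨ENNReal.mul_ne_top (by simp) hcJ, hK2f⟩ hMY
  refine ⟨hYf, ?_⟩
  have r1 := ENNReal.toReal_mono (ENNReal.add_ne_top.2 ⟨post_fin, hKf⟩) hcomb
  rw [ENNReal.toReal_add pre_fin hcJ, ENNReal.toReal_add post_fin hKf] at r1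
  have r2 := ENNReal.toReal_mono
    (ENNReal.add_ne_top.2 ⟨ENNReal.mul_ne_top (by simp) hcJ, hK2f⟩) hMY
  rw [ENNReal.toReal_mul, ENNReal.toReal_add (ENNReal.mul_ne_top (by simp) hcJ) hK2f,
    ENNReal.toReal_mul (a := 4)] at r2
  simp only [ENNReal.toReal_ofNat] at r2
  linarith

end

/-! ### Integrability of negative powers of the energy -/

section
variable {m : ℝ}

theorem lintegral_Ioi_rpow_mul_lt_top (hm : 0 < m) {β k : ℝ} (hβ : -1 < β) (hk : β + 1 < k) :
    ∫⁻ I in Ioi (0 : ℝ), ENNReal.ofReal (I ^ β) * ENNReal.ofReal ((1 + I / m) ^ (-k)) < ∞ := by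
  have h1 : ∫⁻ I in Ioc (0 : ℝ) 1, ENNReal.ofReal (I ^ β) < ∞ :=
    ((intervalIntegrable_iff_integrableOn_Ioc_of_le zero_le_one).1
      (intervalIntegral.intervalIntegrable_rpow' hβ)).lintegral_lt_top
  have h2 : ∫⁻ I in Ioi (1 : ℝ), ENNReal.ofReal (I ^ (β - k)) < ∞ :=
    (integrableOn_Ioi_rpow_of_lt (by linarith : β - k < -1) one_pos).lintegral_lt_top
  rw [← Ioc_union_Ioi_eq_Ioi (zero_le_one' ℝ), lintegral_union measurableSet_Ioi
    (Ioc_disjoint_Ioi le_rfl)]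
  refine ENNReal.add_lt_top.2 ⟨lt_of_le_of_lt ?_ h1, lt_of_le_of_lt ?_
    (ENNReal.mul_lt_top (ENNReal.ofReal_lt_top (r := m ^ k)) h2)⟩
  · refine setLIntegral_mono' measurableSet_Ioc fun I hI => ?_
    refine mul_le_of_le_one_right' ?_
    rw [ENNReal.ofReal_le_one]
    refine Real.rpow_le_one_of_one_le_of_nonpos ?_ (by linarith)
    have := div_nonneg hI.1.le hm.le
    linarith
  · rw [← lintegral_const_mul' _ _ ENNReal.ofReal_ne_top]
    refine setLIntegral_mono' measurableSet_Ioi fun I hI => ?_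
    have hI0 : 0 < I := one_pos.trans hI
    rw [← ENNReal.ofReal_mul (by positivity), ← ENNReal.ofReal_mul (by positivity)]
    refine ENNReal.ofReal_le_ofReal ?_
    calc I ^ β * (1 + I / m) ^ (-k) ≤ I ^ β * (I / m) ^ (-k) := by
          refine mul_le_mul_of_nonneg_left ?_ (by positivity)
          exact Real.rpow_le_rpow_of_nonpos (by positivity) (by linarith) (by linarith)
      _ = m ^ k * I ^ (β - k) := by
          rw [Real.div_rpow hI0.le hm.le, Real.rpow_sub hI0, Real.rpow_neg hI0.le,
            Real.rpow_neg hm.le]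
          field_simp

/-- Large negative powers of the energy are integrable: the energy dominates the geometric mean
of its kinetic and its internal part. -/
theorem lintegral_kin_rpow_lt_top (hm : 0 < m) {β q : ℝ} (hβ : -1 < β) (hq : 3 < q)
    (hqβ : 2 * (β + 1) < q) :
    ∫⁻ z, ENNReal.ofReal (kin m z ^ (-q)) ∂gasMeasure β < ∞ := by
  have hv : ∫⁻ v : Vel, ENNReal.ofReal ((1 + ‖v‖ ^ 2) ^ (-q / 2)) < ∞ :=
    (integrable_rpow_neg_one_add_norm_sq (E := Vel) (by simpa using hq)).lintegral_lt_top
  have hI := lintegral_Ioi_rpow_mul_lt_top hm hβ (k := q / 2) (by linarith)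
  rw [lintegral_gasMeasure _ _ (by fun_prop)]
  refine lt_of_le_of_lt ?_ (ENNReal.mul_lt_top
    (ENNReal.mul_lt_top (ENNReal.ofReal_lt_top (r := 2 ^ (q / 2))) hv) hI)
  rw [← lintegral_const_mul' _ _ ENNReal.ofReal_ne_top, ← lintegral_mul_const _ (by fun_prop)]
  refine lintegral_mono fun v => ?_
  rw [← lintegral_const_mul' _ _ (ENNReal.mul_ne_top ENNReal.ofReal_ne_top ENNReal.ofReal_ne_top)]
  refine setLIntegral_mono' measurableSet_Ioi fun I hI => ?_
  have hI0 : 0 < I := hI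
  rw [mul_left_comm]
  refine mul_le_mul_right ?_ _
  rw [← ENNReal.ofReal_mul (by positivity), ← ENNReal.ofReal_mul (by positivity)]
  refine ENNReal.ofReal_le_ofReal ?_
  have hA : (1 + ‖v‖ ^ 2) / 2 * (1 + I / m) ≤ kin m (v, I) ^ 2 := by
    have h3 : 0 ≤ I / m := by positivity
    unfold kin
    simp only
    nlinarith [sq_nonneg ‖v‖, mul_nonneg (sq_nonneg ‖v‖) h3]
  have hk := one_le_kin hm (z := (v, I)) hI0
  calc kin m (v, I) ^ (-q) = (kin m (v, I) ^ 2) ^ (-(q / 2)) := by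
        rw [← Real.rpow_natCast, ← Real.rpow_mul (by linarith)]
        congr 1
        push_cast
        ring
    _ ≤ ((1 + ‖v‖ ^ 2) / 2 * (1 + I / m)) ^ (-(q / 2)) :=
        Real.rpow_le_rpow_of_nonpos (by positivity) hA (by linarith)
    _ = _ := by
        rw [Real.mul_rpow (by positivity) (by positivity), Real.div_rpow (by positivity)
          (by norm_num), Real.rpow_neg (by norm_num : (0 : ℝ) ≤ 2), neg_div]
        field_simp

end

/-! ### Truncated densities and the pointwise entropy inequality -/

/-- The lower cut-off `e^{-n/8} x^{-q}` of a density at a state of energy `x`. The power makes it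
integrable, and its logarithm is at most of the order of the energy. -/
noncomputable def lowCut (q n x : ℝ) : ℝ := Real.exp (-n / 8) * x ^ (-q)

/-- The density `y`, at a state of energy `x`, truncated to `[e^{-n/8} x^{-q}, e^n]`. -/
noncomputable def trunc (q n x y : ℝ) : ℝ := max (lowCut q n x) (min y (Real.exp n))

/-- The part of `y` above the upper cut-off. -/
noncomputable def excess (n y : ℝ) : ℝ := max (y - Real.exp n) 0

theorem lowCut_pos (q n : ℝ) {x : ℝ} (hx : 1 ≤ x) : 0 < lowCut q n x := by
  unfold lowCut; positivity

theorem lowCut_le_one {q n x : ℝ} (hq : 0 ≤ q) (hn : 0 ≤ n) (hx : 1 ≤ x) : lowCut q n x ≤ 1 := by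
  unfold lowCut
  exact mul_le_one₀ (Real.exp_le_one_iff.2 (by linarith)) (by positivity)
    (Real.rpow_le_one_of_one_le_of_nonpos hx (by linarith))

theorem log_lowCut (q n : ℝ) {x : ℝ} (hx : 1 ≤ x) :
    Real.log (lowCut q n x) = -n / 8 - q * Real.log x := by
  unfold lowCut
  rw [Real.log_mul (Real.exp_pos _).ne' (by positivity), Real.log_exp,
    Real.log_rpow (by linarith)]
  ring

theorem trunc_pos (q n : ℝ) {x : ℝ} (hx : 1 ≤ x) (y : ℝ) : 0 < trunc q n x y :=
  (lowCut_pos q n hx).trans_le (le_max_left _ _)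

theorem trunc_add_excess {q n x : ℝ} (hq : 0 ≤ q) (hn : 0 ≤ n) (hx : 1 ≤ x) (y : ℝ) :
    trunc q n x y + excess n y = max (lowCut q n x) y := by
  have h1 := lowCut_le_one hq hn hx
  have h2 := Real.one_le_exp hn
  unfold trunc excess
  rcases le_total y (Real.exp n) with h | h
  · rw [min_eq_left h, max_eq_right (sub_nonpos.2 h), add_zero]
  · rw [min_eq_right h, max_eq_left (sub_nonneg.2 h), max_eq_right (by linarith),
      max_eq_right (by linarith)]
    ring

theorem log_trunc_le {q n x : ℝ} (hq : 0 ≤ q) (hn : 0 ≤ n) (hx : 1 ≤ x) (y : ℝ) :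
    Real.log (trunc q n x y) ≤ n := by
  rw [Real.log_le_iff_le_exp (trunc_pos q n hx y)]
  exact max_le ((lowCut_le_one hq hn hx).trans (Real.one_le_exp hn)) (min_le_right _ _)

theorem le_log_trunc (q n : ℝ) {x : ℝ} (hx : 1 ≤ x) (y : ℝ) :
    -n / 8 - q * Real.log x ≤ Real.log (trunc q n x y) := by
  rw [← log_lowCut q n hx]
  exact Real.log_le_log (lowCut_pos q n hx) (le_max_left _ _)

theorem log_trunc_of_excess {q n x y : ℝ} (hq : 0 ≤ q) (hn : 0 ≤ n) (hx : 1 ≤ x)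
    (h : excess n y ≠ 0) : Real.log (trunc q n x y) = n := by
  have h1 := lowCut_le_one hq hn hx
  have h2 := Real.one_le_exp hn
  have h3 : Real.exp n < y := by
    by_contra hc
    exact h (max_eq_right (by linarith))
  rw [trunc, min_eq_right h3.le, max_eq_right (by linarith), Real.log_exp]

theorem log_trunc_le_of_le {q n x y : ℝ} (hq : 0 ≤ q) (hn : 0 ≤ n) (hx : 1 ≤ x)
    (h : y ≤ Real.exp (n / 8)) : Real.log (trunc q n x y) ≤ n / 8 := by
  rw [Real.log_le_iff_le_exp (trunc_pos q n hx y)]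
  exact max_le ((lowCut_le_one hq hn hx).trans (Real.one_le_exp (by linarith)))
    ((min_le_left _ _).trans h)

/-- Indicator of the values above `e^{n/8}` of the density. -/
noncomputable def isLarge (n y : ℝ) : ℝ := if Real.exp (n / 8) < y then 1 else 0

theorem isLarge_nonneg (n y : ℝ) : 0 ≤ isLarge n y := by unfold isLarge; split_ifs <;> norm_num

theorem log_trunc_le_isLarge {q n x : ℝ} (hq : 0 ≤ q) (hn : 0 ≤ n) (hx : 1 ≤ x) (y : ℝ) :
    Real.log (trunc q n x y) ≤ n / 8 + n * isLarge n y := by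
  unfold isLarge
  split_ifs with h
  · have := log_trunc_le hq hn hx y; linarith
  · have := log_trunc_le_of_le hq hn hx (not_lt.1 h); linarith

theorem log_le_two_sqrt {x : ℝ} (hx : 0 < x) : Real.log x ≤ 2 * √x := by
  have h := Real.log_le_sub_one_of_pos (Real.sqrt_pos.2 hx)
  rw [Real.log_sqrt hx.le] at h
  linarith

/-- The pointwise inequality behind the estimate of the truncated entropy production, for the
densities `F₁, F₂` before and `F₃, F₄` after a collision and the energies `x₁, …, x₄`. The terms
with the factor `5 / 8 * n` on the left come from the collisions in which a molecule leaves the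
region where the density exceeds `e^n`; they outweigh the terms with `isLarge` on the right if most
collisions lead out of the region of large densities. -/
theorem entropy_production_pointwise {q n : ℝ} (hq : 0 ≤ q) (hn : 1 ≤ n)
    {F₁ F₂ F₃ F₄ x₁ x₂ x₃ x₄ : ℝ} (hF₁ : 0 ≤ F₁) (hF₂ : 0 ≤ F₂) (hx₁ : 1 ≤ x₁) (hx₂ : 1 ≤ x₂)
    (hx₃ : 1 ≤ x₃) (hx₄ : 1 ≤ x₄) (hx : x₃ + x₄ = x₁ + x₂) :
    F₁ * F₂ * (Real.log (trunc q n x₃ F₃) + Real.log (trunc q n x₄ F₄) -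
        (Real.log (trunc q n x₁ F₁) + Real.log (trunc q n x₂ F₂))) +
      (trunc q n x₁ F₁ * trunc q n x₂ F₂ + 5 / 8 * n * (excess n F₁ * max (lowCut q n x₂) F₂ +
        trunc q n x₁ F₁ * excess n F₂)) ≤
    trunc q n x₃ F₃ * trunc q n x₄ F₄ +
      n * ((excess n F₁ * max (lowCut q n x₂) F₂ + trunc q n x₁ F₁ * excess n F₂) *
        (isLarge n F₃ + isLarge n F₄)) +
      2 * q * (excess n F₁ * max (lowCut q n x₂) F₂ * √x₂ +
        trunc q n x₁ F₁ * excess n F₂ * √x₁) +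
      (3 + 4 * q) * n * ((lowCut q n x₁ * max (lowCut q n x₂) F₂ + F₁ * lowCut q n x₂) *
        √(x₁ + x₂)) := by
  have hn0 : 0 ≤ n := by linarith
  have e1 := trunc_add_excess hq hn0 hx₁ F₁
  have e2 := trunc_add_excess hq hn0 hx₂ F₂
  have p1 := trunc_pos q n hx₁ F₁
  have p2 := trunc_pos q n hx₂ F₂
  have p3 := trunc_pos q n hx₃ F₃
  have p4 := trunc_pos q n hx₄ F₄
  have l1 := le_log_trunc q n hx₁ F₁
  have l2 := le_log_trunc q n hx₂ F₂
  have l3 := le_log_trunc q n hx₃ F₃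
  have l4 := le_log_trunc q n hx₄ F₄
  have u1 := log_trunc_le hq hn0 hx₁ F₁
  have u2 := log_trunc_le hq hn0 hx₂ F₂
  have v3 := log_trunc_le_isLarge hq hn0 hx₃ F₃
  have v4 := log_trunc_le_isLarge hq hn0 hx₄ F₄
  have w1 := fun h => log_trunc_of_excess (y := F₁) hq hn0 hx₁ h
  have w2 := fun h => log_trunc_of_excess (y := F₂) hq hn0 hx₂ h
  have h1 : 0 ≤ excess n F₁ := le_max_right _ _
  have h2 : 0 ≤ excess n F₂ := le_max_right _ _
  have c1 := lowCut_pos q n hx₁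
  have c2 := lowCut_pos q n hx₂
  have g1 : F₁ ≤ max (lowCut q n x₁) F₁ := le_max_right _ _
  have g2 : F₂ ≤ max (lowCut q n x₂) F₂ := le_max_right _ _
  have g1' : max (lowCut q n x₁) F₁ ≤ lowCut q n x₁ + F₁ := max_le (by linarith) (by linarith)
  have g2' : max (lowCut q n x₂) F₂ ≤ lowCut q n x₂ + F₂ := max_le (by linarith) (by linarith)
  set L := Real.log (trunc q n x₃ F₃) + Real.log (trunc q n x₄ F₄) -
        (Real.log (trunc q n x₁ F₁) + Real.log (trunc q n x₂ F₂)) with hL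
  set s := isLarge n F₃ + isLarge n F₄ with hs
  -- the usual sign of the entropy production, from `log t ≤ t - 1`
  have s1 : trunc q n x₁ F₁ * trunc q n x₂ F₂ * L ≤
      trunc q n x₃ F₃ * trunc q n x₄ F₄ - trunc q n x₁ F₁ * trunc q n x₂ F₂ := by
    have hp := mul_pos p1 p2
    have h3 : L = Real.log (trunc q n x₃ F₃ * trunc q n x₄ F₄ /
        (trunc q n x₁ F₁ * trunc q n x₂ F₂)) := by
      rw [Real.log_div (mul_pos p3 p4).ne' hp.ne', Real.log_mul p3.ne' p4.ne',
        Real.log_mul p1.ne' p2.ne']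
    have h4 := Real.log_le_sub_one_of_pos (div_pos (mul_pos p3 p4) hp)
    rw [← h3] at h4
    calc _ ≤ trunc q n x₁ F₁ * trunc q n x₂ F₂ * (trunc q n x₃ F₃ * trunc q n x₄ F₄ /
        (trunc q n x₁ F₁ * trunc q n x₂ F₂) - 1) := mul_le_mul_of_nonneg_left h4 hp.le
      _ = _ := by field_simp
  have hlog1 : q * Real.log x₁ ≤ q * (2 * √x₁) :=
    mul_le_mul_of_nonneg_left (log_le_two_sqrt (by linarith)) hq
  have hlog2 : q * Real.log x₂ ≤ q * (2 * √x₂) :=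
    mul_le_mul_of_nonneg_left (log_le_two_sqrt (by linarith)) hq
  -- a factor `excess n F₁` forces the term `-n` in `L`; the outgoing molecules contribute at most
  -- `n / 8` each where the density is not large, and the partner at most `n / 8 + q log x₂`
  have s2 : excess n F₁ * max (lowCut q n x₂) F₂ * L ≤ excess n F₁ * max (lowCut q n x₂) F₂ *
      (-(5 / 8) * n + n * s + q * (2 * √x₂)) := by
    rcases eq_or_ne (excess n F₁) 0 with h | h
    · simp [h]
    · have := w1 h
      exact mul_le_mul_of_nonneg_left (by rw [hL, hs]; linarith) (mul_nonneg h1 (by linarith))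
  have s3 : trunc q n x₁ F₁ * excess n F₂ * L ≤ trunc q n x₁ F₁ * excess n F₂ *
      (-(5 / 8) * n + n * s + q * (2 * √x₁)) := by
    rcases eq_or_ne (excess n F₂) 0 with h | h
    · simp [h]
    · have := w2 h
      exact mul_le_mul_of_nonneg_left (by rw [hL, hs]; linarith) (mul_nonneg p1.le h2)
  have s4 : -L ≤ (3 + 4 * q) * n * √(x₁ + x₂) := by
    have hX : 1 ≤ √(x₁ + x₂) := Real.one_le_sqrt.2 (by linarith)
    have k3 : Real.log x₃ ≤ 2 * √(x₁ + x₂) := (log_le_two_sqrt (by linarith)).trans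
      (by have : √x₃ ≤ √(x₁ + x₂) := Real.sqrt_le_sqrt (by linarith)
          linarith)
    have k4 : Real.log x₄ ≤ 2 * √(x₁ + x₂) := (log_le_two_sqrt (by linarith)).trans
      (by have : √x₄ ≤ √(x₁ + x₂) := Real.sqrt_le_sqrt (by linarith)
          linarith)
    have k5 : q * Real.log x₃ + q * Real.log x₄ ≤ q * (4 * √(x₁ + x₂)) := by
      rw [← mul_add]; exact mul_le_mul_of_nonneg_left (by linarith) hq
    have k6 : -L ≤ 3 * n + q * (4 * √(x₁ + x₂)) := by rw [hL]; linarith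
    have k7 : n ≤ n * √(x₁ + x₂) := le_mul_of_one_le_right hn0 hX
    have k8 : q * (4 * √(x₁ + x₂)) ≤ n * (q * (4 * √(x₁ + x₂))) :=
      le_mul_of_one_le_left (by positivity) hn
    linarith
  -- `F₁ F₂` differs from the product of the densities cut off from below only by small terms
  have s5 : -((max (lowCut q n x₁) F₁ * max (lowCut q n x₂) F₂ - F₁ * F₂) * L) ≤
      (lowCut q n x₁ * max (lowCut q n x₂) F₂ + F₁ * lowCut q n x₂) *
        ((3 + 4 * q) * n * √(x₁ + x₂)) := by
    have d1 : 0 ≤ max (lowCut q n x₁) F₁ * max (lowCut q n x₂) F₂ - F₁ * F₂ :=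
      sub_nonneg.2 (mul_le_mul g1 g2 hF₂ (hF₁.trans g1))
    have d2 : max (lowCut q n x₁) F₁ * max (lowCut q n x₂) F₂ - F₁ * F₂ ≤
        lowCut q n x₁ * max (lowCut q n x₂) F₂ + F₁ * lowCut q n x₂ := by
      have := mul_le_mul_of_nonneg_right g1' (hF₂.trans g2)
      have := mul_le_mul_of_nonneg_left g2' hF₁
      linarith
    calc _ = (max (lowCut q n x₁) F₁ * max (lowCut q n x₂) F₂ - F₁ * F₂) * (-L) := by ring
      _ ≤ (max (lowCut q n x₁) F₁ * max (lowCut q n x₂) F₂ - F₁ * F₂) *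
          ((3 + 4 * q) * n * √(x₁ + x₂)) := mul_le_mul_of_nonneg_left s4 d1
      _ ≤ _ := mul_le_mul_of_nonneg_right d2 (by positivity)
  have e3 : F₁ * F₂ * L = trunc q n x₁ F₁ * trunc q n x₂ F₂ * L +
      excess n F₁ * max (lowCut q n x₂) F₂ * L + trunc q n x₁ F₁ * excess n F₂ * L -
      (max (lowCut q n x₁) F₁ * max (lowCut q n x₂) F₂ - F₁ * F₂) * L := by
    rw [← e1, ← e2]; ring
  rw [e3]
  linarith

/-! ### Escape from small regions -/

section
variable {m α ζ : ℝ} {b : ℝ → ℝ} {B : Vel → Vel → ℝ → ℝ → ℝ → ℝ → ℝ} {blb bub : ℝ → ℝ → ℝ}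

/-- Collisions of relative energy at least `n^(-2/ζ)` spread over a set much larger than the
region where the density exceeds `e^{n/8}`. -/
theorem tendsto_energyCut_smallness (α ζ : ℝ) {E δ : ℝ≥0∞} (hE : E ≠ ∞) (hδ : 0 < δ) :
    ∀ᶠ n : ℝ in Filter.atTop,
      ENNReal.ofReal ((n ^ (-(2 / ζ))) ^ (5 / 2 + α))⁻¹ * (ENNReal.ofReal (Real.exp (-n / 8)) * E) <
        δ := by
  have h1 := tendsto_rpow_mul_exp_neg_mul_atTop_nhds_zero (2 / ζ * (5 / 2 + α)) (1 / 8)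
    (by norm_num)
  have h2 := ENNReal.tendsto_ofReal (h1.mul_const E.toReal)
  rw [zero_mul, ENNReal.ofReal_zero] at h2
  filter_upwards [(tendsto_order.1 h2).2 δ hδ, Filter.eventually_gt_atTop 0] with n hn hn0
  convert hn using 1
  rw [← ENNReal.ofReal_toReal hE, ← ENNReal.ofReal_mul (by positivity),
    ← ENNReal.ofReal_mul (by positivity), ENNReal.toReal_ofReal (by positivity)]
  congr 1
  rw [← Real.rpow_mul hn0.le, ← Real.rpow_neg hn0.le, ← mul_assoc]
  congr 3
  · ring
  · ring

/-- If the region `s` is small, most collisions lead out of it. Collisions of small relative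
energy are treated separately: their rate is at most of order `1 / n`. -/
theorem exists_escape (hK : IsHardKernel m α ζ b B blb bub) (hm : 0 < m) (hα : -1 < α)
    (hb0 : angConst b ≠ 0) (hb : angConst b ≠ ∞) {E : ℝ≥0∞} (hE : E ≠ ∞) :
    ∃ K : ℝ≥0∞, K ≠ ∞ ∧ ∃ n₀ : ℝ, ∀ n ≥ n₀, ∀ s, MeasurableSet s →
      gasMeasure α s ≤ ENNReal.ofReal (Real.exp (-n / 8)) * E →
      ∀ W : (Vel × ℝ) × (Vel × ℝ) → ℝ≥0∞, Measurable W →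
      ENNReal.ofReal n * ∫⁻ y : Coll, W y.1 * (s.indicator 1 y.2.1 + s.indicator 1 y.2.2)
        ∂collMeasure m α b B ≤
      ENNReal.ofReal (5 / 8 * n) * ∫⁻ y : Coll, W y.1 ∂collMeasure m α b B +
        K * ∫⁻ p, W p ∂((gasMeasure α).prod (gasMeasure α)) := by
  obtain ⟨C1, hC1, h1⟩ := hK.exists_lintegral_le hm hb
  obtain ⟨c0, hc0, h0⟩ := hK.exists_const_mul_le hm
  -- two outgoing molecules, each of which hits `s` with at most a quarter of the total rate
  set η : ℝ≥0∞ := c0 * angConst b / 4 with hη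
  have hη0 : η ≠ 0 := by
    rw [hη, ne_eq, ENNReal.div_eq_zero_iff, not_or]
    exact ⟨mul_ne_zero hc0 hb0, by simp⟩
  obtain ⟨δ, hδ, hsp⟩ := hK.exists_spread hm hb hα hη0
  have hev := (tendsto_energyCut_smallness α ζ hE hδ).and (Filter.eventually_gt_atTop 0)
  obtain ⟨n₀, hn₀⟩ := Filter.eventually_atTop.1 hev
  refine ⟨2 * C1, ENNReal.mul_ne_top (by simp) hC1, n₀, fun n hn s hs hsμ W hW => ?_⟩
  obtain ⟨hsm, hn0⟩ := hn₀ n hn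
  -- the threshold at which the rate of the collisions, `ε ^ (ζ / 2)`, equals `1 / n`
  set ε : ℝ := n ^ (-(2 / ζ)) with hε
  have hε0 : 0 < ε := by positivity
  have hεn : ε ^ (ζ / 2) = n⁻¹ := by
    have := hK.zeta_pos
    rw [hε, ← Real.rpow_mul hn0.le, ← Real.rpow_neg_one]
    congr 1
    field_simp
  have hs1 : Measurable (s.indicator (1 : Vel × ℝ → ℝ≥0∞)) := measurable_one.indicator hs
  have hst : MeasurableSet {p : (Vel × ℝ) × (Vel × ℝ) | relE m p < ε} :=
    measurableSet_lt (by fun_prop) (by fun_prop)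
  set Wl := {p : (Vel × ℝ) × (Vel × ℝ) | relE m p < ε}.indicator W with hWl
  set Wh := {p : (Vel × ℝ) × (Vel × ℝ) | relE m p < ε}ᶜ.indicator W with hWh
  have hWlm : Measurable Wl := hW.indicator hst
  have hWhm : Measurable Wh := hW.indicator hst.compl
  have hWsum : ∀ p, W p = Wh p + Wl p := fun p => by
    rw [hWl, hWh, add_comm]
    exact (congrFun (indicator_self_add_compl _ W) p).symm
  have hspread : ∀ G : (Vel × ℝ) × (Vel × ℝ) → ℝ≥0∞, Measurable G →
      (∀ p, relE m p < ε → G p = 0) → _ := hsp s hs ε hε0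
    (lt_of_le_of_lt (by gcongr) hsm)
  -- collisions of large relative energy
  have a1 : ∫⁻ y : Coll, Wh y.1 * (s.indicator 1 y.2.1 + s.indicator 1 y.2.2)
      ∂collMeasure m α b B ≤ 2 * (η * ∫⁻ p, Wh p * ENNReal.ofReal (relE m p ^ (ζ / 2))
        ∂((gasMeasure α).prod (gasMeasure α))) := by
    have z1 : ∀ p, relE m p < ε → Wh p = 0 := fun p hp => indicator_of_notMem (by simpa using hp) _
    have z2 : ∀ p, relE m p < ε → Wh p.swap = 0 := fun p hp => z1 _ (by
      have : relE m p.swap = relE m p := by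
        unfold relE; rw [Prod.fst_swap, Prod.snd_swap, collE_comm]
      rwa [this])
    have b1 := hspread Wh hWhm z1
    have b2 := hspread (fun p => Wh p.swap) (by fun_prop) z2
    have b3 : ∫⁻ y : Coll, Wh y.1.swap * s.indicator 1 y.2.1 ∂collMeasure m α b B =
        ∫⁻ y : Coll, Wh y.1 * s.indicator 1 y.2.2 ∂collMeasure m α b B := by
      rw [← hK.lintegral_collMeasure_exchange (m := m) (G := fun y : Coll => Wh y.1 *
        s.indicator 1 y.2.2) (by fun_prop)]
      rfl
    have b4 : ∫⁻ p : (Vel × ℝ) × (Vel × ℝ), Wh p.swap * ENNReal.ofReal (relE m p ^ (ζ / 2))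
        ∂((gasMeasure α).prod (gasMeasure α)) = ∫⁻ p, Wh p * ENNReal.ofReal (relE m p ^ (ζ / 2))
        ∂((gasMeasure α).prod (gasMeasure α)) := by
      rw [← (Measure.measurePreserving_swap (μ := gasMeasure α)
        (ν := gasMeasure α)).lintegral_comp (f := fun p => Wh p *
          ENNReal.ofReal (relE m p ^ (ζ / 2))) (by fun_prop)]
      refine lintegral_congr fun p => ?_
      have : relE m p.swap = relE m p := by
        unfold relE; rw [Prod.fst_swap, Prod.snd_swap, collE_comm]
      rw [this]
    rw [b3, b4] at b2
    simp only [mul_add]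
    rw [lintegral_add_left (by fun_prop), two_mul]
    exact add_le_add b1 b2
  have a2 : c0 * angConst b * ∫⁻ p, Wh p * ENNReal.ofReal (relE m p ^ (ζ / 2))
        ∂((gasMeasure α).prod (gasMeasure α)) ≤ ∫⁻ y : Coll, W y.1 ∂collMeasure m α b B :=
    (h0 Wh hWhm).trans (lintegral_mono fun y => by rw [hWsum]; exact le_self_add)
  have a3 : ∫⁻ y : Coll, Wh y.1 * (s.indicator 1 y.2.1 + s.indicator 1 y.2.2)
      ∂collMeasure m α b B ≤ ENNReal.ofReal (5 / 8) * ∫⁻ y : Coll, W y.1 ∂collMeasure m α b B := by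
    refine a1.trans ?_
    calc _ = 2 / 4 * (c0 * angConst b * ∫⁻ p, Wh p * ENNReal.ofReal (relE m p ^ (ζ / 2))
        ∂((gasMeasure α).prod (gasMeasure α))) := by
          rw [hη]; simp only [div_eq_mul_inv]; ring
      _ ≤ ENNReal.ofReal (5 / 8) * ∫⁻ y : Coll, W y.1 ∂collMeasure m α b B := by
          refine mul_le_mul' ?_ a2
          rw [show (2 / 4 : ℝ≥0∞) = ENNReal.ofReal (2 / 4) by
            rw [ENNReal.ofReal_div_of_pos (by norm_num)]; simp]
          exact ENNReal.ofReal_le_ofReal (by norm_num)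
  -- collisions of small relative energy
  have a4 : ∫⁻ y : Coll, Wl y.1 * (s.indicator 1 y.2.1 + s.indicator 1 y.2.2)
      ∂collMeasure m α b B ≤ 2 * (C1 * (ENNReal.ofReal n⁻¹ *
        ∫⁻ p, W p ∂((gasMeasure α).prod (gasMeasure α)))) := by
    have hi : ∀ z, s.indicator (1 : Vel × ℝ → ℝ≥0∞) z ≤ 1 := fun z =>
      indicator_le_self' (by simp) z
    calc _ ≤ ∫⁻ y : Coll, 2 * Wl y.1 ∂collMeasure m α b B := by
          refine lintegral_mono fun y => ?_
          rw [mul_comm]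
          gcongr
          exact (add_le_add (hi _) (hi _)).trans (by norm_num)
      _ = 2 * ∫⁻ y : Coll, Wl y.1 ∂collMeasure m α b B := lintegral_const_mul _ (by fun_prop)
      _ ≤ 2 * (C1 * ∫⁻ p, Wl p * ENNReal.ofReal (relE m p ^ (ζ / 2))
          ∂((gasMeasure α).prod (gasMeasure α))) := by gcongr; exact h1 Wl hWlm
      _ ≤ _ := by
          gcongr
          rw [← lintegral_const_mul _ hW]
          refine lintegral_mono_ae ((ae_pair_pos α).mono fun p hp => ?_)
          rw [hWl, mul_comm]
          by_cases h : relE m p < ε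
          · rw [indicator_of_mem (by exact h), ← hεn]
            gcongr
            · exact (relE_pos hm hp.1 hp.2).le
            · have := hK.zeta_pos; positivity
          · rw [indicator_of_notMem (by exact h)]
            simp
  have hnn : ENNReal.ofReal n * ENNReal.ofReal n⁻¹ = 1 := by
    rw [← ENNReal.ofReal_mul hn0.le, mul_inv_cancel₀ hn0.ne', ENNReal.ofReal_one]
  calc _ = ENNReal.ofReal n * (∫⁻ y : Coll, Wh y.1 * (s.indicator 1 y.2.1 + s.indicator 1 y.2.2)
      ∂collMeasure m α b B + ∫⁻ y : Coll, Wl y.1 * (s.indicator 1 y.2.1 + s.indicator 1 y.2.2)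
      ∂collMeasure m α b B) := by
        rw [← lintegral_add_left (by fun_prop)]
        simp only [hWsum, add_mul]
    _ ≤ ENNReal.ofReal n * (ENNReal.ofReal (5 / 8) * ∫⁻ y : Coll, W y.1 ∂collMeasure m α b B +
        2 * (C1 * (ENNReal.ofReal n⁻¹ *
        ∫⁻ p, W p ∂((gasMeasure α).prod (gasMeasure α))))) := by gcongr
    _ = (ENNReal.ofReal (5 / 8) * ENNReal.ofReal n) * ∫⁻ y : Coll, W y.1 ∂collMeasure m α b B +
        (ENNReal.ofReal n * ENNReal.ofReal n⁻¹) * (2 * C1 *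
          ∫⁻ p, W p ∂((gasMeasure α).prod (gasMeasure α))) := by ring
    _ = _ := by rw [hnn, one_mul, ← ENNReal.ofReal_mul (by norm_num)]

end

/-! ### Moments of pairs of molecules -/

/-- Comparison of an integral with lower integrals, for inequalities between terms of variable
sign. -/
theorem integral_le_toReal_of_lintegral_le {Y : Type*} [MeasurableSpace Y] {P : Measure Y}
    {g : Y → ℝ} {A D : Y → ℝ≥0∞} {K : ℝ≥0∞} (hg : Integrable g P) (hA : Measurable A)
    (h : ∀ᵐ y ∂P, ENNReal.ofReal (g y) + A y ≤ D y + ENNReal.ofReal (-g y))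
    (hAf : ∫⁻ y, A y ∂P ≠ ∞) (hK : K ≠ ∞) (hD : ∫⁻ y, D y ∂P ≤ ∫⁻ y, A y ∂P + K) :
    ∫ y, g y ∂P ≤ K.toReal := by
  have hp : ∫⁻ y, ENNReal.ofReal (g y) ∂P ≠ ∞ := hg.lintegral_lt_top.ne
  have hn : ∫⁻ y, ENNReal.ofReal (-g y) ∂P ≠ ∞ := hg.neg.lintegral_lt_top.ne
  have h1 := lintegral_mono_ae h
  have hgm : AEMeasurable (fun y => ENNReal.ofReal (-g y)) P :=
    hg.aemeasurable.neg.ennreal_ofReal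
  rw [lintegral_add_right _ hA, lintegral_add_right' _ hgm] at h1
  have h2 : ∫⁻ y, ENNReal.ofReal (g y) ∂P ≤ K + ∫⁻ y, ENNReal.ofReal (-g y) ∂P := by
    refine (ENNReal.add_le_add_iff_right hAf).1 (h1.trans ?_)
    calc _ ≤ ∫⁻ y, A y ∂P + K + ∫⁻ y, ENNReal.ofReal (-g y) ∂P := by gcongr
      _ = _ := by ring
  have h3 := ENNReal.toReal_mono (ENNReal.add_ne_top.2 ⟨hK, hn⟩) h2
  rw [ENNReal.toReal_add hK hn] at h3
  rw [integral_eq_lintegral_pos_part_sub_lintegral_neg_part hg]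
  linarith

section
variable {m α ζ : ℝ}

theorem sqrt_mul_relE_rpow_le (hm : 0 < m) (hζ : 0 < ζ) (hζ2 : ζ ≤ 2)
    {p : (Vel × ℝ) × (Vel × ℝ)} (h1 : 0 < p.1.2) (h2 : 0 < p.2.2) :
    √(pairKin m p) * relE m p ^ (ζ / 2) ≤
      4 * (kin m p.1 ^ (ζ / 2 + 1 / 2) * kin m p.2 ^ (ζ / 2 + 1 / 2)) := by
  have hx := one_le_kin hm h1
  have hy := one_le_kin hm h2
  have hX : 0 < pairKin m p := by unfold pairKin; linarith
  have hXle : pairKin m p ≤ 2 * (kin m p.1 * kin m p.2) := by unfold pairKin; nlinarith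
  calc _ ≤ pairKin m p ^ (1 / 2 : ℝ) * pairKin m p ^ (ζ / 2) := by
        rw [← Real.sqrt_eq_rpow]
        exact mul_le_mul_of_nonneg_left (relE_rpow_le hm hζ hζ2 h1 h2).1 (Real.sqrt_nonneg _)
    _ = pairKin m p ^ (ζ / 2 + 1 / 2) := by rw [← Real.rpow_add hX, add_comm]
    _ ≤ (2 * (kin m p.1 * kin m p.2)) ^ (ζ / 2 + 1 / 2) :=
        Real.rpow_le_rpow hX.le hXle (by positivity)
    _ = 2 ^ (ζ / 2 + 1 / 2) * (kin m p.1 ^ (ζ / 2 + 1 / 2) * kin m p.2 ^ (ζ / 2 + 1 / 2)) := by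
        rw [Real.mul_rpow (by norm_num) (by nlinarith), Real.mul_rpow (by linarith) (by linarith)]
    _ ≤ 2 ^ (2 : ℝ) * (kin m p.1 ^ (ζ / 2 + 1 / 2) * kin m p.2 ^ (ζ / 2 + 1 / 2)) := by
        gcongr
        · norm_num
        · linarith
    _ = _ := by norm_num

theorem sqrt_snd_mul_relE_rpow_le (hm : 0 < m) (hζ : 0 < ζ) (hζ2 : ζ ≤ 2)
    {p : (Vel × ℝ) × (Vel × ℝ)} (h1 : 0 < p.1.2) (h2 : 0 < p.2.2) :
    √(kin m p.2) * relE m p ^ (ζ / 2) ≤ 2 * (kin m p.1 * kin m p.2 ^ (ζ / 2 + 1 / 2)) := by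
  have hx := one_le_kin hm h1
  have hy := one_le_kin hm h2
  have hX : 0 < pairKin m p := by unfold pairKin; linarith
  have hXle : pairKin m p ≤ 2 * (kin m p.1 * kin m p.2) := by unfold pairKin; nlinarith
  have hle : ∀ x : ℝ, 1 ≤ x → x ^ (ζ / 2) ≤ x := fun x hx => by
    calc _ ≤ x ^ (1 : ℝ) := Real.rpow_le_rpow_of_exponent_le hx (by linarith)
      _ = x := Real.rpow_one _
  calc _ ≤ √(kin m p.2) * (2 * (kin m p.1 * kin m p.2)) ^ (ζ / 2) := by
        exact mul_le_mul_of_nonneg_left ((relE_rpow_le hm hζ hζ2 h1 h2).1.trans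
          (Real.rpow_le_rpow hX.le hXle (by positivity))) (Real.sqrt_nonneg _)
    _ = √(kin m p.2) * (2 ^ (ζ / 2) * (kin m p.1 ^ (ζ / 2) * kin m p.2 ^ (ζ / 2))) := by
        rw [Real.mul_rpow (by norm_num) (by nlinarith), Real.mul_rpow (by linarith) (by linarith)]
    _ ≤ √(kin m p.2) * (2 * (kin m p.1 * kin m p.2 ^ (ζ / 2))) := by
        gcongr
        · exact hle 2 (by norm_num)
        · exact hle _ hx
    _ = _ := by
        rw [Real.rpow_add (by linarith), ← Real.sqrt_eq_rpow]; ring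

theorem relE_swap (m : ℝ) (p : (Vel × ℝ) × (Vel × ℝ)) : relE m p.swap = relE m p := by
  unfold relE; rw [Prod.fst_swap, Prod.snd_swap, collE_comm]

theorem lintegral_pair_sqrt_le (hm : 0 < m) (hζ : 0 < ζ) (hζ2 : ζ ≤ 2)
    {g h : Vel × ℝ → ℝ≥0∞} (hg : Measurable g) (hh : Measurable h) :
    ∫⁻ p, g p.1 * h p.2 * ENNReal.ofReal √(pairKin m p) * ENNReal.ofReal (relE m p ^ (ζ / 2))
      ∂((gasMeasure α).prod (gasMeasure α)) ≤
    4 * ((∫⁻ z, g z * ENNReal.ofReal (kin m z ^ (ζ / 2 + 1 / 2)) ∂gasMeasure α) *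
      ∫⁻ z, h z * ENNReal.ofReal (kin m z ^ (ζ / 2 + 1 / 2)) ∂gasMeasure α) := by
  rw [← lintegral_pair_mul (by fun_prop) (by fun_prop), ← lintegral_const_mul _ (by fun_prop)]
  refine lintegral_mono_ae ((ae_pair_pos α).mono fun p hp => ?_)
  have hx := one_le_kin hm hp.1
  have hy := one_le_kin hm hp.2
  have key : ENNReal.ofReal √(pairKin m p) * ENNReal.ofReal (relE m p ^ (ζ / 2)) ≤
      4 * (ENNReal.ofReal (kin m p.1 ^ (ζ / 2 + 1 / 2)) *
        ENNReal.ofReal (kin m p.2 ^ (ζ / 2 + 1 / 2))) := by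
    rw [← ENNReal.ofReal_mul (by positivity), ← ENNReal.ofReal_mul (by positivity),
      ← ENNReal.ofReal_ofNat, ← ENNReal.ofReal_mul (by norm_num)]
    exact ENNReal.ofReal_le_ofReal (sqrt_mul_relE_rpow_le hm hζ hζ2 hp.1 hp.2)
  calc _ = g p.1 * h p.2 * (ENNReal.ofReal √(pairKin m p) *
        ENNReal.ofReal (relE m p ^ (ζ / 2))) := by ring
    _ ≤ _ := mul_le_mul_right key _
    _ = _ := by ring

theorem lintegral_pair_le (hm : 0 < m) (hζ : 0 < ζ) (hζ2 : ζ ≤ 2)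
    {g h : Vel × ℝ → ℝ≥0∞} (hg : Measurable g) (hh : Measurable h) :
    ∫⁻ p, g p.1 * h p.2 * ENNReal.ofReal (relE m p ^ (ζ / 2))
      ∂((gasMeasure α).prod (gasMeasure α)) ≤
    4 * ((∫⁻ z, g z * ENNReal.ofReal (kin m z ^ (ζ / 2 + 1 / 2)) ∂gasMeasure α) *
      ∫⁻ z, h z * ENNReal.ofReal (kin m z ^ (ζ / 2 + 1 / 2)) ∂gasMeasure α) := by
  refine le_trans ?_ (lintegral_pair_sqrt_le hm hζ hζ2 hg hh)
  refine lintegral_mono_ae ((ae_pair_pos α).mono fun p hp => ?_)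
  have hx := one_le_kin hm hp.1
  have hy := one_le_kin hm hp.2
  refine mul_le_mul_left (le_mul_of_one_le_right' ?_) _
  rw [ENNReal.one_le_ofReal]
  exact Real.one_le_sqrt.2 (by unfold pairKin; linarith)

theorem lintegral_pair_sqrt_snd_le (hm : 0 < m) (hζ : 0 < ζ) (hζ2 : ζ ≤ 2)
    {g h : Vel × ℝ → ℝ≥0∞} (hg : Measurable g) (hh : Measurable h) :
    ∫⁻ p, g p.1 * h p.2 * ENNReal.ofReal √(kin m p.2) * ENNReal.ofReal (relE m p ^ (ζ / 2))
      ∂((gasMeasure α).prod (gasMeasure α)) ≤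
    2 * ((∫⁻ z, g z * ENNReal.ofReal (kin m z) ∂gasMeasure α) *
      ∫⁻ z, h z * ENNReal.ofReal (kin m z ^ (ζ / 2 + 1 / 2)) ∂gasMeasure α) := by
  rw [← lintegral_pair_mul (by fun_prop) (by fun_prop), ← lintegral_const_mul _ (by fun_prop)]
  refine lintegral_mono_ae ((ae_pair_pos α).mono fun p hp => ?_)
  have hx := one_le_kin hm hp.1
  have hy := one_le_kin hm hp.2
  have key : ENNReal.ofReal √(kin m p.2) * ENNReal.ofReal (relE m p ^ (ζ / 2)) ≤
      2 * (ENNReal.ofReal (kin m p.1) * ENNReal.ofReal (kin m p.2 ^ (ζ / 2 + 1 / 2))) := by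
    rw [← ENNReal.ofReal_mul (by positivity), ← ENNReal.ofReal_mul (by positivity),
      ← ENNReal.ofReal_ofNat, ← ENNReal.ofReal_mul (by norm_num)]
    exact ENNReal.ofReal_le_ofReal (sqrt_snd_mul_relE_rpow_le hm hζ hζ2 hp.1 hp.2)
  calc _ = g p.1 * h p.2 * (ENNReal.ofReal √(kin m p.2) *
        ENNReal.ofReal (relE m p ^ (ζ / 2))) := by ring
    _ ≤ _ := mul_le_mul_right key _
    _ = _ := by ring

theorem lintegral_pair_sqrt_fst_le (hm : 0 < m) (hζ : 0 < ζ) (hζ2 : ζ ≤ 2)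
    {g h : Vel × ℝ → ℝ≥0∞} (hg : Measurable g) (hh : Measurable h) :
    ∫⁻ p, g p.1 * h p.2 * ENNReal.ofReal √(kin m p.1) * ENNReal.ofReal (relE m p ^ (ζ / 2))
      ∂((gasMeasure α).prod (gasMeasure α)) ≤
    2 * ((∫⁻ z, g z * ENNReal.ofReal (kin m z ^ (ζ / 2 + 1 / 2)) ∂gasMeasure α) *
      ∫⁻ z, h z * ENNReal.ofReal (kin m z) ∂gasMeasure α) := by
  have h1 := lintegral_pair_sqrt_snd_le (α := α) hm hζ hζ2 hh hg
  rw [mul_comm (∫⁻ z, g z * ENNReal.ofReal (kin m z ^ (ζ / 2 + 1 / 2)) ∂gasMeasure α)]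
  refine le_trans (le_of_eq ?_) h1
  rw [← (Measure.measurePreserving_swap (μ := gasMeasure α)
        (ν := gasMeasure α)).lintegral_comp (f := fun p => h p.1 * g p.2 *
          ENNReal.ofReal √(kin m p.2) * ENNReal.ofReal (relE m p ^ (ζ / 2))) (by fun_prop)]
  refine lintegral_congr fun p => ?_
  rw [relE_swap, Prod.fst_swap, Prod.snd_swap]
  ring

/-! ### Moments of the truncated density -/

theorem lintegral_lowCut_le (hm : 0 < m) (hζ2 : ζ ≤ 2) (q n : ℝ) :
    ∫⁻ z, ENNReal.ofReal (lowCut q n (kin m z)) * ENNReal.ofReal (kin m z ^ (ζ / 2 + 1 / 2))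
      ∂gasMeasure α ≤ ENNReal.ofReal (Real.exp (-n / 8)) *
        ∫⁻ z, ENNReal.ofReal (kin m z ^ (-(q - 3 / 2))) ∂gasMeasure α := by
  rw [← lintegral_const_mul' _ _ ENNReal.ofReal_ne_top]
  refine lintegral_mono_ae ((ae_gasMeasure_pos α).mono fun z hz => ?_)
  have hx := one_le_kin hm hz
  rw [← ENNReal.ofReal_mul (lowCut_pos q n hx).le, ← ENNReal.ofReal_mul (Real.exp_pos _).le]
  refine ENNReal.ofReal_le_ofReal ?_
  rw [lowCut, mul_assoc, ← Real.rpow_add (by linarith)]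
  refine mul_le_mul_of_nonneg_left ?_ (Real.exp_pos _).le
  exact Real.rpow_le_rpow_of_exponent_le hx (by linarith)

@[fun_prop] theorem measurable_lowCut (m q n : ℝ) :
    Measurable fun z => lowCut q n (kin m z) := by unfold lowCut; fun_prop

theorem measurable_trunc (m q n : ℝ) {F : Vel × ℝ → ℝ} (hF : Measurable F) :
    Measurable fun z => trunc q n (kin m z) (F z) := by unfold trunc lowCut; fun_prop

theorem measurable_excess (n : ℝ) {F : Vel × ℝ → ℝ} (hF : Measurable F) :
    Measurable fun z => excess n (F z) := by unfold excess; fun_prop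

theorem lintegral_max_lowCut_le (hm : 0 < m) (hζ2 : ζ ≤ 2) (q : ℝ) {n : ℝ} (hn : 0 ≤ n)
    {f : Vel × ℝ → ℝ} (hf : Measurable f) :
    ∫⁻ z, ENNReal.ofReal (max (lowCut q n (kin m z)) (gasDensity α f z)) *
      ENNReal.ofReal (kin m z ^ (ζ / 2 + 1 / 2)) ∂gasMeasure α ≤
      highMoment m α ζ f + ∫⁻ z, ENNReal.ofReal (kin m z ^ (-(q - 3 / 2))) ∂gasMeasure α := by
  have hF := measurable_gasDensity α hf
  have h1 := lintegral_lowCut_le (α := α) hm hζ2 q n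
  have h2 : ENNReal.ofReal (Real.exp (-n / 8)) ≤ 1 := by
    rw [ENNReal.ofReal_le_one, Real.exp_le_one_iff]; linarith
  calc _ ≤ ∫⁻ z, (ENNReal.ofReal (gasDensity α f z) * ENNReal.ofReal (kin m z ^ (ζ / 2 + 1 / 2)) +
        ENNReal.ofReal (lowCut q n (kin m z)) * ENNReal.ofReal (kin m z ^ (ζ / 2 + 1 / 2)))
          ∂gasMeasure α := by
        refine lintegral_mono fun z => ?_
        rw [← add_mul, ENNReal.ofReal_max]
        gcongr
        exact max_le le_add_self le_self_add
    _ ≤ _ := by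
        rw [lintegral_add_left (by fun_prop)]
        refine add_le_add le_rfl (h1.trans (mul_le_of_le_one_left' h2))

end

/-! ### Production of the truncated entropy -/

section
variable {m α ζ : ℝ} {b : ℝ → ℝ} {B : Vel → Vel → ℝ → ℝ → ℝ → ℝ → ℝ} {blb bub : ℝ → ℝ → ℝ}

theorem ofReal_add_ofReal_le {g u v : ℝ} (hu : 0 ≤ u) (hv : 0 ≤ v) (h : g + u ≤ v) :
    ENNReal.ofReal g + ENNReal.ofReal u ≤ ENNReal.ofReal v + ENNReal.ofReal (-g) := by
  rcases le_total 0 g with hg | hg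
  · rw [← ENNReal.ofReal_add hg hu]
    exact (ENNReal.ofReal_le_ofReal h).trans le_self_add
  · rw [ENNReal.ofReal_of_nonpos hg, zero_add, ← ENNReal.ofReal_add hv (by linarith)]
    exact ENNReal.ofReal_le_ofReal (by linarith)

theorem add_mul_le_add_mul_add (a d u v : ℝ≥0∞) : a * u + d * v ≤ (a + d) * (u + v) := by
  calc a * u + d * v ≤ a * u + d * v + (a * v + d * u) := le_self_add
    _ = _ := by ring

/-- The inequality `entropy_production_pointwise`, read in `[0, ∞]`, where its terms can be
integrated separately. -/
theorem ofReal_production_le {g n k₁ k₂ k₃ a₁ a₂ a₃ a₄ h₁ h₂ g₂ c₁ c₂ f₁ s₃ s₄ r₁ r₂ r : ℝ}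
    (hn : 0 ≤ n) (hk₁ : 0 ≤ k₁) (hk₂ : 0 ≤ k₂) (hk₃ : 0 ≤ k₃) (ha₁ : 0 ≤ a₁) (ha₂ : 0 ≤ a₂)
    (ha₃ : 0 ≤ a₃) (ha₄ : 0 ≤ a₄) (hh₁ : 0 ≤ h₁) (hh₂ : 0 ≤ h₂) (hg₂ : 0 ≤ g₂) (hc₁ : 0 ≤ c₁)
    (hc₂ : 0 ≤ c₂) (hf₁ : 0 ≤ f₁) (hs₃ : 0 ≤ s₃) (hs₄ : 0 ≤ s₄) (hr₁ : 0 ≤ r₁) (hr₂ : 0 ≤ r₂)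
    (hr : 0 ≤ r)
    (h : g + (a₁ * a₂ + k₁ * (h₁ * g₂ + a₁ * h₂)) ≤ a₃ * a₄ +
      n * ((h₁ * g₂ + a₁ * h₂) * (s₃ + s₄)) + k₂ * (h₁ * g₂ * r₂ + a₁ * h₂ * r₁) +
      k₃ * ((c₁ * g₂ + f₁ * c₂) * r)) :
    ENNReal.ofReal g + (ENNReal.ofReal a₁ * ENNReal.ofReal a₂ + ENNReal.ofReal k₁ *
      (ENNReal.ofReal h₁ * ENNReal.ofReal g₂ + ENNReal.ofReal a₁ * ENNReal.ofReal h₂)) ≤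
    ENNReal.ofReal a₃ * ENNReal.ofReal a₄ + ENNReal.ofReal n *
      ((ENNReal.ofReal h₁ * ENNReal.ofReal g₂ + ENNReal.ofReal a₁ * ENNReal.ofReal h₂) *
      (ENNReal.ofReal s₃ + ENNReal.ofReal s₄)) + ENNReal.ofReal k₂ *
      (ENNReal.ofReal h₁ * ENNReal.ofReal g₂ * ENNReal.ofReal r₂ +
        ENNReal.ofReal a₁ * ENNReal.ofReal h₂ * ENNReal.ofReal r₁) +
      ENNReal.ofReal k₃ * (ENNReal.ofReal c₁ * ENNReal.ofReal g₂ * ENNReal.ofReal r +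
        ENNReal.ofReal f₁ * ENNReal.ofReal c₂ * ENNReal.ofReal r) + ENNReal.ofReal (-g) := by
  have k := ofReal_add_ofReal_le (by positivity) (by positivity) h
  lift n to NNReal using hn
  lift k₁ to NNReal using hk₁
  lift k₂ to NNReal using hk₂
  lift k₃ to NNReal using hk₃
  lift a₁ to NNReal using ha₁
  lift a₂ to NNReal using ha₂
  lift a₃ to NNReal using ha₃
  lift a₄ to NNReal using ha₄
  lift h₁ to NNReal using hh₁
  lift h₂ to NNReal using hh₂
  lift g₂ to NNReal using hg₂
  lift c₁ to NNReal using hc₁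
  lift c₂ to NNReal using hc₂
  lift f₁ to NNReal using hf₁
  lift s₃ to NNReal using hs₃
  lift s₄ to NNReal using hs₄
  lift r₁ to NNReal using hr₁
  lift r₂ to NNReal using hr₂
  lift r to NNReal using hr
  simp only [← NNReal.coe_mul, ← NNReal.coe_add, ENNReal.ofReal_coe_nnreal, ENNReal.coe_add,
    ENNReal.coe_mul] at k ⊢
  rw [← add_mul]
  exact k

/-- The energy of the part of the density above `e^n`. -/
noncomputable def excessEnergy (m α n : ℝ) (f : Vel × ℝ → ℝ) : ℝ≥0∞ :=
  ∫⁻ z, ENNReal.ofReal (excess n (gasDensity α f z)) * ENNReal.ofReal (kin m z) ∂gasMeasure α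

theorem abs_log_trunc_le {q n x : ℝ} (hq : 0 ≤ q) (hn : 0 ≤ n) (hx : 1 ≤ x) (y : ℝ) :
    |Real.log (trunc q n x y)| ≤ (n + q) * x := by
  have h1 := log_trunc_le hq hn hx y
  have h2 := le_log_trunc q n hx y
  have h3 : q * Real.log x ≤ q * x := mul_le_mul_of_nonneg_left (Real.log_le_self (by linarith)) hq
  have h4 : n ≤ n * x := le_mul_of_one_le_right hn hx
  have h5 : 0 ≤ q * x := mul_nonneg hq (by linarith)
  rw [abs_le]
  constructor <;> linarith

theorem mass_le_energy (hm : 0 < m) (f : Vel × ℝ → ℝ) : mass α f ≤ energy m α f := by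
  refine lintegral_mono_ae ((ae_gasMeasure_pos α).mono fun z hz => ?_)
  exact le_mul_of_one_le_right' (ENNReal.one_le_ofReal.2 (one_le_kin hm hz))

/-- The density is large only on a set of small measure. -/
theorem gasMeasure_large_le (hm : 0 < m) {f : Vel × ℝ → ℝ} (hf : Measurable f) (n : ℝ) :
    gasMeasure α {z | Real.exp (n / 8) < gasDensity α f z} ≤
      ENNReal.ofReal (Real.exp (-n / 8)) * energy m α f := by
  have hF := measurable_gasDensity α hf
  have h1 := mul_meas_ge_le_lintegral (μ := gasMeasure α) hF.ennreal_ofReal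
    (ENNReal.ofReal (Real.exp (n / 8)))
  have h2 : ENNReal.ofReal (Real.exp (-n / 8)) * ENNReal.ofReal (Real.exp (n / 8)) = 1 := by
    rw [← ENNReal.ofReal_mul (Real.exp_pos _).le, ← Real.exp_add]
    simp [neg_div]
  calc gasMeasure α {z | Real.exp (n / 8) < gasDensity α f z}
      ≤ gasMeasure α {z | ENNReal.ofReal (Real.exp (n / 8)) ≤ ENNReal.ofReal (gasDensity α f z)} :=
        measure_mono fun z hz => ENNReal.ofReal_le_ofReal (le_of_lt hz)
    _ = ENNReal.ofReal (Real.exp (-n / 8)) * (ENNReal.ofReal (Real.exp (n / 8)) *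
        gasMeasure α {z | ENNReal.ofReal (Real.exp (n / 8)) ≤
          ENNReal.ofReal (gasDensity α f z)}) := by rw [← mul_assoc, h2, one_mul]
    _ ≤ _ := by
        gcongr
        exact h1.trans (mass_le_energy hm f)

theorem ae_collMeasure_pos (hK : IsHardKernel m α ζ b B blb bub) (hm : 0 < m) :
    ∀ᵐ y : Coll ∂collMeasure m α b B, (0 < y.1.1.2 ∧ 0 < y.1.2.2) ∧ 0 < y.2.1.2 ∧ 0 < y.2.2.2 :=
  hK.ae_collMeasure_all hm (ae_gasMeasure_pos α)

/-- The production of the truncated entropy is small for large truncation levels, relative to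
the moment of order `ζ + 1`, up to the energy of the part of the density above the truncation. -/
theorem exists_entropy_production_le (hK : IsHardKernel m α ζ b B blb bub) (hm : 0 < m)
    (hα : -1 < α) (hb0 : angConst b ≠ 0) (hb : angConst b ≠ ∞) {E : ℝ≥0∞} (hE : E ≠ ∞) {q : ℝ}
    (hq : 0 ≤ q) (hQ : ∫⁻ z, ENNReal.ofReal (kin m z ^ (-(q - 3 / 2))) ∂gasMeasure α ≠ ∞) :
    ∃ κ : ℝ≥0∞, κ ≠ ∞ ∧ ∃ n₀ ≥ (1 : ℝ), ∀ n ≥ n₀, ∀ f, IsState m α b B f → energy m α f ≤ E →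
      highMoment m α ζ f ≠ ∞ → excessEnergy m α n f ≠ ∞ →
      2 * ∫ z, Real.log (trunc q n (kin m z) (gasDensity α f z)) * collOp m α b B f f z
        ∂stateMeasure ≤
      (κ * (excessEnergy m α n f + ENNReal.ofReal (n * Real.exp (-n / 8))) *
        (1 + highMoment m α ζ f)).toReal := by
  obtain ⟨K0, hK0, n₀, hesc⟩ := exists_escape hK hm hα hb0 hb hE
  obtain ⟨C1, hC1, h1⟩ := hK.exists_lintegral_le hm hb
  have hζ := hK.zeta_pos
  have hζ2 := hK.zeta_le
  set Q := ∫⁻ z, ENNReal.ofReal (kin m z ^ (-(q - 3 / 2))) ∂gasMeasure α with hQdef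
  refine ⟨(2 * K0 + ENNReal.ofReal (2 * q) * C1 * 4) * (1 + Q) +
    ENNReal.ofReal (3 + 4 * q) * C1 * 4 * Q * (2 + Q), ?_, max n₀ 1, le_max_right _ _,
    fun n hn f hf hfE hY hX => ?_⟩
  · finiteness
  have hn1 : 1 ≤ n := (le_max_right _ _).trans hn
  have hn0 : 0 ≤ n := by linarith
  have hF := measurable_gasDensity α hf.measurable
  set F := gasDensity α f with hFdef
  set Y := highMoment m α ζ f with hYdef
  set HX := excessEnergy m α n f with hHX
  set Ae : Vel × ℝ → ℝ≥0∞ := fun z => ENNReal.ofReal (trunc q n (kin m z) (F z)) with hAe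
  set Ge : Vel × ℝ → ℝ≥0∞ := fun z => ENNReal.ofReal (max (lowCut q n (kin m z)) (F z)) with hGe
  set He : Vel × ℝ → ℝ≥0∞ := fun z => ENNReal.ofReal (excess n (F z)) with hHe
  set Ce : Vel × ℝ → ℝ≥0∞ := fun z => ENNReal.ofReal (lowCut q n (kin m z)) with hCe
  set Fe : Vel × ℝ → ℝ≥0∞ := fun z => ENNReal.ofReal (F z) with hFe
  set S : Set (Vel × ℝ) := {z | Real.exp (n / 8) < F z} with hS
  have mA : Measurable Ae := (measurable_trunc m q n hF).ennreal_ofReal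
  have mG : Measurable Ge := ((measurable_lowCut m q n).max hF).ennreal_ofReal
  have mH : Measurable He := (measurable_excess n hF).ennreal_ofReal
  have mC : Measurable Ce := (measurable_lowCut m q n).ennreal_ofReal
  have mF : Measurable Fe := hF.ennreal_ofReal
  have mS : MeasurableSet S := measurableSet_lt measurable_const hF
  have mS1 : Measurable (S.indicator (1 : Vel × ℝ → ℝ≥0∞)) := measurable_one.indicator mS
  -- the coefficients of `5 / 8 * n`, `2 * q` and `(3 + 4 * q) * n` in the pointwise inequality
  set W : (Vel × ℝ) × (Vel × ℝ) → ℝ≥0∞ := fun p => He p.1 * Ge p.2 + Ae p.1 * He p.2 with hW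
  set V : (Vel × ℝ) × (Vel × ℝ) → ℝ≥0∞ := fun p =>
    He p.1 * Ge p.2 * ENNReal.ofReal √(kin m p.2) +
    Ae p.1 * He p.2 * ENNReal.ofReal √(kin m p.1) with hV
  set Z : (Vel × ℝ) × (Vel × ℝ) → ℝ≥0∞ := fun p =>
    Ce p.1 * Ge p.2 * ENNReal.ofReal √(pairKin m p) +
    Fe p.1 * Ce p.2 * ENNReal.ofReal √(pairKin m p) with hZ
  have mW : Measurable W := by fun_prop
  have mV : Measurable V := by fun_prop
  have mZ : Measurable Z := by fun_prop
  -- moments of the pieces of the density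
  set GS := ∫⁻ z, Ge z * ENNReal.ofReal (kin m z ^ (ζ / 2 + 1 / 2)) ∂gasMeasure α with hGS
  set CS := ∫⁻ z, Ce z * ENNReal.ofReal (kin m z ^ (ζ / 2 + 1 / 2)) ∂gasMeasure α with hCS
  have hGSle : GS ≤ Y + Q := lintegral_max_lowCut_le hm hζ2 q hn0 hf.measurable
  have hCSle : CS ≤ ENNReal.ofReal (Real.exp (-n / 8)) * Q := lintegral_lowCut_le hm hζ2 q n
  have hxs : ∀ᵐ z ∂gasMeasure α, 1 ≤ ENNReal.ofReal (kin m z ^ (ζ / 2 + 1 / 2)) :=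
    (ae_gasMeasure_pos α).mono fun z hz => by
      rw [ENNReal.one_le_ofReal]
      exact Real.one_le_rpow (one_le_kin hm hz) (by positivity)
  have hAG : ∀ z, Ae z ≤ Ge z := fun z =>
    ENNReal.ofReal_le_ofReal (max_le_max le_rfl (min_le_left _ _))
  have iG : ∫⁻ z, Ge z ∂gasMeasure α ≤ GS :=
    lintegral_mono_ae (hxs.mono fun z hz => le_mul_of_one_le_right' hz)
  have iA : ∫⁻ z, Ae z ∂gasMeasure α ≤ GS := (lintegral_mono hAG).trans iG
  have iAs : ∫⁻ z, Ae z * ENNReal.ofReal (kin m z ^ (ζ / 2 + 1 / 2)) ∂gasMeasure α ≤ GS :=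
    lintegral_mono fun z => mul_le_mul_left (hAG z) _
  have iH : ∫⁻ z, He z ∂gasMeasure α ≤ HX := by
    refine lintegral_mono_ae ((ae_gasMeasure_pos α).mono fun z hz => ?_)
    exact le_mul_of_one_le_right' (ENNReal.one_le_ofReal.2 (one_le_kin hm hz))
  have hGSf : GS ≠ ∞ := ne_top_of_le_ne_top (by finiteness) hGSle
  -- the integrals that occur
  have wW : ∫⁻ p, W p ∂((gasMeasure α).prod (gasMeasure α)) ≤ 2 * (HX * GS) := by
    rw [hW, lintegral_add_left (by fun_prop), lintegral_pair_mul mH mG, lintegral_pair_mul mA mH]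
    calc _ ≤ HX * GS + GS * HX := by gcongr
      _ = _ := by ring
  have vV : ∫⁻ y : Coll, V y.1 ∂collMeasure m α b B ≤ C1 * (4 * (HX * GS)) := by
    refine (h1 V mV).trans ?_
    gcongr
    simp only [hV, add_mul]
    rw [lintegral_add_left (by fun_prop)]
    calc _ ≤ 2 * (HX * GS) + 2 * (GS * HX) := by
          refine add_le_add (lintegral_pair_sqrt_snd_le hm hζ hζ2 mH mG)
            ((lintegral_pair_sqrt_fst_le hm hζ hζ2 mA mH).trans ?_)
          gcongr
          exact le_rfl
      _ = _ := by ring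
  have zZ : ∫⁻ y : Coll, Z y.1 ∂collMeasure m α b B ≤ C1 * (4 * (CS * GS + Y * CS)) := by
    refine (h1 Z mZ).trans ?_
    gcongr
    simp only [hZ, add_mul]
    rw [lintegral_add_left (by fun_prop), mul_add]
    exact add_le_add (lintegral_pair_sqrt_le hm hζ hζ2 mC mG)
      (lintegral_pair_sqrt_le hm hζ hζ2 mF mC)
  have aA : ∫⁻ y : Coll, Ae y.1.1 * Ae y.1.2 ∂collMeasure m α b B ≤ C1 * (4 * (GS * GS)) := by
    refine (h1 (fun p => Ae p.1 * Ae p.2) (by fun_prop)).trans ?_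
    gcongr
    refine (lintegral_pair_le hm hζ hζ2 mA mA).trans ?_
    gcongr
  have aA' : ∫⁻ y : Coll, Ae y.2.1 * Ae y.2.2 ∂collMeasure m α b B =
      ∫⁻ y : Coll, Ae y.1.1 * Ae y.1.2 ∂collMeasure m α b B :=
    hK.lintegral_collMeasure_swap hm (G := fun y => Ae y.1.1 * Ae y.1.2) (by fun_prop)
  have wWf : ∫⁻ y : Coll, W y.1 ∂collMeasure m α b B ≠ ∞ := by
    have : ∫⁻ y : Coll, W y.1 ∂collMeasure m α b B ≤ ∫⁻ y : Coll, V y.1 ∂collMeasure m α b B := by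
      refine lintegral_mono_ae ((ae_collMeasure_pos hK hm).mono fun y hy => ?_)
      refine add_le_add (le_mul_of_one_le_right' ?_) (le_mul_of_one_le_right' ?_)
      · exact ENNReal.one_le_ofReal.2 (Real.one_le_sqrt.2 (one_le_kin hm hy.1.2))
      · exact ENNReal.one_le_ofReal.2 (Real.one_le_sqrt.2 (one_le_kin hm hy.1.1))
    refine ne_top_of_le_ne_top ?_ (this.trans vV)
    finiteness
  have hes := hesc n ((le_max_left _ _).trans hn) S mS
    ((gasMeasure_large_le hm hf.measurable n).trans (by gcongr)) W mW
  -- the weak form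
  set ψ : Vel × ℝ → ℝ := fun z => Real.log (trunc q n (kin m z) (F z)) with hψ
  obtain ⟨hint, heq⟩ := weak_form_symm hK hm hf.measurable hf.nonneg hf.gain_finite hf.loss_finite
    (ψ := ψ) (measurable_trunc m q n hF).log (C := n + q) fun z hz =>
      abs_log_trunc_le hq hn0 (one_le_kin hm hz) _
  rw [heq]
  set K := K0 * (2 * (HX * GS)) + (ENNReal.ofReal (2 * q) * (C1 * (4 * (HX * GS))) +
    ENNReal.ofReal ((3 + 4 * q) * n) * (C1 * (4 * (CS * GS + Y * CS)))) with hKdef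
  have hCSf : CS ≠ ∞ := ne_top_of_le_ne_top (by finiteness) hCSle
  have hKf : K ≠ ∞ := by finiteness
  have main := integral_le_toReal_of_lintegral_le (P := collMeasure m α b B)
    (A := fun y : Coll => Ae y.1.1 * Ae y.1.2 + ENNReal.ofReal (5 / 8 * n) * W y.1)
    (D := fun y : Coll => Ae y.2.1 * Ae y.2.2 +
      ENNReal.ofReal n * (W y.1 * (S.indicator 1 y.2.1 + S.indicator 1 y.2.2)) +
      ENNReal.ofReal (2 * q) * V y.1 + ENNReal.ofReal ((3 + 4 * q) * n) * Z y.1) (K := K)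
    hint (by fun_prop) ?_ ?_ hKf ?_
  · refine main.trans (ENNReal.toReal_mono ?_ ?_)
    · finiteness
    have g1 : GS ≤ (1 + Q) * (1 + Y) := hGSle.trans (by
      calc Y + Q ≤ Y + Q + (1 + Q * Y) := le_self_add
        _ = _ := by ring)
    have g2 : CS * GS + Y * CS ≤ ENNReal.ofReal (Real.exp (-n / 8)) * Q * ((2 + Q) * (1 + Y)) := by
      calc CS * GS + Y * CS = CS * (GS + Y) := by ring
        _ ≤ ENNReal.ofReal (Real.exp (-n / 8)) * Q * ((Y + Q) + Y) := by gcongr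
        _ ≤ _ := by
            gcongr
            calc Y + Q + Y ≤ Y + Q + Y + (2 + Q * Y) := le_self_add
              _ = _ := by ring
    calc K ≤ K0 * (2 * (HX * ((1 + Q) * (1 + Y)))) +
          (ENNReal.ofReal (2 * q) * (C1 * (4 * (HX * ((1 + Q) * (1 + Y))))) +
          ENNReal.ofReal ((3 + 4 * q) * n) * (C1 * (4 *
            (ENNReal.ofReal (Real.exp (-n / 8)) * Q * ((2 + Q) * (1 + Y)))))) := by
          rw [hKdef]; gcongr
      _ = ((2 * K0 + ENNReal.ofReal (2 * q) * C1 * 4) * (1 + Q) * HX +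
          ENNReal.ofReal (3 + 4 * q) * C1 * 4 * Q * (2 + Q) *
            ENNReal.ofReal (n * Real.exp (-n / 8))) * (1 + Y) := by
          rw [ENNReal.ofReal_mul (p := 3 + 4 * q) (by positivity), ENNReal.ofReal_mul (p := n) hn0]
          ring
      _ ≤ _ := by
          refine mul_le_mul_left ?_ _
          exact add_mul_le_add_mul_add _ _ _ _
  · refine ((ae_collMeasure_pos hK hm).and (ae_pairKin hm)).mono fun y hy => ?_
    obtain ⟨⟨⟨p1, p2⟩, p3, p4⟩, hE⟩ := hy
    have x1 := one_le_kin hm p1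
    have x2 := one_le_kin hm p2
    have x3 := one_le_kin hm p3
    have x4 := one_le_kin hm p4
    have f1 : 0 ≤ F y.1.1 := gasDensity_nonneg α f p1
    have f2 : 0 ≤ F y.1.2 := gasDensity_nonneg α f p2
    have key := entropy_production_pointwise hq hn1 f1 f2 x1 x2 x3 x4 hE
      (F₁ := F y.1.1) (F₂ := F y.1.2) (F₃ := F y.2.1) (F₄ := F y.2.2)
    have a1 := (trunc_pos q n x1 (F y.1.1)).le
    have a2 := (trunc_pos q n x2 (F y.1.2)).le
    have a3 := (trunc_pos q n x3 (F y.2.1)).le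
    have a4 := (trunc_pos q n x4 (F y.2.2)).le
    have c1 := (lowCut_pos q n x1).le
    have c2 := (lowCut_pos q n x2).le
    have g2 : 0 ≤ max (lowCut q n (kin m y.1.2)) (F y.1.2) := c2.trans (le_max_left _ _)
    have e1 : 0 ≤ excess n (F y.1.1) := le_max_right _ _
    have e2 : 0 ≤ excess n (F y.1.2) := le_max_right _ _
    have i3 := isLarge_nonneg n (F y.2.1)
    have i4 := isLarge_nonneg n (F y.2.2)
    have hind : ∀ z, S.indicator (1 : Vel × ℝ → ℝ≥0∞) z = ENNReal.ofReal (isLarge n (F z)) := by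
      intro z
      by_cases hz : z ∈ S
      · rw [indicator_of_mem hz, isLarge, if_pos (show Real.exp (n / 8) < F z from hz)]; simp
      · rw [indicator_of_notMem hz, isLarge, if_neg (show ¬Real.exp (n / 8) < F z from hz)]; simp
    have k := ofReal_production_le hn0 (k₁ := 5 / 8 * n) (by positivity) (k₂ := 2 * q)
      (by positivity) (k₃ := (3 + 4 * q) * n) (by positivity) a1 a2 a3 a4 e1 e2 g2 c1 c2 f1 i3 i4
      (Real.sqrt_nonneg _) (Real.sqrt_nonneg _) (Real.sqrt_nonneg _) key
    simp only [hind]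
    exact k
  · rw [lintegral_add_left (by fun_prop), lintegral_const_mul _ (by fun_prop)]
    have : ∫⁻ y : Coll, Ae y.1.1 * Ae y.1.2 ∂collMeasure m α b B ≠ ∞ :=
      ne_top_of_le_ne_top (by finiteness) aA
    finiteness
  · rw [lintegral_add_left (by fun_prop), lintegral_add_left (by fun_prop),
      lintegral_add_left (by fun_prop), lintegral_add_left (by fun_prop),
      lintegral_const_mul _ (by fun_prop), lintegral_const_mul _ (by fun_prop),
      lintegral_const_mul _ (by fun_prop), lintegral_const_mul _ (by fun_prop), aA']
    calc _ ≤ ∫⁻ y : Coll, Ae y.1.1 * Ae y.1.2 ∂collMeasure m α b B +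
          (ENNReal.ofReal (5 / 8 * n) * ∫⁻ y : Coll, W y.1 ∂collMeasure m α b B +
          K0 * (2 * (HX * GS))) + ENNReal.ofReal (2 * q) * (C1 * (4 * (HX * GS))) +
          ENNReal.ofReal ((3 + 4 * q) * n) * (C1 * (4 * (CS * GS + Y * CS))) := by
          gcongr
          exact hes.trans (by gcongr)
      _ = _ := by rw [hKdef]; ring

end

/-! ### The truncated entropy -/

section
variable {m α q n : ℝ}

theorem smul_gasDensity_ae (α : ℝ) {f : Vel × ℝ → ℝ} (hf0 : ∀ᵐ z ∂stateMeasure, 0 ≤ f z)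
    (ψ : Vel × ℝ → ℝ) : (fun z => (ENNReal.ofReal (z.2 ^ α)).toReal • (ψ z * gasDensity α f z))
      =ᵐ[stateMeasure] fun z => ψ z * f z := by
  filter_upwards [hf0, ae_stateMeasure_pos] with z h0 hz
  rw [ENNReal.toReal_ofReal (by positivity), smul_eq_mul, gasDensity, max_eq_left h0,
    Real.rpow_neg hz.le]
  have : z.2 ^ α ≠ 0 := by positivity
  field_simp

theorem integral_gasDensity (α : ℝ) {f : Vel × ℝ → ℝ} (hf0 : ∀ᵐ z ∂stateMeasure, 0 ≤ f z)
    (ψ : Vel × ℝ → ℝ) :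
    ∫ z, ψ z * gasDensity α f z ∂gasMeasure α = ∫ z, ψ z * f z ∂stateMeasure := by
  unfold gasMeasure
  rw [integral_withDensity_eq_integral_toReal_smul (by fun_prop) (by simp)]
  exact integral_congr_ae (smul_gasDensity_ae α hf0 ψ)

theorem integrable_gasDensity (α : ℝ) {f : Vel × ℝ → ℝ} (hf0 : ∀ᵐ z ∂stateMeasure, 0 ≤ f z)
    {ψ : Vel × ℝ → ℝ} (h : Integrable (fun z => ψ z * f z) stateMeasure) :
    Integrable (fun z => ψ z * gasDensity α f z) (gasMeasure α) := by
  unfold gasMeasure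
  rw [integrable_withDensity_iff_integrable_smul' (by fun_prop) (by simp)]
  exact h.congr (smul_gasDensity_ae α hf0 ψ).symm

/-- The integrand `y log a - a` of the truncated entropy, where `a` is the truncation of `y`. As
a function of `y` it is convex with derivative `log a`. -/
noncomputable def entropyFun (q n x y : ℝ) : ℝ :=
  y * Real.log (trunc q n x y) - trunc q n x y

/-- Convexity of `entropyFun`, as an inequality for the tangent at `y₂`. -/
theorem entropyFun_sub_le {x : ℝ} (hq : 0 ≤ q) (hn : 0 ≤ n) (hx : 1 ≤ x) (y₁ y₂ : ℝ) :
    entropyFun q n x y₂ - entropyFun q n x y₁ ≤ Real.log (trunc q n x y₂) * (y₂ - y₁) := by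
  have p1 := trunc_pos q n hx y₁
  have p2 := trunc_pos q n hx y₂
  have hc := lowCut_le_one hq hn hx
  have hN := Real.one_le_exp hn
  have h1 : trunc q n x y₁ * (Real.log (trunc q n x y₂) - Real.log (trunc q n x y₁)) ≤
      trunc q n x y₂ - trunc q n x y₁ := by
    rw [← Real.log_div p2.ne' p1.ne']
    calc _ ≤ trunc q n x y₁ * (trunc q n x y₂ / trunc q n x y₁ - 1) :=
          mul_le_mul_of_nonneg_left (Real.log_le_sub_one_of_pos (div_pos p2 p1)) p1.le
      _ = _ := by field_simp
  -- where the truncation acts on `y₁`, it returns the least or the greatest possible value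
  have h2 : (y₁ - trunc q n x y₁) *
      (Real.log (trunc q n x y₂) - Real.log (trunc q n x y₁)) ≤ 0 := by
    rcases lt_trichotomy y₁ (trunc q n x y₁) with h | h | h
    · have e : trunc q n x y₁ = lowCut q n x := by
        unfold trunc at h ⊢
        refine max_eq_left ?_
        by_contra hcon
        rw [not_le] at hcon
        rw [max_eq_right hcon.le] at h
        have : min y₁ (Real.exp n) = Real.exp n := min_eq_right
          (by by_contra h3; rw [min_eq_left (le_of_not_ge h3)] at h; exact lt_irrefl _ h)
        have := min_le_left y₁ (Real.exp n)
        linarith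
      have := Real.log_le_log (lowCut_pos q n hx) (le_max_left (lowCut q n x) (min y₂ (Real.exp n)))
      refine mul_nonpos_of_nonpos_of_nonneg (by linarith) ?_
      rw [e, sub_nonneg]
      exact this
    · rw [← h, sub_self, zero_mul]
    · have e : trunc q n x y₁ = Real.exp n := by
        have h3 : min y₁ (Real.exp n) < y₁ := lt_of_le_of_lt (le_max_right _ _) h
        have h4 : min y₁ (Real.exp n) = Real.exp n :=
          min_eq_right (by by_contra h5; rw [min_eq_left (le_of_not_ge h5)] at h3
                           exact lt_irrefl _ h3)
        rw [trunc, h4, max_eq_right (by linarith)]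
      refine mul_nonpos_of_nonneg_of_nonpos (by linarith) ?_
      rw [e, Real.log_exp, sub_nonpos]
      exact log_trunc_le hq hn hx y₂
  unfold entropyFun
  nlinarith

/-- The truncated entropy of a state, at the truncation level `n`. -/
noncomputable def truncEntropy (m α q n : ℝ) (f : Vel × ℝ → ℝ) : ℝ :=
  ∫ z, entropyFun q n (kin m z) (gasDensity α f z) ∂gasMeasure α

theorem integrable_lowCut (hm : 0 < m)
    (hQ : ∫⁻ z, ENNReal.ofReal (kin m z ^ (-q)) ∂gasMeasure α ≠ ∞) :
    Integrable (fun z => lowCut q n (kin m z)) (gasMeasure α) := by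
  refine Integrable.const_mul ⟨((measurable_kin m).pow_const _).aestronglyMeasurable, ?_⟩ _
  rw [hasFiniteIntegral_iff_ofReal]
  · exact lt_top_iff_ne_top.2 hQ
  · filter_upwards [ae_gasMeasure_pos α] with z hz
    have := one_le_kin hm hz
    positivity

theorem trunc_le {x y : ℝ} (hx : 1 ≤ x) (hy : 0 ≤ y) : trunc q n x y ≤ lowCut q n x + y :=
  max_le (by linarith) ((min_le_left _ _).trans (by linarith [lowCut_pos q n hx]))

theorem integrable_log_trunc_mul (hm : 0 < m) (hq : 0 ≤ q) (hn : 0 ≤ n) {h : Vel × ℝ → ℝ}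
    (hh : Measurable h) (f : L12 m) :
    Integrable (fun z => Real.log (trunc q n (kin m z) (h z)) * f z) stateMeasure :=
  integrable_weight_mul hm (measurable_trunc m q n hh).log (C := n + q)
    (fun _ hz => abs_log_trunc_le hq hn (one_le_kin hm hz) _) f

theorem integrable_one_mul (hm : 0 < m) (f : L12 m) :
    Integrable (fun z => 1 * f z) stateMeasure :=
  integrable_weight_mul hm (ψ := fun _ => 1) measurable_const (C := 1)
    (fun z hz => by simpa using one_le_kin hm hz) f

theorem integrable_entropyFun (hm : 0 < m) (hq : 0 ≤ q) (hn : 0 ≤ n)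
    (hQ : ∫⁻ z, ENNReal.ofReal (kin m z ^ (-q)) ∂gasMeasure α ≠ ∞) (f : L12 m)
    (hf0 : ∀ᵐ z ∂stateMeasure, 0 ≤ f z) :
    Integrable (fun z => entropyFun q n (kin m z) (gasDensity α f z)) (gasMeasure α) := by
  have hF := measurable_gasDensity α (measurable_coe_L12 f)
  have h1 := integrable_gasDensity α hf0 (integrable_log_trunc_mul hm hq hn hF f)
  have h2 := integrable_gasDensity α hf0 (integrable_one_mul hm f)
  have h3 : Integrable (fun z => trunc q n (kin m z) (gasDensity α f z)) (gasMeasure α) := by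
    refine ((integrable_lowCut (n := n) hm hQ).add h2).mono'
      (measurable_trunc m q n hF).aestronglyMeasurable ?_
    filter_upwards [ae_gasMeasure_pos α] with z hz
    have hx := one_le_kin hm hz
    rw [Real.norm_eq_abs, abs_of_pos (trunc_pos q n hx _), Pi.add_apply, one_mul]
    exact trunc_le hx (gasDensity_nonneg α f hz)
  refine (h1.sub h3).congr (Filter.Eventually.of_forall fun z => ?_)
  simp only [Pi.sub_apply, entropyFun]
  ring

/-- Tangent inequality for the truncated entropy. It bounds the left difference quotients in
time by the entropy production, with no differentiability of the truncated entropy. -/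
theorem truncEntropy_sub_le (hm : 0 < m) (hq : 0 ≤ q) (hn : 0 ≤ n)
    (hQ : ∫⁻ z, ENNReal.ofReal (kin m z ^ (-q)) ∂gasMeasure α ≠ ∞) (f g : L12 m)
    (hf0 : ∀ᵐ z ∂stateMeasure, 0 ≤ f z) (hg0 : ∀ᵐ z ∂stateMeasure, 0 ≤ g z) :
    truncEntropy m α q n g - truncEntropy m α q n f ≤
      ∫ z, Real.log (trunc q n (kin m z) (gasDensity α g z)) * g z ∂stateMeasure -
      ∫ z, Real.log (trunc q n (kin m z) (gasDensity α g z)) * f z ∂stateMeasure := by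
  have hG := measurable_gasDensity α (measurable_coe_L12 g)
  have i1 := integrable_entropyFun hm hq hn hQ f hf0
  have i2 := integrable_entropyFun hm hq hn hQ g hg0
  have j1 := integrable_gasDensity α hf0 (integrable_log_trunc_mul hm hq hn hG f)
  have j2 := integrable_gasDensity α hg0 (integrable_log_trunc_mul hm hq hn hG g)
  unfold truncEntropy
  rw [← integral_gasDensity α hf0, ← integral_gasDensity α hg0, ← integral_sub i2 i1,
    ← integral_sub j2 j1]
  refine integral_mono_ae (i2.sub i1) (j2.sub j1) ?_
  filter_upwards [ae_gasMeasure_pos α] with z hz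
  simp only [← mul_sub]
  exact entropyFun_sub_le hq hn (one_le_kin hm hz) _ _

theorem truncEntropy_lipschitz (hm : 0 < m) (hq : 0 ≤ q) (hn : 0 ≤ n)
    (hQ : ∫⁻ z, ENNReal.ofReal (kin m z ^ (-q)) ∂gasMeasure α ≠ ∞) (f g : L12 m)
    (hf0 : ∀ᵐ z ∂stateMeasure, 0 ≤ f z) (hg0 : ∀ᵐ z ∂stateMeasure, 0 ≤ g z) :
    truncEntropy m α q n g - truncEntropy m α q n f ≤ (n + q) * ‖g - f‖ := by
  have hG := measurable_gasDensity α (measurable_coe_L12 g)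
  refine (truncEntropy_sub_le hm hq hn hQ f g hf0 hg0).trans ?_
  have j1 := integrable_log_trunc_mul hm hq hn hG f
  have j2 := integrable_log_trunc_mul hm hq hn hG g
  rw [← integral_sub j2 j1, norm_L12 hm, ← integral_const_mul]
  have i3 : Integrable (fun z => (n + q) * (kin m z * |(g - f : L12 m) z|)) stateMeasure :=
    (integrable_kin_mul_abs hm (g - f)).const_mul _
  refine integral_mono_ae (j2.sub j1) i3 ?_
  filter_upwards [ae_stateMeasure_pos, ae_stateMeasure_of_energyMeasure hm (Lp.coeFn_sub g f)]
    with z hz hz2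
  simp only [← mul_sub]
  rw [hz2, Pi.sub_apply, ← mul_assoc]
  refine (le_abs_self _).trans ?_
  rw [abs_mul]
  exact mul_le_mul_of_nonneg_right (abs_log_trunc_le hq hn (one_le_kin hm hz) _) (abs_nonneg _)

end

/-- A continuous function whose left difference quotients are nonpositive in the limit does not
increase. -/
theorem le_of_left_slope_nonpos {g : ℝ → ℝ} {T : ℝ} (hT : 0 ≤ T) (hg : ContinuousOn g (Icc 0 T))
    (h : ∀ t ∈ Ioc 0 T, ∀ r > 0, ∀ᶠ s in nhdsWithin t (Iio t), g t - g s ≤ r * (t - s)) :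
    g T ≤ g 0 := by
  have hk : ContinuousOn (fun τ => -g (T - τ)) (Icc 0 T) :=
    (hg.comp (by fun_prop) fun τ hτ => ⟨by linarith [hτ.2], by linarith [hτ.1]⟩).neg
  have := image_le_of_liminf_slope_right_le_deriv_boundary (f := fun τ => -g (T - τ)) (a := 0)
    (b := T) (B := fun _ => -g T) (B' := fun _ => 0) hk (by simp) continuousOn_const
    (fun x _ => hasDerivWithinAt_const _ _ _) ?_ (x := T) ⟨hT, le_rfl⟩
  · simpa using this
  intro τ hτ r hr
  have h1 := h (T - τ) ⟨by linarith [hτ.2], by linarith [hτ.1]⟩ (r / 2) (half_pos hr)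
  have h2 : Filter.Tendsto (fun z => T - z) (nhdsWithin τ (Ioi τ))
      (nhdsWithin (T - τ) (Iio (T - τ))) := by
    refine tendsto_nhdsWithin_iff.2 ⟨?_, ?_⟩
    · exact ((continuous_const.sub continuous_id).tendsto τ).mono_left nhdsWithin_le_nhds
    · filter_upwards [self_mem_nhdsWithin] with z hz
      exact sub_lt_sub_left hz T
  refine Filter.Eventually.frequently ?_
  filter_upwards [h2.eventually h1, self_mem_nhdsWithin] with z hz hz0
  have hz0' : 0 < z - τ := sub_pos.2 hz0
  rw [slope_def_field, div_lt_iff₀ hz0']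
  nlinarith

/-! ### Growth of the truncated entropy along a solution -/

section
variable {m α q n : ℝ}

theorem lintegral_abs_kin (hm : 0 < m) (f : L12 m) :
    ∫⁻ z, ENNReal.ofReal |f z| * ENNReal.ofReal (kin m z) ∂stateMeasure = ENNReal.ofReal ‖f‖ := by
  have hi := integrable_kin_mul_abs hm f
  rw [norm_L12 hm, ofReal_integral_eq_lintegral_ofReal hi]
  · refine lintegral_congr fun z => ?_
    rw [ENNReal.ofReal_mul' (abs_nonneg _), mul_comm]
  · filter_upwards [ae_stateMeasure_pos] with z hz
    exact mul_nonneg (zero_le_one.trans (one_le_kin hm hz)) (abs_nonneg _)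

theorem energy_le (hm : 0 < m) (f : L12 m) : energy m α f ≤ ENNReal.ofReal ‖f‖ := by
  unfold energy
  rw [lintegral_gasDensity α (measurable_coe_L12 f) _ (by fun_prop), ← lintegral_abs_kin hm]
  gcongr
  exact le_abs_self _

theorem mass_eq (hm : 0 < m) (f : L12 m) (hf0 : ∀ᵐ z ∂stateMeasure, 0 ≤ f z) :
    mass α f = ENNReal.ofReal (∫ z, f z ∂stateMeasure) := by
  have h1 := lintegral_gasDensity α (measurable_coe_L12 f) (fun _ => 1) measurable_const
  have h2 := integrable_one_mul hm f
  simp only [mul_one] at h1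
  simp only [one_mul] at h2
  rw [mass, h1, ofReal_integral_eq_lintegral_ofReal h2 hf0]

theorem excess_le_add (n y₁ y₂ : ℝ) : excess n y₁ ≤ excess n y₂ + |y₁ - y₂| := by
  unfold excess
  refine max_le ?_ (add_nonneg (le_max_right _ _) (abs_nonneg _))
  linarith [le_abs_self (y₁ - y₂), le_max_left (y₂ - Real.exp n) 0]

theorem abs_gasDensity_sub_le (f g : Vel × ℝ → ℝ) {z : Vel × ℝ} (hz : 0 < z.2) :
    |gasDensity α f z - gasDensity α g z| ≤ gasDensity α (fun z => |f z - g z|) z := by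
  unfold gasDensity
  rw [← sub_mul, abs_mul, abs_of_nonneg (Real.rpow_nonneg hz.le _),
    max_eq_left (abs_nonneg (f z - g z))]
  refine mul_le_mul_of_nonneg_right ?_ (Real.rpow_nonneg hz.le _)
  exact abs_max_sub_max_le_abs _ _ _

theorem excessEnergy_le_add (hm : 0 < m) (n : ℝ) (f g : L12 m) :
    excessEnergy m α n f ≤ excessEnergy m α n g + ENNReal.ofReal ‖f - g‖ := by
  have hF := measurable_gasDensity α (measurable_coe_L12 g)
  have hg := measurable_coe_L12 (f - g)
  have hE := measurable_excess n hF
  have e : ENNReal.ofReal ‖f - g‖ = ∫⁻ z, ENNReal.ofReal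
      (gasDensity α (fun z => |(f - g : L12 m) z|) z) * ENNReal.ofReal (kin m z) ∂gasMeasure α := by
    rw [lintegral_gasDensity α (by fun_prop) _ (by fun_prop), lintegral_abs_kin hm]
  unfold excessEnergy
  rw [e, ← lintegral_add_left (by fun_prop)]
  refine lintegral_mono_ae ?_
  filter_upwards [ae_gasMeasure_pos α,
    ae_gasMeasure_of_ae α (ae_stateMeasure_of_energyMeasure hm (Lp.coeFn_sub f g))] with z hz hz2
  rw [← add_mul]
  gcongr
  have h0 : 0 ≤ gasDensity α (fun z => |(f - g : L12 m) z|) z := gasDensity_nonneg α _ hz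
  have h1 : 0 ≤ excess n (gasDensity α g z) := le_max_right _ _
  rw [← ENNReal.ofReal_add h1 h0]
  refine ENNReal.ofReal_le_ofReal ((excess_le_add n _ (gasDensity α g z)).trans ?_)
  gcongr
  refine (abs_gasDensity_sub_le f g hz).trans (le_of_eq ?_)
  simp only [gasDensity, hz2, Pi.sub_apply]

theorem excessEnergy_anti (m α : ℝ) (f : Vel × ℝ → ℝ) {n n' : ℝ} (h : n ≤ n') :
    excessEnergy m α n' f ≤ excessEnergy m α n f := by
  unfold excessEnergy excess
  gcongr

theorem excessEnergy_le_energy (f : Vel × ℝ → ℝ) : excessEnergy m α n f ≤ energy m α f := by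
  refine lintegral_mono fun z => mul_le_mul_left ?_ _
  rw [excess, ENNReal.ofReal_max, ENNReal.ofReal_zero]
  exact max_le (ENNReal.ofReal_le_ofReal (by linarith [Real.exp_pos n])) zero_le

theorem tendsto_excessEnergy (hm : 0 < m) (f : L12 m) :
    Filter.Tendsto (fun n => excessEnergy m α n f) Filter.atTop (nhds 0) := by
  have hF := measurable_gasDensity α (measurable_coe_L12 f)
  rw [← lintegral_zero (μ := gasMeasure α)]
  refine tendsto_lintegral_filter_of_dominated_convergence
    (fun z => ENNReal.ofReal (gasDensity α f z) * ENNReal.ofReal (kin m z))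
    (Filter.Eventually.of_forall fun n => ?_) (Filter.Eventually.of_forall fun n => ?_)
    (ne_top_of_le_ne_top ENNReal.ofReal_ne_top (energy_le hm f))
    (Filter.Eventually.of_forall fun z => ?_)
  · exact (measurable_excess n hF).ennreal_ofReal.mul (by fun_prop)
  · refine Filter.Eventually.of_forall fun z => mul_le_mul_left ?_ _
    rw [excess, ENNReal.ofReal_max, ENNReal.ofReal_zero]
    exact max_le (ENNReal.ofReal_le_ofReal (by linarith [Real.exp_pos n])) zero_le
  · refine tendsto_const_nhds.congr' ?_
    filter_upwards [Real.tendsto_exp_atTop.eventually_ge_atTop (gasDensity α f z)] with n hn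
    rw [excess, max_eq_right (sub_nonpos.2 hn), ENNReal.ofReal_zero, zero_mul]

/-- Along a continuous curve the excess energy is uniformly small on compact time intervals, as
a monotone limit of functionals that are Lipschitz with constant one. -/
theorem exists_excessEnergy_le (hm : 0 < m) {f : ℝ → L12 m} {s : Set ℝ} (hs : IsCompact s)
    (hf : ContinuousOn f s) {ε : ℝ≥0∞} (hε : ε ≠ 0) :
    ∃ n₀ : ℝ, ∀ n ≥ n₀, ∀ t ∈ s, excessEnergy m α n (f t) ≤ ε := by
  refine hs.induction_on (p := fun u => ∃ n₀ : ℝ, ∀ n ≥ n₀, ∀ t ∈ u, excessEnergy m α n (f t) ≤ ε)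
    ⟨0, by simp⟩ ?_ ?_ ?_
  · rintro u v huv ⟨n₀, h⟩
    exact ⟨n₀, fun n hn t ht => h n hn t (huv ht)⟩
  · rintro u v ⟨n₀, h⟩ ⟨n₁, h'⟩
    refine ⟨max n₀ n₁, fun n hn t ht => ht.elim (h n ((le_max_left _ _).trans hn) t)
      (h' n ((le_max_right _ _).trans hn) t)⟩
  · intro t ht
    have hε2 : 0 < ε / 2 := ENNReal.half_pos hε
    obtain ⟨n₀, hn₀⟩ := ((tendsto_excessEnergy (α := α) hm (f t)).eventually_le_const
      hε2).exists
    have hc : Filter.Tendsto (fun r => ENNReal.ofReal ‖f r - f t‖) (nhdsWithin t s) (nhds 0) := by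
      have h1 := ((hf t ht).sub_const (f t)).norm
      have h2 := ENNReal.tendsto_ofReal h1
      simpa using h2
    have hev : ∀ᶠ r in nhdsWithin t s, ENNReal.ofReal ‖f r - f t‖ ≤ ε / 2 :=
      hc.eventually_le_const hε2
    refine ⟨{r | ENNReal.ofReal ‖f r - f t‖ ≤ ε / 2}, hev, n₀, fun n hn r hr => ?_⟩
    calc excessEnergy m α n (f r) ≤ excessEnergy m α n₀ (f r) := excessEnergy_anti _ _ _ hn
      _ ≤ excessEnergy m α n₀ (f t) + ENNReal.ofReal ‖f r - f t‖ := excessEnergy_le_add hm _ _ _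
      _ ≤ ε / 2 + ε / 2 := add_le_add hn₀ hr
      _ = ε := ENNReal.add_halves ε

end

section
variable {m α ζ : ℝ} {b : ℝ → ℝ} {B : Vel → Vel → ℝ → ℝ → ℝ → ℝ → ℝ} {blb bub : ℝ → ℝ → ℝ}

theorem HasDerivAt.eventually_sub_le {φ : ℝ → ℝ} {d t r : ℝ} (h : HasDerivAt φ d t) (hd : d ≤ 0)
    (hr : 0 < r) : ∀ᶠ s in nhdsWithin t (Iio t), φ t - φ s ≤ r * (t - s) := by
  have h1 := (hasDerivAt_iff_tendsto_slope.1 h).mono_left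
    (nhdsWithin_mono t fun s (hs : s ∈ Iio t) => ne_of_lt hs)
  filter_upwards [(tendsto_order.1 h1).2 r (by linarith), self_mem_nhdsWithin] with s hs hst
  rw [slope_comm, slope_def_field, div_lt_iff₀ (sub_pos.2 hst)] at hs
  exact hs.le

/-- A bound on the entropy production by the production of the square root of the energy controls
the growth of the truncated entropy, because the total square root of the energy is bounded. -/
theorem IsSolution.truncEntropy_le (hK : IsHardKernel m α ζ b B blb bub) (hm : 0 < m)
    {f : ℝ → L12 m} (hf : IsSolution m α b B f) {q n : ℝ} (hq : 0 ≤ q) (hn : 0 ≤ n)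
    (hQ : ∫⁻ z, ENNReal.ofReal (kin m z ^ (-q)) ∂gasMeasure α ≠ ∞) {T γ K : ℝ} (hT : 0 ≤ T)
    (hγ : 0 ≤ γ)
    (h : ∀ t ∈ Ioc 0 T, ∫ z, Real.log (trunc q n (kin m z) (gasDensity α (f t) z)) *
      collOp m α b B (f t) (f t) z ∂stateMeasure ≤
      γ * (∫ z, √(kin m z) * collOp m α b B (f t) (f t) z ∂stateMeasure + K)) :
    truncEntropy m α q n (f T) ≤ truncEntropy m α q n (f 0) + γ * (‖f 0‖ + K * T) := by
  have hsq : ∀ z : Vel × ℝ, 0 < z.2 → √(kin m z) ≤ kin m z := fun z hz => by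
    have := one_le_kin hm hz
    rw [Real.sqrt_le_left (by linarith)]
    nlinarith
  obtain ⟨l, hl⟩ := exists_weight_functional hm (ψ := fun z => √(kin m z)) (by fun_prop) (C := 1)
    fun z hz => by rw [one_mul, abs_of_nonneg (Real.sqrt_nonneg _)]; exact hsq z hz
  have hcont : ContinuousOn f (Icc 0 T) := hf.continuousOn.mono Icc_subset_Ici_self
  have hG : ContinuousOn (fun t => truncEntropy m α q n (f t)) (Icc 0 T) := by
    have hlip : LipschitzOnWith (Real.toNNReal (n + q)) (fun g : L12 m => truncEntropy m α q n g)
        {g : L12 m | ∀ᵐ z ∂stateMeasure, 0 ≤ g z} := by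
      refine LipschitzOnWith.of_dist_le_mul fun g hg k hk => ?_
      rw [Real.dist_eq, dist_eq_norm, Real.coe_toNNReal _ (by linarith), abs_le]
      have h1 := truncEntropy_lipschitz hm hq hn hQ g k hg hk
      have h2 := truncEntropy_lipschitz hm hq hn hQ k g hk hg
      rw [norm_sub_rev] at h1
      constructor <;> linarith
    exact hlip.continuousOn.comp hcont fun t ht => hf.nonneg t ht.1
  have hl2 : ContinuousOn (fun t => l (f t)) (Icc 0 T) :=
    (hf.continuousOn_moment l).mono Icc_subset_Ici_self
  have key := le_of_left_slope_nonpos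
    (g := fun t => truncEntropy m α q n (f t) - γ * (l (f t) + K * t)) hT
    (hG.sub (continuousOn_const.mul (hl2.add (by fun_prop)))) fun t ht r hr => ?_
  · simp only [mul_zero, add_zero] at key
    have e1 : l (f T) ≤ ‖f 0‖ := by
      rw [← (hf.exists_conserved hK hm hT).2, hl, norm_L12 hm]
      have i1 := integrable_weight_mul hm (ψ := fun z => √(kin m z)) (by fun_prop) (C := 1)
        (fun z hz => by rw [one_mul, abs_of_nonneg (Real.sqrt_nonneg _)]; exact hsq z hz) (f T)
      have i2 := integrable_kin_mul_abs hm (f T)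
      refine integral_mono_ae i1 i2 ?_
      filter_upwards [ae_stateMeasure_pos] with z hz
      exact (mul_le_mul_of_nonneg_left (le_abs_self _) (Real.sqrt_nonneg _)).trans
        (mul_le_mul_of_nonneg_right (hsq z hz) (abs_nonneg _))
    have e2 : 0 ≤ l (f 0) := by
      rw [hl]
      refine integral_nonneg_of_ae ((hf.nonneg 0 le_rfl).mono fun z hz => ?_)
      exact mul_nonneg (Real.sqrt_nonneg _) hz
    have e3 := mul_le_mul_of_nonneg_left e1 hγ
    have e4 := mul_nonneg hγ e2
    linarith
  · have hg := measurable_gasDensity α (measurable_coe_L12 (f t))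
    obtain ⟨lt, hlt⟩ := exists_weight_functional hm
      (ψ := fun z => Real.log (trunc q n (kin m z) (gasDensity α (f t) z)))
      (measurable_trunc m q n hg).log (C := n + q)
      fun z hz => abs_log_trunc_le hq hn (one_le_kin hm hz) _
    have hd : HasDerivAt (fun s => lt (f s) - γ * (l (f s) + K * s)) _ t :=
      (hf.hasDerivAt_moment hlt ht.1).sub
        (((hf.hasDerivAt_moment hl ht.1).add ((hasDerivAt_id t).const_mul K)).const_mul γ)
    have hd0 := h t ht
    have hev := HasDerivAt.eventually_sub_le hd (by linarith) hr
    filter_upwards [hev, Ioo_mem_nhdsLT ht.1] with s hs hs0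
    refine le_trans ?_ hs
    have h1 := truncEntropy_sub_le hm hq hn hQ (f s) (f t) (hf.nonneg s hs0.1.le)
      (hf.nonneg t ht.1.le)
    rw [← hlt, ← hlt] at h1
    linarith

end

/-! ### Monotonicity of the truncated entropy in the limit -/

section
variable {m α ζ : ℝ} {b : ℝ → ℝ} {B : Vel → Vel → ℝ → ℝ → ℝ → ℝ → ℝ} {blb bub : ℝ → ℝ → ℝ}

/-- Without mass, or if the angular part of the kernel vanishes, there are no collisions. -/
theorem IsState.integral_collOp_eq_zero (hK : IsHardKernel m α ζ b B blb bub) (hm : 0 < m)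
    {f : Vel × ℝ → ℝ} (hf : IsState m α b B f) (h : mass α f = 0 ∨ angConst b = 0)
    {ψ : Vel × ℝ → ℝ} (hψ : Measurable ψ) {C : ℝ}
    (hC : ∀ z : Vel × ℝ, 0 < z.2 → |ψ z| ≤ C * kin m z) :
    ∫ z, ψ z * collOp m α b B f f z ∂stateMeasure = 0 := by
  have e := (weak_form_symm hK hm hf.measurable hf.nonneg hf.gain_finite hf.loss_finite hψ hC).2
  have h0 : ∀ᵐ y : Coll ∂collMeasure m α b B, preDensity α f y = 0 := by
    rcases h with h | h
    · have hF := measurable_gasDensity α hf.measurable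
      have h1 : ∀ᵐ z ∂gasMeasure α, gasDensity α f z = 0 := by
        have h2 := (lintegral_eq_zero_iff hF.ennreal_ofReal).1 h
        filter_upwards [h2, ae_gasMeasure_pos α] with z hz hz0
        exact le_antisymm (ENNReal.ofReal_eq_zero.1 hz) (gasDensity_nonneg α f hz0)
      have h3 := ae_collMeasure_of_ae m α b B h1
      exact h3.mono fun y hy => by rw [preDensity, hy, zero_mul]
    · obtain ⟨C, -, h1⟩ := hK.exists_lintegral_le_angConst_mul hm
      have h2 := h1 (fun _ => 1) measurable_const
      rw [h, mul_zero, zero_mul, lintegral_one, nonpos_iff_eq_zero, Measure.measure_univ_eq_zero]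
        at h2
      rw [h2]
      simp
  have h1 : ∫ y : Coll, preDensity α f y * (ψ y.2.1 + ψ y.2.2 - (ψ y.1.1 + ψ y.1.2))
      ∂collMeasure m α b B = 0 := by
    rw [← integral_zero Coll ℝ (μ := collMeasure m α b B)]
    exact integral_congr_ae (h0.mono fun y hy => by simp only [hy, zero_mul])
  linarith

/-- The angular part of the kernel is integrable over the sphere. This is read off from the
finiteness of the loss term, which avoids computing the surface measure of spherical zones. -/
theorem IsState.angConst_ne_top (hK : IsHardKernel m α ζ b B blb bub) (hm : 0 < m)
    {f : Vel × ℝ → ℝ} (hf : IsState m α b B f) (h : mass α f ≠ 0) : angConst b ≠ ∞ := by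
  have hF := measurable_gasDensity α hf.measurable
  have h1 : ∫⁻ y : Coll, ENNReal.ofReal (gasDensity α f y.1.1) *
      ENNReal.ofReal (gasDensity α f y.1.2) ∂collMeasure m α b B ≠ ∞ := by
    have h2 := lintegral_loss (m := m) hK hf.measurable (φ := fun _ => 1) measurable_const
    simp only [one_mul] at h2
    rw [← h2]
    refine ne_top_of_le_ne_top hf.loss_finite.ne ?_
    rw [lintegral_energyMeasure hm]
    refine lintegral_mono_ae (ae_stateMeasure_pos.mono fun z hz => ?_)
    exact le_mul_of_one_le_left' (ENNReal.one_le_ofReal.2 (one_le_kin hm hz))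
  obtain ⟨c, hc, h2⟩ := hK.exists_const_mul_le hm
  have h3 := h2 (fun p => ENNReal.ofReal (gasDensity α f p.1) *
    ENNReal.ofReal (gasDensity α f p.2)) (by fun_prop)
  have h4 : ∫⁻ p, ENNReal.ofReal (gasDensity α f p.1) * ENNReal.ofReal (gasDensity α f p.2) *
      ENNReal.ofReal (relE m p ^ (ζ / 2)) ∂((gasMeasure α).prod (gasMeasure α)) ≠ 0 := by
    intro h5
    rw [lintegral_eq_zero_iff (by fun_prop)] at h5
    have h6 : mass α f * mass α f = 0 := by
      unfold mass
      rw [← lintegral_pair_mul hF.ennreal_ofReal hF.ennreal_ofReal,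
        lintegral_eq_zero_iff (by fun_prop)]
      filter_upwards [h5, ae_pair_pos α] with p hp hp0
      have he := relE_pos hm hp0.1 hp0.2
      have h7 : ENNReal.ofReal (relE m p ^ (ζ / 2)) ≠ 0 := by
        rw [ne_eq, ENNReal.ofReal_eq_zero, not_le]
        positivity
      exact (mul_eq_zero.1 hp).resolve_right h7
    exact h (mul_self_eq_zero.1 h6)
  intro hb
  rw [hb, ENNReal.mul_top hc, ENNReal.top_mul h4] at h3
  exact h1 (top_le_iff.1 h3)

theorem IsSolution.mass_eq_mass (hK : IsHardKernel m α ζ b B blb bub) (hm : 0 < m)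
    {f : ℝ → L12 m} (hf : IsSolution m α b B f) {t : ℝ} (ht : 0 ≤ t) :
    mass α (f t) = mass α (f 0) := by
  rw [mass_eq hm _ (hf.nonneg t ht), mass_eq hm _ (hf.nonneg 0 le_rfl),
    (hf.exists_conserved hK hm ht).1]

theorem tendsto_mul_exp_neg_div : Filter.Tendsto
    (fun n : ℝ => ENNReal.ofReal (n * Real.exp (-n / 8))) Filter.atTop (nhds 0) := by
  have h1 := tendsto_rpow_mul_exp_neg_mul_atTop_nhds_zero 1 (1 / 8) (by norm_num)
  have h2 := ENNReal.tendsto_ofReal h1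
  rw [ENNReal.ofReal_zero] at h2
  refine h2.congr fun n => ?_
  rw [Real.rpow_one]
  congr 3
  ring

/-- Along a solution, the truncated entropy does not increase, up to an error that vanishes as
the truncation is removed. -/
theorem IsSolution.exists_truncEntropy_le (hK : IsHardKernel m α ζ b B blb bub) (hm : 0 < m)
    (hα : -1 < α) {f : ℝ → L12 m} (hf : IsSolution m α b B f) {q : ℝ} (hq : 0 ≤ q)
    (hQ : ∫⁻ z, ENNReal.ofReal (kin m z ^ (-q)) ∂gasMeasure α ≠ ∞)
    (hQ' : ∫⁻ z, ENNReal.ofReal (kin m z ^ (-(q - 3 / 2))) ∂gasMeasure α ≠ ∞)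
    {T ε : ℝ} (hT : 0 ≤ T) (hε : 0 < ε) :
    ∃ n₀ : ℝ, ∀ n ≥ n₀, truncEntropy m α q n (f T) ≤ truncEntropy m α q n (f 0) + ε := by
  have hEn : ∀ t, 0 ≤ t → energy m α (f t) ≤ ENNReal.ofReal ‖f 0‖ := fun t ht => by
    rw [← (hf.exists_conserved hK hm ht).2]
    exact energy_le hm _
  by_cases hdeg : mass α (f 0) = 0 ∨ angConst b = 0
  · refine ⟨0, fun n hn => ?_⟩
    have := hf.truncEntropy_le hK hm hq hn hQ hT le_rfl (K := 0) fun t ht => ?_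
    · linarith
    · rw [zero_mul]
      refine ((hf.isState ht.1).integral_collOp_eq_zero hK hm ?_
        (measurable_trunc m q n (measurable_gasDensity α (measurable_coe_L12 (f t)))).log
        (C := n + q) fun z hz => abs_log_trunc_le hq hn (one_le_kin hm hz) _).le
      rwa [hf.mass_eq_mass hK hm ht.1.le]
  push Not at hdeg
  obtain ⟨hM, hb0⟩ := hdeg
  have hb : angConst b ≠ ∞ := (hf.isState one_pos).angConst_ne_top hK hm
    (by rwa [hf.mass_eq_mass hK hm zero_le_one])
  have hE : ENNReal.ofReal ‖f 0‖ ≠ ∞ := ENNReal.ofReal_ne_top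
  have hM' : mass α (f 0) ≠ ∞ :=
    ne_top_of_le_ne_top hE ((mass_le_energy hm _).trans (energy_le hm _))
  obtain ⟨c, hc, C, hsq⟩ := exists_sqrt_production hK hm hb0 hb hM hM' hE
  obtain ⟨κ, hκ, n₁, hn₁, hprod⟩ := exists_entropy_production_le hK hm hα hb0 hb hE hq hQ'
  -- `β` bounds the coefficient of `1 + Y` in the entropy production; through `1 + Y` being at most
  -- `1 / c` times the production of `√energy` plus a constant, it costs at most `ε` up to time `T`
  set A : ℝ := ‖f 0‖ + (|C| + c) * T + 1 with hA
  have hA0 : 0 < A := by positivity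
  set β : ℝ := 2 * c * ε / A with hβ
  have hβ0 : 0 < β := by positivity
  obtain ⟨δ, hδ0, hδ⟩ : ∃ δ : ℝ≥0∞, δ ≠ 0 ∧ κ * (δ + δ) ≤ ENNReal.ofReal β := by
    refine ⟨ENNReal.ofReal β / (2 * (κ + 1)), ?_, ?_⟩
    · rw [ne_eq, ENNReal.div_eq_zero_iff, not_or]
      exact ⟨by simpa using hβ0, by finiteness⟩
    · rw [← two_mul, ← mul_assoc, mul_comm κ 2]
      calc 2 * κ * (ENNReal.ofReal β / (2 * (κ + 1)))
          ≤ 2 * (κ + 1) * (ENNReal.ofReal β / (2 * (κ + 1))) := by gcongr; exact le_self_add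
        _ = ENNReal.ofReal β := ENNReal.mul_div_cancel (by simp) (by finiteness)
  obtain ⟨n₂, hn₂⟩ := exists_excessEnergy_le (α := α) hm isCompact_Icc
    (hf.continuousOn.mono (Icc_subset_Ici_self : Icc 0 T ⊆ Ici 0)) hδ0
  obtain ⟨n₃, hn₃⟩ := Filter.eventually_atTop.1
    (tendsto_mul_exp_neg_div.eventually_le_const (pos_iff_ne_zero.2 hδ0))
  refine ⟨max n₁ (max n₂ n₃), fun n hn => ?_⟩
  have hnn₁ : n₁ ≤ n := (le_max_left _ _).trans hn
  have hn0 : 0 ≤ n := by linarith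
  have key := hf.truncEntropy_le hK hm hq hn0 hQ hT (γ := β / (2 * c)) (by positivity)
    (K := |C| + c) fun t ht => ?_
  · refine key.trans (add_le_add le_rfl ?_)
    have h1 : β / (2 * c) = ε / A := by rw [hβ]; field_simp
    rw [h1, div_mul_eq_mul_div, div_le_iff₀ hA0]
    exact mul_le_mul_of_nonneg_left (by rw [hA]; linarith) hε.le
  have hst := hf.isState ht.1
  obtain ⟨hY, hYle⟩ := hsq _ hst (hf.mass_eq_mass hK hm ht.1.le) (hEn t ht.1.le)
  have h1 := hprod n hnn₁ _ hst (hEn t ht.1.le) hY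
    (ne_top_of_le_ne_top hE ((excessEnergy_le_energy _).trans (hEn t ht.1.le)))
  have h2 : κ * (excessEnergy m α n (f t) + ENNReal.ofReal (n * Real.exp (-n / 8))) *
      (1 + highMoment m α ζ (f t)) ≤ ENNReal.ofReal β * (1 + highMoment m α ζ (f t)) := by
    gcongr
    refine le_trans ?_ hδ
    gcongr
    · exact hn₂ n ((le_max_left _ _).trans ((le_max_right _ _).trans hn)) t ⟨ht.1.le, ht.2⟩
    · exact hn₃ n ((le_max_right _ _).trans ((le_max_right _ _).trans hn))
  have h3 := h1.trans (ENNReal.toReal_mono (by finiteness) h2)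
  rw [ENNReal.toReal_mul, ENNReal.toReal_ofReal hβ0.le, ENNReal.toReal_add (by simp) hY,
    ENNReal.toReal_one] at h3
  have h4 : 1 + (highMoment m α ζ (f t)).toReal ≤
      (∫ z, √(kin m z) * collOp m α b B (f t) (f t) z ∂stateMeasure + (|C| + c)) / c := by
    rw [le_div_iff₀ hc]
    linarith [le_abs_self C]
  have h5 := mul_le_mul_of_nonneg_left h4 hβ0.le
  calc _ ≤ β * ((∫ z, √(kin m z) * collOp m α b B (f t) (f t) z ∂stateMeasure +
          (|C| + c)) / c) / 2 := by linarith
    _ = _ := by field_simp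

end

/-! ### Scalar inequalities for the entropy -/

theorem le_entropyFun {q n x y : ℝ} (hn : 0 ≤ n) (hx : 1 ≤ x) (hy : 0 ≤ y) :
    y * Real.posLog (min y (Real.exp n)) ≤
      entropyFun q n x y + y * max 0 (-Real.log y) + y + lowCut q n x := by
  have ha := trunc_le (q := q) (n := n) hx hy
  have hN := Real.one_le_exp hn
  rcases hy.eq_or_lt with rfl | hy0
  · simp only [entropyFun]
    linarith
  have hmin : 0 < min y (Real.exp n) := lt_min hy0 (Real.exp_pos n)
  have h1 : Real.log (min y (Real.exp n)) ≤ Real.log (trunc q n x y) :=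
    Real.log_le_log hmin (le_max_right _ _)
  have h2 : Real.posLog (min y (Real.exp n)) ≤
      Real.log (min y (Real.exp n)) + max 0 (-Real.log y) := by
    rw [Real.posLog]
    refine max_le ?_ (by linarith [le_max_left 0 (-Real.log y)])
    rcases le_total y (Real.exp n) with h | h
    · rw [min_eq_left h]; linarith [le_max_right 0 (-Real.log y)]
    · rw [min_eq_right h, Real.log_exp]; linarith [le_max_left 0 (-Real.log y)]
  have h3 := mul_le_mul_of_nonneg_left (h2.trans (add_le_add_left h1 _)) hy
  unfold entropyFun
  linarith

theorem entropyFun_le {q n x y : ℝ} (hq : 0 ≤ q) (hn : 0 ≤ n) (hx : 1 ≤ x) (hy : 0 ≤ y) :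
    entropyFun q n x y ≤ y * Real.posLog y := by
  have hp := trunc_pos q n hx y
  have h1 : trunc q n x y ≤ max 1 y :=
    max_le_max (lowCut_le_one hq hn hx) (min_le_left _ _)
  have h2 : Real.log (trunc q n x y) ≤ Real.posLog y := by
    refine (Real.log_le_log hp h1).trans ?_
    rcases le_total 1 y with h | h
    · rw [max_eq_right h]; exact le_max_right _ _
    · rw [max_eq_left h, Real.log_one]; exact le_max_left _ _
  have h3 := mul_le_mul_of_nonneg_left h2 hy
  unfold entropyFun
  linarith

/-- The entropy of small values of the density is controlled by the energy: either
`√y ≤ x^(-q)`, or `|log y|` is at most of the order of `x`. -/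
theorem mul_neg_log_le {q x y : ℝ} (hq : 0 ≤ q) (hx : 1 ≤ x) (hy : 0 ≤ y) :
    y * max 0 (-Real.log y) ≤ 2 * q * (y * x) + 2 * x ^ (-q) := by
  have hx0 : 0 < x := by linarith
  have hp : 0 < x ^ (-q) := by positivity
  have hyx : 0 ≤ q * (y * x) := by positivity
  rcases hy.eq_or_lt with rfl | hy0
  · simp only [zero_mul, mul_zero]; linarith
  rw [mul_max_of_nonneg _ _ hy, mul_zero]
  refine max_le (by linarith) ?_
  rcases le_total (x ^ (-q)) √y with h | h
  · have h1 := Real.log_le_log hp h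
    rw [Real.log_rpow hx0, Real.log_sqrt hy] at h1
    have h2 : q * Real.log x ≤ q * x := mul_le_mul_of_nonneg_left (Real.log_le_self hx0.le) hq
    have h3 : -Real.log y ≤ 2 * (q * x) := by linarith
    have h4 := mul_le_mul_of_nonneg_left h3 hy
    linarith
  · have hs : 0 < √y := Real.sqrt_pos.2 hy0
    have h1 := Real.log_le_self (inv_pos.2 hs).le
    rw [Real.log_inv, Real.log_sqrt hy] at h1
    have h2 : -Real.log y ≤ 2 * (√y)⁻¹ := by linarith
    have h3 := mul_le_mul_of_nonneg_left h2 hy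
    have h4 : y * (2 * (√y)⁻¹) = 2 * √y := by
      nth_rw 1 [← Real.mul_self_sqrt hy]
      field_simp
    linarith

/-- The weight `log I` costs nothing new: for small `I`, either the density is at most an
integrable function, or `|log I|` is controlled by `log⁺` of the density and the energy. -/
theorem mul_abs_log_intensity_le {m q x y I : ℝ} (hm : 0 < m) (hq : 0 ≤ q) (hx : 1 ≤ x)
    (hy : 0 ≤ y) (hI : 0 < I) (hIx : I ≤ m * x) :
    y * |Real.log I| ≤ 2 * (y * Real.posLog y) + (m + 2 * q) * (y * x) +
      4 * (I ^ (-(3 / 4 : ℝ)) * x ^ (-q)) := by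
  have hx0 : 0 < x := by linarith
  have hl : 0 ≤ Real.posLog y := Real.posLog_nonneg
  have hyl : 0 ≤ y * Real.posLog y := mul_nonneg hy hl
  have hyx : 0 ≤ y * x := by positivity
  have hmy : 0 ≤ m * (y * x) := by positivity
  have hqy : 0 ≤ q * (y * x) := by positivity
  have hIq : 0 ≤ I ^ (-(3 / 4 : ℝ)) * x ^ (-q) := by positivity
  rcases le_total 1 I with h | h
  · rw [abs_of_nonneg (Real.log_nonneg h)]
    have h1 : Real.log I ≤ m * x := (Real.log_le_self hI.le).trans hIx
    have h2 := mul_le_mul_of_nonneg_left h1 hy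
    nlinarith
  · rw [abs_of_nonpos (Real.log_nonpos hI.le h)]
    rcases le_total y (I ^ (-(1 / 2 : ℝ)) * x ^ (-q)) with h1 | h1
    · have h2 : -Real.log I ≤ 4 * I ^ (-(1 / 4 : ℝ)) := by
        have := Real.log_le_self (Real.rpow_nonneg hI.le (-(1 / 4 : ℝ)))
        rw [Real.log_rpow hI] at this
        linarith
      have h3 : y * -Real.log I ≤ (I ^ (-(1 / 2 : ℝ)) * x ^ (-q)) * (4 * I ^ (-(1 / 4 : ℝ))) :=
        mul_le_mul h1 h2 (by linarith [Real.log_nonpos hI.le h]) (by positivity)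
      have h4 : I ^ (-(3 / 4 : ℝ)) = I ^ (-(1 / 2 : ℝ)) * I ^ (-(1 / 4 : ℝ)) := by
        rw [← Real.rpow_add hI]; norm_num
      rw [h4] at hIq ⊢
      nlinarith
    · have hp : 0 < I ^ (-(1 / 2 : ℝ)) * x ^ (-q) := by positivity
      have h2 := Real.log_le_log hp h1
      rw [Real.log_mul (by positivity) (by positivity), Real.log_rpow hI, Real.log_rpow hx0] at h2
      have h3 : Real.log y ≤ Real.posLog y := le_max_right _ _
      have h4 : q * Real.log x ≤ q * x := mul_le_mul_of_nonneg_left (Real.log_le_self hx0.le) hq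
      have h5 : -Real.log I ≤ 2 * Real.posLog y + 2 * (q * x) := by linarith
      have h6 := mul_le_mul_of_nonneg_left h5 hy
      nlinarith

theorem mul_posLog_mul_rpow_le {m q x y I : ℝ} (α : ℝ) (hm : 0 < m) (hq : 0 ≤ q) (hx : 1 ≤ x)
    (hy : 0 ≤ y) (hI : 0 < I) (hIx : I ≤ m * x) :
    y * Real.posLog (y * I ^ (-α)) ≤ (1 + 2 * |α|) * (y * Real.posLog y) +
      |α| * (m + 2 * q) * (y * x) + 4 * |α| * (I ^ (-(3 / 4 : ℝ)) * x ^ (-q)) := by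
  have h1 : Real.posLog (I ^ (-α)) ≤ |α| * |Real.log I| := by
    rw [Real.posLog, Real.log_rpow hI, ← abs_mul]
    refine max_le (abs_nonneg _) ?_
    rw [neg_mul]
    exact neg_le_abs _
  have h2 : Real.posLog (y * I ^ (-α)) ≤ Real.posLog y + |α| * |Real.log I| :=
    Real.posLog_mul.trans (add_le_add_right h1 _)
  have h3 := mul_le_mul_of_nonneg_left h2 hy
  have h4 := mul_le_mul_of_nonneg_left (mul_abs_log_intensity_le hm hq hx hy hI hIx) (abs_nonneg α)
  linarith

theorem mul_posLog_le_rpow {p y : ℝ} (hp : 1 < p) (hy : 0 ≤ y) :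
    y * Real.posLog y ≤ y ^ p / (p - 1) := by
  have hp1 : 0 < p - 1 := by linarith
  rcases hy.eq_or_lt with rfl | hy0
  · rw [zero_mul, Real.zero_rpow (by linarith), zero_div]
  have h1 : Real.posLog y ≤ y ^ (p - 1) / (p - 1) :=
    max_le (by positivity) (Real.log_le_rpow_div hy hp1)
  calc y * Real.posLog y ≤ y * (y ^ (p - 1) / (p - 1)) := mul_le_mul_of_nonneg_left h1 hy
    _ = y ^ p / (p - 1) := by
        rw [← mul_div_assoc]
        congr 1
        nth_rw 1 [← Real.rpow_one y]
        rw [← Real.rpow_add hy0]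
        congr 1
        ring

/-! ### Bounds for the initial entropy and removal of the truncation -/

/-- The bound on `∫ f log⁺ f` provided by the energy `A` and the `L^p` norm `D` of `f`. -/
noncomputable def posLogBound (p : ℝ≥0∞) (A D : ℝ) : ℝ :=
  if p = ∞ then Real.posLog D * A else D ^ p.toReal / (p.toReal - 1)

section
variable {m : ℝ}

theorem integral_mul_posLog_le (hm : 0 < m) {p : ℝ≥0∞} (hp : 1 < p) (f : L12 m)
    (hf0 : ∀ᵐ z ∂stateMeasure, 0 ≤ f z) (hfp : MemLp f p stateMeasure) :
    Integrable (fun z => f z * Real.posLog (f z)) stateMeasure ∧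
    ∫ z, f z * Real.posLog (f z) ∂stateMeasure ≤
      posLogBound p ‖f‖ (eLpNorm f p stateMeasure).toReal := by
  have hf := measurable_coe_L12 f
  have hmeas : AEStronglyMeasurable (fun z => f z * Real.posLog (f z)) stateMeasure :=
    (hf.mul (Real.continuous_posLog.measurable.comp hf)).aestronglyMeasurable
  have hnorm : ∀ᵐ z ∂stateMeasure, ‖f z * Real.posLog (f z)‖ = f z * Real.posLog (f z) := by
    filter_upwards [hf0] with z hz
    exact Real.norm_of_nonneg (mul_nonneg hz Real.posLog_nonneg)
  unfold posLogBound
  split_ifs with h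
  · subst h
    set D := (eLpNorm f ∞ stateMeasure).toReal with hD
    have hb : ∀ᵐ z ∂stateMeasure, f z * Real.posLog (f z) ≤ Real.posLog D * (kin m z * |f z|) := by
      have h1 : ∀ᵐ z ∂stateMeasure, ‖f z‖ₑ ≤ eLpNorm f ∞ stateMeasure := by
        rw [eLpNorm_exponent_top]; exact ae_le_eLpNormEssSup
      filter_upwards [h1, hf0, ae_stateMeasure_pos] with z h1 hz hz0
      have h2 : f z ≤ D := by
        have := ENNReal.toReal_mono hfp.2.ne h1
        rw [toReal_enorm, Real.norm_of_nonneg hz] at this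
        exact this
      have h3 : f z ≤ kin m z * |f z| := by
        rw [abs_of_nonneg hz]; exact le_mul_of_one_le_left hz (one_le_kin hm hz0)
      rw [mul_comm]
      exact mul_le_mul (Real.posLog_le_posLog hz h2) h3 hz Real.posLog_nonneg
    have hi := (integrable_kin_mul_abs hm f).const_mul (Real.posLog D)
    have hi2 : Integrable (fun z => f z * Real.posLog (f z)) stateMeasure := by
      refine hi.mono' hmeas ?_
      filter_upwards [hb, hnorm] with z h1 h2
      rw [h2]; exact h1
    refine ⟨hi2, (integral_mono_ae hi2 hi hb).trans (le_of_eq ?_)⟩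
    rw [integral_const_mul, norm_L12 hm]
  · have hp1 : 1 < p.toReal := by
      rw [← ENNReal.toReal_one]
      exact (ENNReal.toReal_lt_toReal (by simp) h).2 hp
    have hi : Integrable (fun z => ‖f z‖ ^ p.toReal) stateMeasure :=
      hfp.integrable_norm_rpow (by positivity) h
    have hb : ∀ᵐ z ∂stateMeasure, f z * Real.posLog (f z) ≤ ‖f z‖ ^ p.toReal / (p.toReal - 1) := by
      filter_upwards [hf0] with z hz
      rw [Real.norm_of_nonneg hz]
      exact mul_posLog_le_rpow hp1 hz
    have hi' := hi.div_const (p.toReal - 1)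
    have hi2 : Integrable (fun z => f z * Real.posLog (f z)) stateMeasure := by
      refine hi'.mono' hmeas ?_
      filter_upwards [hb, hnorm] with z h1 h2
      rw [h2]; exact h1
    refine ⟨hi2, (integral_mono_ae hi2 hi' hb).trans (le_of_eq ?_)⟩
    rw [integral_div, hfp.eLpNorm_eq_integral_rpow_norm (by positivity) h,
      ENNReal.toReal_ofReal (by positivity), ← Real.rpow_mul (by positivity),
      inv_mul_cancel₀ (by linarith), Real.rpow_one]

theorem integrable_kin_rpow {β q : ℝ} (hm : 0 < m)
    (hQ : ∫⁻ z, ENNReal.ofReal (kin m z ^ (-q)) ∂gasMeasure β ≠ ∞) :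
    Integrable (fun z => kin m z ^ (-q)) (gasMeasure β) := by
  refine ⟨((measurable_kin m).pow_const _).aestronglyMeasurable, ?_⟩
  rw [hasFiniteIntegral_iff_ofReal]
  · exact lt_top_iff_ne_top.2 hQ
  · filter_upwards [ae_gasMeasure_pos β] with z hz
    have := one_le_kin hm hz
    positivity

theorem integral_gasMeasure_eq (β : ℝ) (h : Vel × ℝ → ℝ) :
    ∫ z, h z ∂gasMeasure β = ∫ z, z.2 ^ β * h z ∂stateMeasure := by
  unfold gasMeasure
  rw [integral_withDensity_eq_integral_toReal_smul (by fun_prop) (by simp)]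
  refine integral_congr_ae (ae_stateMeasure_pos.mono fun z hz => ?_)
  simp only
  rw [ENNReal.toReal_ofReal (by positivity), smul_eq_mul]

theorem integrable_gasMeasure_iff (β : ℝ) (h : Vel × ℝ → ℝ) :
    Integrable h (gasMeasure β) ↔ Integrable (fun z => z.2 ^ β * h z) stateMeasure := by
  unfold gasMeasure
  rw [integrable_withDensity_iff_integrable_smul' (by fun_prop) (by simp)]
  refine integrable_congr (ae_stateMeasure_pos.mono fun z hz => ?_)
  simp only
  rw [ENNReal.toReal_ofReal (by positivity), smul_eq_mul]

/-- The bound on the positive part of the initial entropy. The measure `I^(-3/4) dv dI` comes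
from the weight `log I`. -/
noncomputable def initialBound (m α q : ℝ) (p : ℝ≥0∞) (A D : ℝ) : ℝ :=
  (1 + 2 * |α|) * posLogBound p A D + |α| * (m + 2 * q) * A +
    4 * |α| * ∫ z, kin m z ^ (-q) ∂gasMeasure (-(3 / 4))

/-- The positive part of the initial entropy is controlled by the energy and the `L^p` norm. -/
theorem integral_gasDensity_posLog_le {α q : ℝ} (hm : 0 < m) (hq : 0 ≤ q) {p : ℝ≥0∞} (hp : 1 < p)
    (hQ : ∫⁻ z, ENNReal.ofReal (kin m z ^ (-q)) ∂gasMeasure (-(3 / 4)) ≠ ∞) (f : L12 m)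
    (hf0 : ∀ᵐ z ∂stateMeasure, 0 ≤ f z) (hfp : MemLp f p stateMeasure) :
    Integrable (fun z => gasDensity α f z * Real.posLog (gasDensity α f z)) (gasMeasure α) ∧
    ∫ z, gasDensity α f z * Real.posLog (gasDensity α f z) ∂gasMeasure α ≤
      initialBound m α q p ‖f‖ (eLpNorm f p stateMeasure).toReal := by
  have hF := measurable_gasDensity α (measurable_coe_L12 f)
  have hlog : Measurable fun z => Real.posLog (gasDensity α f z) :=
    Real.continuous_posLog.measurable.comp hF
  obtain ⟨i1, b1⟩ := integral_mul_posLog_le hm hp f hf0 hfp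
  have i2 := integrable_kin_mul_abs hm f
  have i3 := (integrable_gasMeasure_iff _ _).1 (integrable_kin_rpow hm hQ)
  have i4 := ((i1.const_mul (1 + 2 * |α|)).add (i2.const_mul (|α| * (m + 2 * q)))).add
    (i3.const_mul (4 * |α|))
  have hb : ∀ᵐ z ∂stateMeasure, Real.posLog (gasDensity α f z) * f z ≤
      (1 + 2 * |α|) * (f z * Real.posLog (f z)) + |α| * (m + 2 * q) * (kin m z * |f z|) +
        4 * |α| * (z.2 ^ (-(3 / 4 : ℝ)) * kin m z ^ (-q)) := by
    filter_upwards [hf0, ae_stateMeasure_pos] with z hz hz0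
    have hIx : z.2 ≤ m * kin m z := by
      unfold kin
      have : m * (z.2 / m) = z.2 := by field_simp
      nlinarith [mul_nonneg hm.le (sq_nonneg ‖z.1‖)]
    have := mul_posLog_mul_rpow_le α hm hq (one_le_kin hm hz0) hz hz0 hIx
    rw [abs_of_nonneg hz, gasDensity, max_eq_left hz, mul_comm _ (f z), mul_comm (kin m z)]
    exact this
  have i5 : Integrable (fun z => Real.posLog (gasDensity α f z) * f z) stateMeasure := by
    refine i4.mono' (hlog.mul (measurable_coe_L12 f)).aestronglyMeasurable ?_
    filter_upwards [hb, hf0] with z h1 hz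
    rw [Real.norm_of_nonneg (mul_nonneg Real.posLog_nonneg hz)]
    exact h1
  have e := integral_gasDensity α hf0 (fun z => Real.posLog (gasDensity α f z))
  have i6 := integrable_gasDensity α hf0 i5
  simp only [mul_comm (Real.posLog _)] at e i6
  refine ⟨i6, e.trans_le ?_⟩
  simp only [mul_comm (f _) (Real.posLog (gasDensity α f _))]
  refine (integral_mono_ae i5 i4 hb).trans ?_
  have e4 : ∫ z, (1 + 2 * |α|) * (f z * Real.posLog (f z)) +
      |α| * (m + 2 * q) * (kin m z * |f z|) +
      4 * |α| * (z.2 ^ (-(3 / 4 : ℝ)) * kin m z ^ (-q)) ∂stateMeasure =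
      (1 + 2 * |α|) * ∫ z, f z * Real.posLog (f z) ∂stateMeasure + |α| * (m + 2 * q) * ‖f‖ +
        4 * |α| * ∫ z, kin m z ^ (-q) ∂gasMeasure (-(3 / 4)) := by
    have s1 : Integrable (fun z => (1 + 2 * |α|) * (f z * Real.posLog (f z)) +
      |α| * (m + 2 * q) * (kin m z * |f z|)) stateMeasure :=
      (i1.const_mul (1 + 2 * |α|)).add (i2.const_mul (|α| * (m + 2 * q)))
    rw [integral_add s1 (i3.const_mul (4 * |α|)), integral_add (i1.const_mul _) (i2.const_mul _),
      integral_const_mul, integral_const_mul, integral_const_mul, ← norm_L12 hm,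
      ← integral_gasMeasure_eq]
  refine (le_of_eq e4).trans ?_
  unfold initialBound
  gcongr

/-- The truncated entropy controls the positive part of the entropy, with the logarithm cut off
at `n`. -/
theorem integral_posLog_min_le {α q n : ℝ} (hm : 0 < m) (hq : 0 ≤ q) (hn : 0 ≤ n)
    (hQ : ∫⁻ z, ENNReal.ofReal (kin m z ^ (-q)) ∂gasMeasure α ≠ ∞) (f : L12 m)
    (hf0 : ∀ᵐ z ∂stateMeasure, 0 ≤ f z) :
    ∫⁻ z, ENNReal.ofReal (gasDensity α f z * Real.posLog (min (gasDensity α f z) (Real.exp n)))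
      ∂gasMeasure α ≤ ENNReal.ofReal (truncEntropy m α q n f + (2 * q + 1) * ‖f‖ +
        3 * ∫ z, kin m z ^ (-q) ∂gasMeasure α) := by
  have i1 := integrable_entropyFun hm hq hn hQ f hf0
  have i2 := integrable_gasDensity α hf0 (integrable_kin_mul hm f)
  have i3 := integrable_kin_rpow hm hQ
  have hb : ∀ᵐ z ∂gasMeasure α,
      gasDensity α f z * Real.posLog (min (gasDensity α f z) (Real.exp n)) ≤
      entropyFun q n (kin m z) (gasDensity α f z) +
      (2 * q + 1) * (kin m z * gasDensity α f z) + 3 * kin m z ^ (-q) := by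
    filter_upwards [ae_gasMeasure_pos α] with z hz
    have hx := one_le_kin hm hz
    have hy := gasDensity_nonneg α f hz
    have h1 := le_entropyFun (q := q) hn hx hy
    have h2 := mul_neg_log_le hq hx hy
    have h3 : lowCut q n (kin m z) ≤ kin m z ^ (-q) :=
      mul_le_of_le_one_left (by positivity) (Real.exp_le_one_iff.2 (by linarith))
    have h4 : gasDensity α f z ≤ gasDensity α f z * kin m z := le_mul_of_one_le_right hy hx
    linarith
  have s1 : Integrable (fun z => entropyFun q n (kin m z) (gasDensity α f z) +
      (2 * q + 1) * (kin m z * gasDensity α f z)) (gasMeasure α) := i1.add (i2.const_mul _)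
  have s2 : Integrable (fun z => entropyFun q n (kin m z) (gasDensity α f z) +
      (2 * q + 1) * (kin m z * gasDensity α f z) + 3 * kin m z ^ (-q)) (gasMeasure α) :=
    s1.add (i3.const_mul _)
  have e : ∫ z, (entropyFun q n (kin m z) (gasDensity α f z) +
      (2 * q + 1) * (kin m z * gasDensity α f z) + 3 * kin m z ^ (-q)) ∂gasMeasure α =
      truncEntropy m α q n f + (2 * q + 1) * ‖f‖ + 3 * ∫ z, kin m z ^ (-q) ∂gasMeasure α := by
    rw [integral_add s1 (i3.const_mul _), integral_add i1 (i2.const_mul _), integral_const_mul,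
      integral_const_mul, integral_gasDensity α hf0, norm_L12 hm, truncEntropy]
    congr 3
    exact integral_congr_ae (hf0.mono fun z hz => by simp only; rw [abs_of_nonneg hz])
  rw [← e, ofReal_integral_eq_lintegral_ofReal s2]
  · exact lintegral_mono_ae (hb.mono fun z hz => ENNReal.ofReal_le_ofReal hz)
  · filter_upwards [hb, ae_gasMeasure_pos α] with z h1 hz
    exact (mul_nonneg (gasDensity_nonneg α f hz) Real.posLog_nonneg).trans h1

/-- Removal of the truncation, by Fatou's lemma. -/
theorem lintegral_posLog_le {α : ℝ} {f : Vel × ℝ → ℝ} (hf : Measurable f) {K : ℝ≥0∞} {n₀ : ℝ}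
    (h : ∀ n ≥ n₀, ∫⁻ z, ENNReal.ofReal (gasDensity α f z *
      Real.posLog (min (gasDensity α f z) (Real.exp n))) ∂gasMeasure α ≤ K) :
    ∫⁻ z, ENNReal.ofReal (gasDensity α f z * Real.posLog (gasDensity α f z)) ∂gasMeasure α ≤ K := by
  have hF := measurable_gasDensity α hf
  have h1 : ∀ z, Filter.Tendsto (fun k : ℕ => ENNReal.ofReal (gasDensity α f z *
      Real.posLog (min (gasDensity α f z) (Real.exp k)))) Filter.atTop
      (nhds (ENNReal.ofReal (gasDensity α f z * Real.posLog (gasDensity α f z)))) := by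
    intro z
    refine tendsto_const_nhds.congr' ?_
    have h2 := (Real.tendsto_exp_atTop.comp tendsto_natCast_atTop_atTop).eventually_ge_atTop
      (gasDensity α f z)
    filter_upwards [h2] with k hk
    rw [min_eq_left (by simpa using hk)]
  calc _ = ∫⁻ z, Filter.liminf (fun k : ℕ => ENNReal.ofReal (gasDensity α f z *
        Real.posLog (min (gasDensity α f z) (Real.exp k)))) Filter.atTop ∂gasMeasure α :=
        lintegral_congr fun z => (h1 z).liminf_eq.symm
    _ ≤ Filter.liminf (fun k : ℕ => ∫⁻ z, ENNReal.ofReal (gasDensity α f z *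
        Real.posLog (min (gasDensity α f z) (Real.exp k))) ∂gasMeasure α) Filter.atTop :=
        lintegral_liminf_le fun k => (hF.mul (Real.continuous_posLog.measurable.comp
          (hF.min measurable_const))).ennreal_ofReal
    _ ≤ K := by
        refine Filter.liminf_le_of_frequently_le' (Filter.Eventually.frequently ?_)
        filter_upwards [Filter.eventually_ge_atTop ⌈n₀⌉₊] with k hk
        exact h k (Nat.ceil_le.1 hk)

theorem entropyH_le_posLog_add {α q : ℝ} (hm : 0 < m) (hq : 0 ≤ q) (f : L12 m) :
    entropyH α f ≤
      ∫⁻ z, ENNReal.ofReal (gasDensity α f z * Real.posLog (gasDensity α f z)) ∂gasMeasure α +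
      (ENNReal.ofReal (2 * q * ‖f‖) +
        2 * ∫⁻ z, ENNReal.ofReal (kin m z ^ (-q)) ∂gasMeasure α) := by
  have hf := measurable_coe_L12 f
  have hF := measurable_gasDensity α hf
  have e1 : entropyH α f = ∫⁻ z, ENNReal.ofReal (gasDensity α f z) *
      ENNReal.ofReal |Real.log (gasDensity α f z)| ∂gasMeasure α := by
    rw [lintegral_gasDensity α hf _ (by fun_prop), entropyH]
    refine lintegral_congr fun z => ?_
    rw [ENNReal.ofReal_mul' (abs_nonneg _)]
    rcases le_total (f z) 0 with h | h
    · rw [ENNReal.ofReal_of_nonpos h, zero_mul, zero_mul]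
    · rw [gasDensity, max_eq_left h]
  have e2 : ENNReal.ofReal (2 * q * ‖f‖) ≥ ∫⁻ z, ENNReal.ofReal (2 * q) *
      (ENNReal.ofReal (gasDensity α f z) * ENNReal.ofReal (kin m z)) ∂gasMeasure α := by
    rw [lintegral_const_mul _ (by fun_prop), ENNReal.ofReal_mul (by positivity)]
    exact mul_le_mul_right (energy_le hm f) _
  have hlog : Measurable fun z => Real.posLog (gasDensity α f z) :=
    Real.continuous_posLog.measurable.comp hF
  rw [e1]
  refine le_trans ?_ (add_le_add le_rfl (add_le_add e2 le_rfl))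
  rw [← lintegral_const_mul _ (by fun_prop), ← lintegral_add_left (by fun_prop),
    ← lintegral_add_left (by fun_prop)]
  refine lintegral_mono_ae ((ae_gasMeasure_pos α).mono fun z hz => ?_)
  have hx := one_le_kin hm hz
  have hy := gasDensity_nonneg α f hz
  have h1 := mul_neg_log_le hq hx hy
  have h2 : |Real.log (gasDensity α f z)| ≤
      Real.posLog (gasDensity α f z) + max 0 (-Real.log (gasDensity α f z)) := by
    rw [Real.posLog, abs_le']
    constructor
    · linarith [le_max_right 0 (Real.log (gasDensity α f z)),
        le_max_left 0 (-Real.log (gasDensity α f z))]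
    · linarith [le_max_left 0 (Real.log (gasDensity α f z)),
        le_max_right 0 (-Real.log (gasDensity α f z))]
  have h3 := mul_le_mul_of_nonneg_left h2 hy
  have hp : 0 ≤ gasDensity α f z * Real.posLog (gasDensity α f z) :=
    mul_nonneg hy Real.posLog_nonneg
  have hk : 0 ≤ kin m z ^ (-q) := by positivity
  rw [← ENNReal.ofReal_mul hy, ← ENNReal.ofReal_mul hy, ← ENNReal.ofReal_mul (by positivity),
    show (2 : ℝ≥0∞) * ENNReal.ofReal (kin m z ^ (-q)) = ENNReal.ofReal (2 * kin m z ^ (-q)) by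
      rw [ENNReal.ofReal_mul (by norm_num), ENNReal.ofReal_ofNat],
    ← ENNReal.ofReal_add (by positivity) (by positivity),
    ← ENNReal.ofReal_add hp (by positivity)]
  exact ENNReal.ofReal_le_ofReal (by linarith)

end

section
variable {m α ζ : ℝ} {b : ℝ → ℝ} {B : Vel → Vel → ℝ → ℝ → ℝ → ℝ → ℝ} {blb bub : ℝ → ℝ → ℝ}

/-- The bound on the entropy of a solution, for any large enough weight exponent `q`, in terms
of the energy `A` and the `L^p` norm `D` of its initial datum. -/
noncomputable def entropyBound (m α q : ℝ) (p : ℝ≥0∞) (A D : ℝ) : ℝ :=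
  max 0 (initialBound m α q p A D + 1 + (2 * q + 1) * A +
    3 * ∫ z, kin m z ^ (-q) ∂gasMeasure α) + (2 * q * A + 2 * ∫ z, kin m z ^ (-q) ∂gasMeasure α)

theorem IsSolution.entropyH_le (hK : IsHardKernel m α ζ b B blb bub) (hm : 0 < m)
    (hα : -1 < α) {f : ℝ → L12 m} (hf : IsSolution m α b B f) {p : ℝ≥0∞} (hp : 1 < p)
    (hfp : MemLp (f 0) p stateMeasure) {q : ℝ} (hq : 9 / 2 < q) (hqα : 2 * (α + 1) + 3 / 2 < q)
    {t : ℝ} (ht : 0 ≤ t) :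
    entropyH α (f t) ≤
      ENNReal.ofReal (entropyBound m α q p ‖f 0‖ (eLpNorm (f 0) p stateMeasure).toReal) := by
  have hq0 : 0 ≤ q := by linarith
  have hQ := (lintegral_kin_rpow_lt_top hm hα (q := q) (by linarith) (by linarith)).ne
  have hQ' := (lintegral_kin_rpow_lt_top hm hα (q := q - 3 / 2) (by linarith) (by linarith)).ne
  have hQ₀ := (lintegral_kin_rpow_lt_top hm (β := -(3 / 4)) (q := q) (by norm_num) (by linarith)
    (by linarith)).ne
  obtain ⟨i0, h0⟩ := integral_gasDensity_posLog_le (α := α) hm hq0 hp hQ₀ (f 0)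
    (hf.nonneg 0 le_rfl) hfp
  obtain ⟨n₀, hn₀⟩ := hf.exists_truncEntropy_le hK hm hα hq0 hQ hQ' ht one_pos
  have hE := (hf.exists_conserved hK hm ht).2
  have h1 := lintegral_posLog_le (α := α) (measurable_coe_L12 (f t)) (n₀ := max n₀ 0)
    (K := ENNReal.ofReal (initialBound m α q p ‖f 0‖ (eLpNorm (f 0) p stateMeasure).toReal + 1 +
      (2 * q + 1) * ‖f 0‖ + 3 * ∫ z, kin m z ^ (-q) ∂gasMeasure α)) fun n hn => ?_
  · have h2 := entropyH_le_posLog_add (α := α) hm hq0 (f t)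
    refine h2.trans ?_
    have hI : 0 ≤ ∫ z, kin m z ^ (-q) ∂gasMeasure α :=
      integral_nonneg_of_ae ((ae_gasMeasure_pos α).mono fun z hz => by
        have := one_le_kin hm hz
        simp only [Pi.zero_apply]
        positivity)
    have e : ∫⁻ z, ENNReal.ofReal (kin m z ^ (-q)) ∂gasMeasure α =
        ENNReal.ofReal (∫ z, kin m z ^ (-q) ∂gasMeasure α) := by
      rw [ofReal_integral_eq_lintegral_ofReal (integrable_kin_rpow hm hQ)]
      filter_upwards [ae_gasMeasure_pos α] with z hz
      have := one_le_kin hm hz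
      simp only [Pi.zero_apply]
      positivity
    rw [e, hE, entropyBound, ENNReal.ofReal_add (le_max_left _ _) (by positivity),
      ENNReal.ofReal_add (by positivity) (by positivity), ENNReal.ofReal_mul (p := 2) (by norm_num),
      ENNReal.ofReal_ofNat]
    refine add_le_add (h1.trans (ENNReal.ofReal_le_ofReal (le_max_right _ _))) le_rfl
  · have hn0 : 0 ≤ n := (le_max_right _ _).trans hn
    refine (integral_posLog_min_le hm hq0 hn0 hQ (f t) (hf.nonneg t ht)).trans
      (ENNReal.ofReal_le_ofReal ?_)
    have h3 := hn₀ n ((le_max_left _ _).trans hn)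
    have h4 : truncEntropy m α q n (f 0) ≤
        ∫ z, gasDensity α (f 0) z * Real.posLog (gasDensity α (f 0) z) ∂gasMeasure α := by
      refine integral_mono_ae (integrable_entropyFun hm hq0 hn0 hQ (f 0) (hf.nonneg 0 le_rfl)) i0 ?_
      filter_upwards [ae_gasMeasure_pos α] with z hz
      exact entropyFun_le hq0 hn0 (one_le_kin hm hz) (gasDensity_nonneg α _ hz)
    rw [hE]
    linarith

end

end PolyBoltzmann

theorem mainTheorem6 (m : ℝ) (hm : 0 < m) (α : ℝ) (hα : -1 < α) (p : ℝ≥0∞) (hp : 1 < p) :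
    ∃ C : ℝ → ℝ → ℝ,
      ∀ (ζ : ℝ) (b : ℝ → ℝ)
        (B : PolyBoltzmann.Vel → PolyBoltzmann.Vel → ℝ → ℝ → ℝ → ℝ → ℝ)
        (blb bub : ℝ → ℝ → ℝ),
        PolyBoltzmann.IsHardKernel m α ζ b B blb bub →
      ∀ f : ℝ → PolyBoltzmann.L12 m,
        PolyBoltzmann.IsSolution m α b B f →
        MemLp (f 0) p PolyBoltzmann.stateMeasure →
      ∀ t : ℝ, 0 ≤ t →
        PolyBoltzmann.entropyH α (f t) ≤
          ENNReal.ofReal (C ‖f 0‖ (eLpNorm (f 0) p PolyBoltzmann.stateMeasure).toReal) := by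
  -- any exponent above `9 / 2` and `2 * (α + 1) + 3 / 2` makes the weights `x ^ (-q)` integrable
  refine ⟨PolyBoltzmann.entropyBound m α (2 * |α| + 10) p, fun ζ b B blb bub hK f hf hfp t ht => ?_⟩
  exact hf.entropyH_le hK hm hα hp hfp (by linarith [abs_nonneg α])
    (by linarith [le_abs_self α, abs_nonneg α]) ht
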